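/- Let \(K\) be a field of characteristic zero; all vector spaces are over \(K\), all gradings are by \(\mathbb{Z}\), and signs follow the Koszul rule. Let \((A,\delta)\) be a commutative unital DG algebra, and let \((\mathcal K,\delta_0)\) be a DG Lie–Rinehart algebra over \((A,\delta)\): a DG \(A\)-module with a graded Lie bracket and an action of the graded Lie algebra \(\mathcal K\) on \(A\) by derivations such that \((aq)\cdot b=a(q\cdot b)\) and \([aq,r]=a[q,r]-(-1)^{r(a+q)}(r\cdot a)q\), and such that the differentials are compatible with module structure, bracket and action. Let \((\underline{\mathcal K},\underline\delta)\) be a DG module over \((A,\delta)\). Contraction data for a complex \((V,d)\) over a complex \((W,d')\) are cochain maps \(p:V\to W\), \(j:W\to V\) of degree \(0\) and a map \(h:V\to V\) of degree \(-1\) with \(pj=\mathrm{id}\), \(hd+dh=\mathrm{id}-jp\), \(h^2=0\), \(hj=0\), \(ph=0\). Let \((p_0,j_0,h_0)\) be contraction data for \((\mathcal K,\delta_0)\) over \((\underline{\mathcal K},\underline\delta)\) that are \(A\)-linear (in the graded sense). Extend \(\delta_0\) and \(\underline\delta\) to derivations of the graded symmetric algebras \(S_A\mathcal K\) and \(S_A\underline{\mathcal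 K}\), restricting to \(\delta\) on \(A\); extend \(p_0,j_0\) to algebra morphisms that are the identity on \(A\); let \(h'\) be the \(A\)-linear derivation of \(S_A\mathcal K\) extending \(h_0\). Put \(\mathcal Z=\ker p_0\), so that \(S_A\mathcal K\cong\bigoplus_i S_A\underline{\mathcal K}\otimes_A S_A^i\mathcal Z\), and extend \(h_0\) to \(S_A\mathcal K\) by \(0\) on the summand \(i=0\) and by \(\frac1i h'\) on the summand \(i>0\). Let \((U(\mathcal K),\delta)\) be the universal enveloping DG algebra of \(\mathcal K\), and let \(U_k(\mathcal K)\) be the left \(A\)-submodule generated by products of at most \(k\) elements of \(\mathcal K\) (with \(U_{-1}=0\)). Let \(\mathsf{PBW}:S_A\mathcal K\to U(\mathcal K)\) be an isomorphism of filtered graded \(A\)-modules, with \(S_A\mathcal K\) filtered by \(S_A^{\le k}\mathcal K\), such that for all \(k\) and all \(q_1,\dots,q_k\in\mathcal K\), \[\mathsf{PBW}(q_1\odot\cdots\odot q_k)-q_1\cdots q_k\in U_{k-1}(\mathcal K).\] Put \(t:=\delta_0-\mathsf{PBW}^{-1}\circ\delta\circ\mathsf{PBW}\) on \(S_A\mathcal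 K\). Then: 1. The extended \((p_0,j_0,h_0)\) are contraction data for \((S_A\mathcal K,\delta_0)\) over \((S_A\underline{\mathcal K},\underline\delta)\). 2. The maps \(\delta_0,\underline\delta,p_0,j_0,h_0\) preserve the filtrations \(S_A^{\le k}\mathcal K\) and \(S_A^{\le k}\underline{\mathcal K}\), and \(t(S_A^{\le k}\mathcal K)\subset S_A^{\le k-1}\mathcal K\) for all \(k\). 3. The map \(th_0\) is locally nilpotent, and with \(X:=\sum_{i\ge0}(th_0)^it\), \(\underline\delta_t:=\underline\delta-p_0Xj_0\) and \[p_t:=p_0(\mathrm{id}+Xh_0)\circ\mathsf{PBW}^{-1},\quad j_t:=\mathsf{PBW}\circ(\mathrm{id}+h_0X)j_0,\quad h_t:=\mathsf{PBW}\circ(h_0+h_0Xh_0)\circ\mathsf{PBW}^{-1},\] the triple \((p_t,j_t,h_t)\) is contraction data for \((U(\mathcal K),\delta)\) over \((S_A\underline{\mathcal K},\underline\delta_t)\). 4. Define \(\gamma_1:=-j_t\), \(\gamma_k:=h_t\beta_k\) for \(k\ge2\), where \[\beta_k(x_1,\dots,x_k):=\sum_{\ell+m=k}(-1)^{\ell-1+(m-1)(\bar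 x_1+\cdots+\bar x_\ell)}\,\gamma_\ell(x_1,\dots,x_\ell)\,\gamma_m(x_{\ell+1},\dots,x_k)\] for homogeneous \(x_i\in S_A\underline{\mathcal K}\) of degrees \(\bar x_i\), the products being taken in \(U(\mathcal K)\). Then \(\alpha_1:=\underline\delta_t\) and \(\alpha_k:=p_t\beta_k\) \((k\ge2)\) make \(S_A\underline{\mathcal K}\) an \(A_\infty\)-algebra: \(\alpha_k\) is \(K\)-multilinear of degree \(2-k\), and for all \(k\ge1\) and homogeneous \(x_1,\dots,x_k\), \[\sum_{\substack{i+j=k\\ i\ge1}}(-1)^{ij}\sum_{\ell=0}^{j}(-1)^{\ell(i+1)+i(\bar x_1+\cdots+\bar x_\ell)}\alpha_{j+1}(x_1,\dots,x_\ell,\alpha_i(x_{\ell+1},\dots,x_{\ell+i}),x_{\ell+i+1},\dots,x_k)=0.\] -/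

import Mathlib

/-! Signs are written `(-1 : K) ^ n` with `n : ℤ`.  Gradings are families of subspaces
indexed by `ℤ`, and identities with signs are imposed on homogeneous elements. -/

noncomputable section

section Linear

variable {K V W : Type*} [Field K] [AddCommGroup V] [Module K V] [AddCommGroup W] [Module K W]

/-- A cochain complex of `K`-vector spaces: a `ℤ`-graded space with a differential of degree 1. -/
structure IsCochainComplex (gr : ℤ → Submodule K V) (d : V →ₗ[K] V) : Prop where
  internal : DirectSum.IsInternal gr
  d_mem : ∀ {n : ℤ} {x : V}, x ∈ gr n → d x ∈ gr (n + 1)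
  d_d : ∀ x, d (d x) = 0

/-- Contraction data `(p, j, h)` for the complex `(V, dV)` over the complex `(W, dW)`.
As `h` and `dV` are odd, the graded commutator `[h, dV]` is `h dV + dV h`. -/
structure IsContraction (grV : ℤ → Submodule K V) (dV : V →ₗ[K] V)
    (grW : ℤ → Submodule K W) (dW : W →ₗ[K] W)
    (p : V →ₗ[K] W) (j : W →ₗ[K] V) (h : V →ₗ[K] V) : Prop where
  source : IsCochainComplex grV dV
  target : IsCochainComplex grW dW
  p_mem : ∀ {n : ℤ} {x : V}, x ∈ grV n → p x ∈ grW n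
  j_mem : ∀ {n : ℤ} {y : W}, y ∈ grW n → j y ∈ grV n
  h_mem : ∀ {n : ℤ} {x : V}, x ∈ grV n → h x ∈ grV (n - 1)
  p_d : ∀ x, p (dV x) = dW (p x)
  j_d : ∀ y, j (dW y) = dV (j y)
  p_j : ∀ y, p (j y) = y
  homotopy : ∀ x, h (dV x) + dV (h x) = x - j (p x)
  h_h : ∀ x, h (h x) = 0
  h_j : ∀ y, h (j y) = 0
  p_h : ∀ x, p (h x) = 0

/-- An `A∞`-algebra structure on a graded vector space: operations `α k` of arity `k` and degree
`2 - k`, for `k ≥ 1`, with the Stasheff identities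
`∑_{i+j=k} (-1)^{ij} ∑_{ℓ≤j} (-1)^{ℓ(i+1)+i(x₁+⋯+x_ℓ)}
  α_{j+1}(x₁,…,x_ℓ, α_i(x_{ℓ+1},…,x_{ℓ+i}), x_{ℓ+i+1},…,x_k) = 0`.
The arguments are listed as a sequence `x 0, x 1, …` of elements of degrees `n 0, n 1, …`, of which
only the first `k` matter.  The map `α 0` plays no role. -/
structure IsAInfinityAlgebra (gr : ℤ → Submodule K V)
    (α : (k : ℕ) → MultilinearMap K (fun _ : Fin k => V) V) : Prop where
  internal : DirectSum.IsInternal gr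
  degree : ∀ (k : ℕ), 1 ≤ k → ∀ (x : Fin k → V) (n : Fin k → ℤ), (∀ r, x r ∈ gr (n r)) →
    α k x ∈ gr (∑ r, n r + 2 - k)
  stasheff : ∀ (k : ℕ), 1 ≤ k → ∀ (x : ℕ → V) (n : ℕ → ℤ), (∀ r, x r ∈ gr (n r)) →
    ∑ i ∈ Finset.Icc 1 k, (-1 : K) ^ (i * (k - i)) •
      ∑ l ∈ Finset.range (k - i + 1),
        (-1 : K) ^ ((l : ℤ) * (i + 1) + i * ∑ r ∈ Finset.range l, n r) •
          α (k - i + 1) (fun r : Fin (k - i + 1) =>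
            if (r : ℕ) < l then x r
            else if (r : ℕ) = l then α i (fun s : Fin i => x (l + s))
            else x (r + i - 1)) = 0

/-- The maps `γ_k` of the homotopy transfer of an associative product along contraction data, for
arguments `x 0, x 1, …` of degrees `n 0, n 1, …`: here `γ₁ = -j` and, for `k ≥ 2`,
`γ_k = h β_k` for `β_k = ∑_{ℓ+m=k} (-1)^{ℓ-1+(m-1)(x₁+⋯+x_ℓ)} γ_ℓ γ_m`. -/
def transferGamma {E : Type*} [Ring E] [Algebra K E] (j : W →ₗ[K] E) (h : E →ₗ[K] E) (k : ℕ)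
    (x : ℕ → W) (n : ℕ → ℤ) : E :=
  if k = 1 then - j (x 0)
  else h (∑ l ∈ (Finset.Ico 1 k).attach,
    (-1 : K) ^ ((l.1 : ℤ) - 1 + ((k : ℤ) - l.1 - 1) * ∑ r ∈ Finset.range l.1, n r) •
      (transferGamma j h l.1 x n *
        transferGamma j h (k - l.1) (fun r => x (l.1 + r)) (fun r => n (l.1 + r))))
termination_by k
decreasing_by
  all_goals
    have := Finset.mem_Ico.1 l.2
    omega

/-- The maps `β_k = ∑_{ℓ+m=k} (-1)^{ℓ-1+(m-1)(x₁+⋯+x_ℓ)} γ_ℓ γ_m`, for `k ≥ 2`. -/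
def transferBeta {E : Type*} [Ring E] [Algebra K E] (j : W →ₗ[K] E) (h : E →ₗ[K] E) (k : ℕ)
    (x : ℕ → W) (n : ℕ → ℤ) : E :=
  ∑ l ∈ Finset.Ico 1 k,
    (-1 : K) ^ ((l : ℤ) - 1 + ((k : ℤ) - l - 1) * ∑ r ∈ Finset.range l, n r) •
      (transferGamma j h l x n *
        transferGamma j h (k - l) (fun r => x (l + r)) (fun r => n (l + r)))

theorem transferGamma_one {E : Type*} [Ring E] [Algebra K E] (j : W →ₗ[K] E) (h : E →ₗ[K] E)
    (x : ℕ → W) (n : ℕ → ℤ) : transferGamma j h 1 x n = - j (x 0) := by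
  rw [transferGamma, if_pos rfl]

theorem transferGamma_eq {E : Type*} [Ring E] [Algebra K E] (j : W →ₗ[K] E) (h : E →ₗ[K] E)
    {k : ℕ} (hk : 2 ≤ k) (x : ℕ → W) (n : ℕ → ℤ) :
    transferGamma j h k x n = h (transferBeta j h k x n) := by
  rw [transferGamma, if_neg (by omega), transferBeta]
  congr 1
  exact Finset.sum_attach (Finset.Ico 1 k) (fun l =>
    (-1 : K) ^ ((l : ℤ) - 1 + ((k : ℤ) - l - 1) * ∑ r ∈ Finset.range l, n r) •
      (transferGamma j h l x n *
        transferGamma j h (k - l) (fun r => x (l + r)) (fun r => n (l + r))))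

/-- The operations `α` on `W` are those transferred from the product of the DG algebra `E` along
`(p, j, h)`: `α₁ = dW` and `α_k = p β_k` for `k ≥ 2`. -/
structure IsTransferred {E : Type*} [Ring E] [Algebra K E] (grW : ℤ → Submodule K W)
    (dW : W →ₗ[K] W) (p : E →ₗ[K] W) (j : W →ₗ[K] E) (h : E →ₗ[K] E)
    (α : (k : ℕ) → MultilinearMap K (fun _ : Fin k => W) W) : Prop where
  one : ∀ x : Fin 1 → W, α 1 x = dW (x 0)
  ge_two : ∀ (k : ℕ), 2 ≤ k → ∀ (x : ℕ → W) (n : ℕ → ℤ), (∀ r, x r ∈ grW (n r)) →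
    α k (fun r => x r) = p (transferBeta j h k x n)

/-- Local nilpotency of an endomorphism. -/
def IsLocallyNilpotent (f : V →ₗ[K] V) : Prop := ∀ x, ∃ k : ℕ, (f ^ k) x = 0

theorem IsLocallyNilpotent.finite {f : V →ₗ[K] V} (hf : IsLocallyNilpotent f) (y : V) :
    Function.HasFiniteSupport (fun i : ℕ => (f ^ i) y) := by
  obtain ⟨k, hk⟩ := hf y
  refine (Set.finite_lt_nat k).subset fun i hi => ?_
  by_contra hlt
  apply hi
  obtain ⟨m, rfl⟩ := Nat.exists_eq_add_of_le (not_lt.1 hlt)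
  show (f ^ (k + m)) y = 0
  rw [add_comm, pow_add, Module.End.mul_apply, hk, map_zero]

/-- The series `X = ∑_{i ≥ 0} (t h)^i t` of the perturbation lemma; when `t h` is locally nilpotent
only finitely many terms are nonzero on a given element. -/
def perturbationSeries (t h : V →ₗ[K] V) (hn : IsLocallyNilpotent (t ∘ₗ h)) : V →ₗ[K] V where
  toFun x := ∑ᶠ i : ℕ, ((t ∘ₗ h) ^ i) (t x)
  map_add' x y := by
    simp only [map_add]
    exact finsum_add_distrib (hn.finite _) (hn.finite _)
  map_smul' c x := by
    simp only [map_smul, RingHom.id_apply]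
    exact (smul_finsum' c (hn.finite _)).symm

/-- The parity involution `x ↦ (-1)^n x`, for `x` of degree `n`, of a graded space. -/
def parity {gr : ℤ → Submodule K V} (hgr : DirectSum.IsInternal gr) : V →ₗ[K] V :=
  DirectSum.toModule K ℤ V (fun n => (-1 : K) ^ n • (gr n).subtype) ∘ₗ
    (LinearEquiv.ofBijective (DirectSum.coeLinearMap gr) hgr).symm.toLinearMap

theorem parity_of_mem {gr : ℤ → Submodule K V} (hgr : DirectSum.IsInternal gr) {n : ℤ} {x : V}
    (hx : x ∈ gr n) : parity hgr x = (-1 : K) ^ n • x := by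
  have : (LinearEquiv.ofBijective (DirectSum.coeLinearMap gr) hgr).symm x =
      DirectSum.lof K ℤ (fun n => gr n) n ⟨x, hx⟩ := by
    rw [LinearEquiv.symm_apply_eq]
    exact (DirectSum.coeLinearMap_lof gr n ⟨x, hx⟩).symm
  simp [parity, this]

theorem internal_induction {gr : ℤ → Submodule K V} (hgr : DirectSum.IsInternal gr)
    {P : V → Prop} (hP : ∀ n, ∀ x ∈ gr n, P x) (h0 : P 0) (hadd : ∀ x y, P x → P y → P (x + y))
    (x : V) : P x := by
  have hx : x ∈ iSup gr := by rw [hgr.submodule_iSup_eq_top]; trivial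
  exact Submodule.iSup_induction gr (motive := P) hx hP h0 hadd

theorem neg_one_zpow_mul_self (n : ℤ) : (-1 : K) ^ n * (-1 : K) ^ n = 1 := by
  rw [← mul_zpow]; simp

end Linear

/-- A commutative unital DG algebra structure on the `K`-algebra `A`. -/
structure CommDGAlgebra (K A : Type*) [Field K] [Ring A] [Algebra K A] where
  gr : ℤ → Submodule K A
  internal : DirectSum.IsInternal gr
  one_mem : (1 : A) ∈ gr 0
  mul_mem : ∀ {i j : ℤ} {a b : A}, a ∈ gr i → b ∈ gr j → a * b ∈ gr (i + j)
  comm : ∀ {i j : ℤ} {a b : A}, a ∈ gr i → b ∈ gr j → a * b = (-1 : K) ^ (i * j) • (b * a)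
  d : A →ₗ[K] A
  d_mem : ∀ {i : ℤ} {a : A}, a ∈ gr i → d a ∈ gr (i + 1)
  d_d : ∀ a, d (d a) = 0
  d_mul : ∀ {i : ℤ} {a : A}, a ∈ gr i → ∀ b, d (a * b) = d a * b + (-1 : K) ^ i • (a * d b)

section Modules

variable {K A : Type*} [Field K] [Ring A] [Algebra K A]

/-- A DG module structure on the `A`-module `Q`, over a commutative DG algebra. -/
structure DGModule (𝔸 : CommDGAlgebra K A) (Q : Type*) [AddCommGroup Q] [Module K Q]
    [Module A Q] [IsScalarTower K A Q] where
  gr : ℤ → Submodule K Q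
  internal : DirectSum.IsInternal gr
  smul_mem : ∀ {i j : ℤ} {a : A} {q : Q}, a ∈ 𝔸.gr i → q ∈ gr j → a • q ∈ gr (i + j)
  d : Q →ₗ[K] Q
  d_mem : ∀ {i : ℤ} {q : Q}, q ∈ gr i → d q ∈ gr (i + 1)
  d_d : ∀ q, d (d q) = 0
  d_smul : ∀ {i : ℤ} {a : A}, a ∈ 𝔸.gr i → ∀ q : Q,
    d (a • q) = 𝔸.d a • q + (-1 : K) ^ i • (a • d q)

/-- A DG Lie–Rinehart algebra over a commutative DG algebra: a DG `A`-module with a graded Lie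
bracket and an action `act q a = q · a` on `A`, subject to the usual compatibilities. -/
structure DGLieRinehart (𝔸 : CommDGAlgebra K A) (Q : Type*) [AddCommGroup Q] [Module K Q]
    [Module A Q] [IsScalarTower K A Q] extends DGModule 𝔸 Q where
  bracket : Q →ₗ[K] Q →ₗ[K] Q
  act : Q →ₗ[K] A →ₗ[K] A
  bracket_mem : ∀ {i j : ℤ} {q r : Q}, q ∈ gr i → r ∈ gr j → bracket q r ∈ gr (i + j)
  act_mem : ∀ {i j : ℤ} {q : Q} {a : A}, q ∈ gr i → a ∈ 𝔸.gr j → act q a ∈ 𝔸.gr (i + j)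
  skew : ∀ {i j : ℤ} {q r : Q}, q ∈ gr i → r ∈ gr j →
    bracket q r = -((-1 : K) ^ (i * j) • bracket r q)
  jacobi : ∀ {i j : ℤ} {q r : Q}, q ∈ gr i → r ∈ gr j → ∀ s,
    bracket q (bracket r s) = bracket (bracket q r) s + (-1 : K) ^ (i * j) • bracket r (bracket q s)
  act_bracket : ∀ {i j : ℤ} {q r : Q}, q ∈ gr i → r ∈ gr j → ∀ a,
    act (bracket q r) a = act q (act r a) - (-1 : K) ^ (i * j) • act r (act q a)
  act_smul : ∀ (a : A) (q : Q) (b : A), act (a • q) b = a * act q b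
  act_mul : ∀ {i j : ℤ} {a : A} {q : Q}, a ∈ 𝔸.gr i → q ∈ gr j → ∀ b,
    act q (a * b) = act q a * b + (-1 : K) ^ (i * j) • (a * act q b)
  bracket_smul : ∀ {i j k : ℤ} {a : A} {q r : Q}, a ∈ 𝔸.gr i → q ∈ gr j → r ∈ gr k →
    bracket (a • q) r = a • bracket q r - (-1 : K) ^ (k * (i + j)) • (act r a • q)
  d_bracket : ∀ {i : ℤ} {q : Q}, q ∈ gr i → ∀ r,
    d (bracket q r) = bracket (d q) r + (-1 : K) ^ i • bracket q (d r)
  d_act : ∀ {i : ℤ} {q : Q}, q ∈ gr i → ∀ a,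
    𝔸.d (act q a) = act (d q) a + (-1 : K) ^ i • act q (𝔸.d a)

variable {𝔸 : CommDGAlgebra K A}
variable {Q R : Type*} [AddCommGroup Q] [Module K Q] [Module A Q] [IsScalarTower K A Q]
variable [AddCommGroup R] [Module K R] [Module A R] [IsScalarTower K A R]

/-- A DG module viewed as a DG Lie–Rinehart algebra with zero bracket and zero action. -/
def DGModule.trivialLR (M : DGModule 𝔸 Q) : DGLieRinehart 𝔸 Q where
  toDGModule := M
  bracket := 0
  act := 0
  bracket_mem := by simp
  act_mem := by simp
  skew := by simp
  jacobi := by simp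
  act_bracket := by simp
  act_smul := by simp
  act_mul := by simp
  bracket_smul := by simp
  d_bracket := by simp
  d_act := by simp

@[simp] theorem DGModule.trivialLR_bracket (M : DGModule 𝔸 Q) : M.trivialLR.bracket = 0 := rfl

@[simp] theorem DGModule.trivialLR_act (M : DGModule 𝔸 Q) : M.trivialLR.act = 0 := rfl

@[simp] theorem DGModule.trivialLR_gr (M : DGModule 𝔸 Q) : M.trivialLR.gr = M.gr := rfl

/-- `A`-linear contraction data for the DG module `M` over the DG module `N`; the map `h`, being of
degree `-1`, is `A`-linear in the graded sense. -/
structure LinearContraction (M : DGModule 𝔸 Q) (N : DGModule 𝔸 R) where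
  p : Q →ₗ[K] R
  j : R →ₗ[K] Q
  h : Q →ₗ[K] Q
  isContraction : IsContraction M.gr M.d N.gr N.d p j h
  p_smul : ∀ (a : A) (q : Q), p (a • q) = a • p q
  j_smul : ∀ (a : A) (r : R), j (a • r) = a • j r
  h_smul : ∀ {i : ℤ} {a : A}, a ∈ 𝔸.gr i → ∀ q : Q, h (a • q) = (-1 : K) ^ i • (a • h q)

/-- The relations, in the tensor algebra of `A ⊕ Q`, defining the universal enveloping algebra. -/
inductive EnvelopingRel (L : DGLieRinehart 𝔸 Q) :
    TensorAlgebra K (A × Q) → TensorAlgebra K (A × Q) → Prop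
  | one : EnvelopingRel L (TensorAlgebra.ι K ((1 : A), (0 : Q))) 1
  | mul (a b : A) : EnvelopingRel L
      (TensorAlgebra.ι K (a, (0 : Q)) * TensorAlgebra.ι K (b, (0 : Q)))
      (TensorAlgebra.ι K (a * b, (0 : Q)))
  | smul (a : A) (q : Q) : EnvelopingRel L
      (TensorAlgebra.ι K (a, (0 : Q)) * TensorAlgebra.ι K ((0 : A), q))
      (TensorAlgebra.ι K ((0 : A), a • q))
  | act {i j : ℤ} {q : Q} {a : A} (hq : q ∈ L.gr i) (ha : a ∈ 𝔸.gr j) : EnvelopingRel L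
      (TensorAlgebra.ι K ((0 : A), q) * TensorAlgebra.ι K (a, (0 : Q)) -
        (-1 : K) ^ (i * j) • (TensorAlgebra.ι K (a, (0 : Q)) * TensorAlgebra.ι K ((0 : A), q)))
      (TensorAlgebra.ι K (L.act q a, (0 : Q)))
  | bracket {i j : ℤ} {q r : Q} (hq : q ∈ L.gr i) (hr : r ∈ L.gr j) : EnvelopingRel L
      (TensorAlgebra.ι K ((0 : A), q) * TensorAlgebra.ι K ((0 : A), r) -
        (-1 : K) ^ (i * j) • (TensorAlgebra.ι K ((0 : A), r) * TensorAlgebra.ι K ((0 : A), q)))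
      (TensorAlgebra.ι K ((0 : A), L.bracket q r))

/-- The universal enveloping algebra `U(Q)` of a Lie–Rinehart algebra `Q` over `A`. -/
def UEnv (L : DGLieRinehart 𝔸 Q) : Type _ := RingQuot (EnvelopingRel L)

instance (L : DGLieRinehart 𝔸 Q) : Ring (UEnv L) := inferInstanceAs (Ring (RingQuot _))

instance (L : DGLieRinehart 𝔸 Q) : Algebra K (UEnv L) :=
  inferInstanceAs (Algebra K (RingQuot _))

/-- The graded symmetric algebra `S_A Q` of a DG module: generated by `A` and `Q`, subject to
`1_A = 1`, `a ⊙ b = ab`, `a ⊙ q = aq`, and graded commutativity.  These are the relations of the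
universal enveloping algebra of `Q` with zero bracket and zero action on `A`. -/
abbrev GrSymAlg (M : DGModule 𝔸 Q) : Type _ := UEnv M.trivialLR

namespace UEnv

/-- The canonical projection from the tensor algebra. -/
def mk (L : DGLieRinehart 𝔸 Q) : TensorAlgebra K (A × Q) →ₐ[K] UEnv L :=
  RingQuot.mkAlgHom K (EnvelopingRel L)

/-- The canonical map `A → U(Q)`. -/
def ιA (L : DGLieRinehart 𝔸 Q) : A →ₗ[K] UEnv L :=
  (mk L).toLinearMap ∘ₗ TensorAlgebra.ι K ∘ₗ LinearMap.inl K A Q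

/-- The canonical map `Q → U(Q)`. -/
def ιQ (L : DGLieRinehart 𝔸 Q) : Q →ₗ[K] UEnv L :=
  (mk L).toLinearMap ∘ₗ TensorAlgebra.ι K ∘ₗ LinearMap.inr K A Q

/-- The grading of `U(Q)` induced by those of `A` and `Q`. -/
def gr (L : DGLieRinehart 𝔸 Q) (n : ℤ) : Submodule K (UEnv L) :=
  Submodule.span K {x | ∃ (i : ℤ) (a : A) (l : List (ℤ × Q)), a ∈ 𝔸.gr i ∧
    (∀ y ∈ l, y.2 ∈ L.gr y.1) ∧ i + (l.map Prod.fst).sum = n ∧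
    x = ιA L a * (l.map fun y => ιQ L y.2).prod}

/-- The filtration of `U(Q)`: `filt L k` is the left `A`-submodule generated by the products of at
most `k` elements of `Q`; it is zero for `k < 0`.  For the symmetric algebra this is `S^{≤ k}`. -/
def filt (L : DGLieRinehart 𝔸 Q) (k : ℤ) : Submodule K (UEnv L) :=
  Submodule.span K {x | ∃ (a : A) (l : List Q), (l.length : ℤ) ≤ k ∧
    x = ιA L a * (l.map (ιQ L)).prod}

/-- `E` with `f : A → E` and `g : Q → E` is an enveloping algebra of the Lie–Rinehart algebra `Q`
(apart from the grading of `E`). -/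
structure IsEnveloping {E : Type*} [Ring E] [Algebra K E] (L : DGLieRinehart 𝔸 Q)
    (f : A →ₗ[K] E) (g : Q →ₗ[K] E) : Prop where
  one : f 1 = 1
  mul : ∀ a b, f (a * b) = f a * f b
  smul : ∀ a q, g (a • q) = f a * g q
  act : ∀ {i j : ℤ} {q : Q} {a : A}, q ∈ L.gr i → a ∈ 𝔸.gr j →
    g q * f a = (-1 : K) ^ (i * j) • (f a * g q) + f (L.act q a)
  bracket : ∀ {i j : ℤ} {q r : Q}, q ∈ L.gr i → r ∈ L.gr j →
    g q * g r = (-1 : K) ^ (i * j) • (g r * g q) + g (L.bracket q r)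

theorem isEnveloping (L : DGLieRinehart 𝔸 Q) : IsEnveloping L (ιA L) (ιQ L) where
  one := by
    have := RingQuot.mkAlgHom_rel K (EnvelopingRel.one (L := L))
    rw [map_one] at this
    exact this
  mul a b := by
    have := RingQuot.mkAlgHom_rel K (EnvelopingRel.mul (L := L) a b)
    rw [map_mul] at this
    exact this.symm
  smul a q := by
    have := RingQuot.mkAlgHom_rel K (EnvelopingRel.smul (L := L) a q)
    rw [map_mul] at this
    exact this.symm
  act hq ha := by
    have := RingQuot.mkAlgHom_rel K (EnvelopingRel.act (L := L) hq ha)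
    rw [map_sub, map_smul, map_mul, map_mul, sub_eq_iff_eq_add'] at this
    exact this
  bracket hq hr := by
    have := RingQuot.mkAlgHom_rel K (EnvelopingRel.bracket (L := L) hq hr)
    rw [map_sub, map_smul, map_mul, map_mul, sub_eq_iff_eq_add'] at this
    exact this

/-- The universal property of `U(Q)`. -/
def lift {E : Type*} [Ring E] [Algebra K E] {L : DGLieRinehart 𝔸 Q}
    {f : A →ₗ[K] E} {g : Q →ₗ[K] E} (H : IsEnveloping L f g) : UEnv L →ₐ[K] E :=
  RingQuot.liftAlgHom K ⟨TensorAlgebra.lift K (f.coprod g), fun x y hxy => by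
    induction hxy with
    | one => simpa using H.one
    | mul a b => simpa using (H.mul a b).symm
    | smul a q => simpa using (H.smul a q).symm
    | act hq ha => simpa [sub_eq_iff_eq_add'] using H.act hq ha
    | bracket hq hr => simpa [sub_eq_iff_eq_add'] using H.bracket hq hr⟩

@[simp] theorem lift_ιA {E : Type*} [Ring E] [Algebra K E] {L : DGLieRinehart 𝔸 Q}
    {f : A →ₗ[K] E} {g : Q →ₗ[K] E} (H : IsEnveloping L f g) (a : A) :
    lift H (ιA L a) = f a := by
  refine (RingQuot.liftAlgHom_mkAlgHom_apply K _ _ _).trans ?_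
  simp

@[simp] theorem lift_ιQ {E : Type*} [Ring E] [Algebra K E] {L : DGLieRinehart 𝔸 Q}
    {f : A →ₗ[K] E} {g : Q →ₗ[K] E} (H : IsEnveloping L f g) (q : Q) :
    lift H (ιQ L q) = g q := by
  refine (RingQuot.liftAlgHom_mkAlgHom_apply K _ _ _).trans ?_
  simp

theorem hom_ext {E : Type*} [Ring E] [Algebra K E] {L : DGLieRinehart 𝔸 Q}
    {F G : UEnv L →ₐ[K] E} (hA : ∀ a, F (ιA L a) = G (ιA L a))
    (hQ : ∀ q, F (ιQ L q) = G (ιQ L q)) : F = G := by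
  apply RingQuot.ringQuot_ext' K
  apply TensorAlgebra.hom_ext
  apply LinearMap.prod_ext
  · ext a; exact hA a
  · ext q; exact hQ q

theorem mem_of_generators {L : DGLieRinehart 𝔸 Q} (S : Subalgebra K (UEnv L))
    (hA : ∀ a, ιA L a ∈ S) (hQ : ∀ q, ιQ L q ∈ S) (x : UEnv L) : x ∈ S := by
  have H := isEnveloping L
  let f : A →ₗ[K] S := (ιA L).codRestrict (Subalgebra.toSubmodule S) hA
  let g : Q →ₗ[K] S := (ιQ L).codRestrict (Subalgebra.toSubmodule S) hQ
  have H' : IsEnveloping L f g := by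
    refine ⟨?_, ?_, ?_, ?_, ?_⟩
    · exact Subtype.ext H.one
    · exact fun a b => Subtype.ext (H.mul a b)
    · exact fun a q => Subtype.ext (H.smul a q)
    · exact fun hq ha => Subtype.ext (H.act hq ha)
    · exact fun hq hr => Subtype.ext (H.bracket hq hr)
  have hid : S.val.comp (lift H') = AlgHom.id K (UEnv L) := by
    refine hom_ext (fun a => ?_) (fun q => ?_)
    · rw [AlgHom.comp_apply, lift_ιA]; rfl
    · rw [AlgHom.comp_apply, lift_ιQ]; rfl
  have := congrArg (fun F => F x) hid
  rw [← show ((lift H' x : S) : UEnv L) = x from this]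
  exact (lift H' x).2

theorem isEnveloping_parity (L : DGLieRinehart 𝔸 Q) :
    IsEnveloping L (ιA L ∘ₗ parity 𝔸.internal) (ιQ L ∘ₗ parity L.internal) := by
  have H := isEnveloping L
  refine ⟨?_, ?_, ?_, ?_, ?_⟩
  · simp [parity_of_mem 𝔸.internal 𝔸.one_mem, H.one]
  · intro a b
    induction a using internal_induction 𝔸.internal with
    | h0 => simp
    | hadd x y hx hy => rw [add_mul, map_add, hx, hy, map_add, add_mul]
    | hP i a ha =>
      induction b using internal_induction 𝔸.internal with
      | h0 => simp
      | hadd x y hx hy => rw [mul_add, map_add, hx, hy, map_add, mul_add]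
      | hP j b hb =>
        simp [parity_of_mem 𝔸.internal ha, parity_of_mem 𝔸.internal hb,
          parity_of_mem 𝔸.internal (𝔸.mul_mem ha hb), H.mul, zpow_add₀, smul_smul, mul_comm]
  · intro a q
    induction a using internal_induction 𝔸.internal with
    | h0 => simp
    | hadd x y hx hy => rw [add_smul, map_add, hx, hy, map_add, add_mul]
    | hP i a ha =>
      induction q using internal_induction L.internal with
      | h0 => simp
      | hadd x y hx hy => rw [smul_add, map_add, hx, hy, map_add, mul_add]
      | hP j q hq =>
        simp [parity_of_mem 𝔸.internal ha, parity_of_mem L.internal hq,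
          parity_of_mem L.internal (L.smul_mem ha hq), H.smul, zpow_add₀, smul_smul, mul_comm]
  · intro i j q a hq ha
    simp only [LinearMap.comp_apply, parity_of_mem 𝔸.internal ha, parity_of_mem L.internal hq,
      parity_of_mem 𝔸.internal (L.act_mem hq ha), map_smul, smul_mul_assoc, mul_smul_comm,
      H.act hq ha, smul_add, smul_smul, zpow_add₀ (neg_ne_zero.2 (one_ne_zero (α := K)))]
    congr 2 <;> ring
  · intro i j q r hq hr
    simp only [LinearMap.comp_apply, parity_of_mem L.internal hq, parity_of_mem L.internal hr,
      parity_of_mem L.internal (L.bracket_mem hq hr), map_smul, smul_mul_assoc, mul_smul_comm,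
      H.bracket hq hr, smul_add, smul_smul, zpow_add₀ (neg_ne_zero.2 (one_ne_zero (α := K)))]
    congr 2 <;> ring

/-- The parity automorphism of `U(Q)`, which is `(-1)^n` in degree `n`. -/
def par (L : DGLieRinehart 𝔸 Q) : UEnv L →ₐ[K] UEnv L := lift (isEnveloping_parity L)

theorem par_of_mem {L : DGLieRinehart 𝔸 Q} {n : ℤ} {x : UEnv L} (hx : x ∈ gr L n) :
    par L x = (-1 : K) ^ n • x := by
  induction hx using Submodule.span_induction with
  | mem x hx =>
    obtain ⟨i, a, l, ha, hl, rfl, rfl⟩ := hx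
    have hl' : par L (l.map fun y => ιQ L y.2).prod =
        (-1 : K) ^ (l.map Prod.fst).sum • (l.map fun y => ιQ L y.2).prod := by
      induction l with
      | nil => simp
      | cons y l ih =>
        have h1 : par L (ιQ L y.2) = (-1 : K) ^ y.1 • ιQ L y.2 := by
          simp [par, parity_of_mem L.internal (hl y List.mem_cons_self)]
        rw [List.map_cons, List.prod_cons, map_mul, h1,
          ih fun z hz => hl z (List.mem_cons_of_mem _ hz), List.map_cons, List.sum_cons,
          zpow_add₀ (neg_ne_zero.2 one_ne_zero), smul_mul_assoc, mul_smul_comm, smul_smul]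
    have h1 : par L (ιA L a) = (-1 : K) ^ i • ιA L a := by
      simp [par, parity_of_mem 𝔸.internal ha]
    rw [map_mul, h1, hl', zpow_add₀ (neg_ne_zero.2 one_ne_zero), smul_mul_assoc, mul_smul_comm,
      smul_smul]
  | zero => simp
  | add x y _ _ hx hy => rw [map_add, hx, hy, smul_add]
  | smul c x _ hx => rw [map_smul, hx, smul_comm]

end UEnv

/-- A derivation of odd degree `s` of a Lie–Rinehart algebra: a pair of maps on `A` and on `Q`
satisfying the graded Leibniz rules for all operations. -/
structure OddDerivation (L : DGLieRinehart 𝔸 Q) where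
  s : ℤ
  odd : Odd s
  onA : A →ₗ[K] A
  onQ : Q →ₗ[K] Q
  onA_mem : ∀ {i : ℤ} {a : A}, a ∈ 𝔸.gr i → onA a ∈ 𝔸.gr (i + s)
  onQ_mem : ∀ {i : ℤ} {q : Q}, q ∈ L.gr i → onQ q ∈ L.gr (i + s)
  mul : ∀ {i : ℤ} {a : A}, a ∈ 𝔸.gr i → ∀ b,
    onA (a * b) = onA a * b + (-1 : K) ^ i • (a * onA b)
  smul : ∀ {i : ℤ} {a : A}, a ∈ 𝔸.gr i → ∀ q : Q,
    onQ (a • q) = onA a • q + (-1 : K) ^ i • (a • onQ q)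
  act : ∀ {i : ℤ} {q : Q}, q ∈ L.gr i → ∀ a,
    onA (L.act q a) = L.act (onQ q) a + (-1 : K) ^ i • L.act q (onA a)
  bracket : ∀ {i : ℤ} {q : Q}, q ∈ L.gr i → ∀ r,
    onQ (L.bracket q r) = L.bracket (onQ q) r + (-1 : K) ^ i • L.bracket q (onQ r)

namespace OddDerivation

/-- The map `x ↦ !![a x, b x; 0, c x]`. -/
def triangular {V E : Type*} [AddCommGroup V] [Module K V] [Ring E] [Algebra K E]
    (a b c : V →ₗ[K] E) : V →ₗ[K] Matrix (Fin 2) (Fin 2) E where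
  toFun x := !![a x, b x; 0, c x]
  map_add' x y := by ext i j; fin_cases i <;> fin_cases j <;> simp
  map_smul' k x := by ext i j; fin_cases i <;> fin_cases j <;> simp

theorem neg_one_zpow_mul_odd {s : ℤ} (hs : Odd s) (i : ℤ) :
    (-1 : K) ^ (i * s) = (-1 : K) ^ i := by
  rw [mul_comm, zpow_mul, hs.neg_one_zpow]

theorem isEnveloping {L : DGLieRinehart 𝔸 Q} (D : OddDerivation L) :
    UEnv.IsEnveloping L
      (triangular (UEnv.ιA L ∘ₗ parity 𝔸.internal) (UEnv.ιA L ∘ₗ D.onA) (UEnv.ιA L))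
      (triangular (UEnv.ιQ L ∘ₗ parity L.internal) (UEnv.ιQ L ∘ₗ D.onQ) (UEnv.ιQ L)) := by
  have H := UEnv.isEnveloping L
  have P := UEnv.isEnveloping_parity L
  have hne : (-1 : K) ≠ 0 := neg_ne_zero.2 one_ne_zero
  refine ⟨?_, ?_, ?_, ?_, ?_⟩
  · have h1 : D.onA 1 = 0 := by
      have := D.mul 𝔸.one_mem 1
      simpa using this
    ext i j
    have := P.one
    fin_cases i <;> fin_cases j <;> simp_all [triangular, H.one]
  · intro a b
    have h1 : D.onA (a * b) = D.onA a * b + parity 𝔸.internal a * D.onA b := by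
      induction a using internal_induction 𝔸.internal with
      | h0 => simp
      | hadd x y hx hy => simp only [add_mul, map_add, hx, hy]; abel
      | hP i a ha => simp [D.mul ha, parity_of_mem 𝔸.internal ha]
    have := P.mul a b
    ext i j
    fin_cases i <;> fin_cases j <;> simp_all [triangular, H.mul, Matrix.mul_apply, add_comm]
  · intro a q
    have h1 : D.onQ (a • q) = D.onA a • q + parity 𝔸.internal a • D.onQ q := by
      induction a using internal_induction 𝔸.internal with
      | h0 => simp
      | hadd x y hx hy => simp only [add_smul, map_add, hx, hy]; abel
      | hP i a ha => simp [D.smul ha, parity_of_mem 𝔸.internal ha, smul_assoc]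
    have := P.smul a q
    ext i j
    fin_cases i <;> fin_cases j <;> simp_all [triangular, H.smul, Matrix.mul_apply, add_comm]
  · intro i j q a hq ha
    have h0 := P.act hq ha
    have h1 := H.act hq ha
    have h2 := H.act hq (D.onA_mem ha)
    have h3 := H.act (D.onQ_mem hq) ha
    have h4 := D.act hq a
    ext k l
    fin_cases k <;> fin_cases l
    · simpa [triangular, Matrix.mul_apply] using h0
    · simp only [triangular, Matrix.mul_apply, Fin.sum_univ_two, LinearMap.coe_mk, AddHom.coe_mk,
        LinearMap.comp_apply, parity_of_mem 𝔸.internal ha, parity_of_mem L.internal hq]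
      simp only [mul_add, add_mul, zpow_add₀ hne, neg_one_zpow_mul_odd D.odd, mul_comm D.s j] at h2 h3
      simp [h2, h3, h4, smul_smul, smul_add]
      rw [show (-1 : K) ^ i * ((-1 : K) ^ (i * j) * (-1 : K) ^ i) = (-1 : K) ^ (i * j) by
        rw [mul_left_comm, neg_one_zpow_mul_self, mul_one]]
      abel
    · simp [triangular, Matrix.mul_apply]
    · simpa [triangular, Matrix.mul_apply] using h1
  · intro i j q r hq hr
    have h0 := P.bracket hq hr
    have h1 := H.bracket hq hr
    have h2 := H.bracket hq (D.onQ_mem hr)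
    have h3 := H.bracket (D.onQ_mem hq) hr
    have h4 := D.bracket hq r
    ext k l
    fin_cases k <;> fin_cases l
    · simpa [triangular, Matrix.mul_apply] using h0
    · simp only [triangular, Matrix.mul_apply, Fin.sum_univ_two, LinearMap.coe_mk, AddHom.coe_mk,
        LinearMap.comp_apply, parity_of_mem L.internal hr, parity_of_mem L.internal hq]
      simp only [mul_add, add_mul, zpow_add₀ hne, neg_one_zpow_mul_odd D.odd, mul_comm D.s j] at h2 h3
      simp [h2, h3, h4, smul_smul, smul_add]
      rw [show (-1 : K) ^ i * ((-1 : K) ^ (i * j) * (-1 : K) ^ i) = (-1 : K) ^ (i * j) by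
        rw [mul_left_comm, neg_one_zpow_mul_self, mul_one]]
      abel
    · simp [triangular, Matrix.mul_apply]
    · simpa [triangular, Matrix.mul_apply] using h1

/-- The extension of an odd derivation of `Q` to the unique derivation of `U(Q)`: the map
`x ↦ !![par x, D x; 0, x]` is an algebra morphism exactly when `D` is an odd derivation. -/
def toUEnv {L : DGLieRinehart 𝔸 Q} (D : OddDerivation L) : UEnv L →ₗ[K] UEnv L where
  toFun x := UEnv.lift D.isEnveloping x 0 1
  map_add' x y := by simp
  map_smul' c x := by simp

@[simp] theorem toUEnv_ιA {L : DGLieRinehart 𝔸 Q} (D : OddDerivation L) (a : A) :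
    D.toUEnv (UEnv.ιA L a) = UEnv.ιA L (D.onA a) := by
  simp [toUEnv, triangular]

@[simp] theorem toUEnv_ιQ {L : DGLieRinehart 𝔸 Q} (D : OddDerivation L) (q : Q) :
    D.toUEnv (UEnv.ιQ L q) = UEnv.ιQ L (D.onQ q) := by
  simp [toUEnv, triangular]

theorem lift_eq {L : DGLieRinehart 𝔸 Q} (D : OddDerivation L) (x : UEnv L) :
    UEnv.lift D.isEnveloping x = !![UEnv.par L x, D.toUEnv x; 0, x] := by
  have key : ∀ x, UEnv.lift D.isEnveloping x 1 0 = 0 ∧ UEnv.lift D.isEnveloping x 1 1 = x ∧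
      UEnv.lift D.isEnveloping x 0 0 = UEnv.par L x := by
    intro x
    let F := UEnv.lift D.isEnveloping
    let S : Subalgebra K (UEnv L) :=
      { carrier := {x | F x 1 0 = 0 ∧ F x 1 1 = x ∧ F x 0 0 = UEnv.par L x}
        mul_mem' := by
          rintro a b ⟨a1, a2, a3⟩ ⟨b1, b2, b3⟩
          refine ⟨?_, ?_, ?_⟩ <;> simp [Matrix.mul_apply, *]
        add_mem' := by
          rintro a b ⟨a1, a2, a3⟩ ⟨b1, b2, b3⟩
          refine ⟨?_, ?_, ?_⟩ <;> simp [*]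
        algebraMap_mem' := by
          intro r
          refine ⟨?_, ?_, ?_⟩ <;> simp [Matrix.algebraMap_matrix_apply] }
    have hA : ∀ a, UEnv.ιA L a ∈ S := fun a => by
      refine ⟨?_, ?_, ?_⟩ <;> simp [F, triangular, UEnv.par]
    have hQ : ∀ q, UEnv.ιQ L q ∈ S := fun q => by
      refine ⟨?_, ?_, ?_⟩ <;> simp [F, triangular, UEnv.par]
    exact UEnv.mem_of_generators S hA hQ x
  obtain ⟨h1, h2, h3⟩ := key x
  ext i j
  fin_cases i <;> fin_cases j
  · exact h3
  · rfl
  · exact h1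
  · exact h2

/-- The signed Leibniz rule. -/
theorem toUEnv_mul {L : DGLieRinehart 𝔸 Q} (D : OddDerivation L) (x y : UEnv L) :
    D.toUEnv (x * y) = D.toUEnv x * y + UEnv.par L x * D.toUEnv y := by
  have h := congrFun (congrFun (map_mul (UEnv.lift D.isEnveloping) x y) 0) 1
  rw [lift_eq, lift_eq, lift_eq] at h
  simpa [Matrix.mul_apply, add_comm] using h

end OddDerivation

/-- The differential of a DG Lie–Rinehart algebra is an odd derivation of it. -/
def DGLieRinehart.differential (L : DGLieRinehart 𝔸 Q) : OddDerivation L where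
  s := 1
  odd := odd_one
  onA := 𝔸.d
  onQ := L.d
  onA_mem := 𝔸.d_mem
  onQ_mem := L.d_mem
  mul := 𝔸.d_mul
  smul := L.d_smul
  act := L.d_act
  bracket := L.d_bracket

/-- The differential of the universal enveloping DG algebra: the derivation extending the
differentials of `A` and `Q`.  For the symmetric algebra, this is the differential of `S_A Q`. -/
def UEnv.d (L : DGLieRinehart 𝔸 Q) : UEnv L →ₗ[K] UEnv L := L.differential.toUEnv

namespace GrSymAlg

/-- The algebra morphism `S_A Q → S_A R` extending an `A`-linear map of degree `0`. -/
def map {M : DGModule 𝔸 Q} {N : DGModule 𝔸 R} (f : Q →ₗ[K] R)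
    (hf : ∀ (a : A) (q : Q), f (a • q) = a • f q)
    (hd : ∀ {n : ℤ} {q : Q}, q ∈ M.gr n → f q ∈ N.gr n) : GrSymAlg M →ₐ[K] GrSymAlg N :=
  UEnv.lift (f := UEnv.ιA N.trivialLR) (g := UEnv.ιQ N.trivialLR ∘ₗ f)
    { one := (UEnv.isEnveloping _).one
      mul := (UEnv.isEnveloping _).mul
      smul := fun a q => by simp [hf, (UEnv.isEnveloping _).smul]
      act := fun hq ha => (UEnv.isEnveloping N.trivialLR).act (hd hq) ha
      bracket := fun hq hr => by
        simpa using (UEnv.isEnveloping N.trivialLR).bracket (hd hq) (hd hr) }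

/-- The differential of `S_A Q` induced by those of `A` and `Q`, as a derivation. -/
abbrev d (M : DGModule 𝔸 Q) : GrSymAlg M →ₗ[K] GrSymAlg M := UEnv.d M.trivialLR

/-- The grading of `S_A Q` by total degree. -/
abbrev gr (M : DGModule 𝔸 Q) (n : ℤ) : Submodule K (GrSymAlg M) := UEnv.gr M.trivialLR n

/-- The filtration `S_A^{≤ k} Q`. -/
abbrev filt (M : DGModule 𝔸 Q) (k : ℤ) : Submodule K (GrSymAlg M) := UEnv.filt M.trivialLR k

end GrSymAlg

namespace LinearContraction

variable {M : DGModule 𝔸 Q} {N : DGModule 𝔸 R} (C : LinearContraction M N)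

/-- The extension of `p` to symmetric algebras, as an algebra morphism. -/
def symP : GrSymAlg M →ₐ[K] GrSymAlg N := GrSymAlg.map C.p C.p_smul C.isContraction.p_mem

/-- The extension of `j` to symmetric algebras, as an algebra morphism. -/
def symJ : GrSymAlg N →ₐ[K] GrSymAlg M := GrSymAlg.map C.j C.j_smul C.isContraction.j_mem

/-- The homotopy `h` is an odd derivation of the module `Q`, subordinate to zero. -/
def homotopyDerivation : OddDerivation M.trivialLR where
  s := -1
  odd := odd_neg_one
  onA := 0
  onQ := C.h
  onA_mem := by simp
  onQ_mem := fun h => C.isContraction.h_mem h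
  mul := by simp
  smul := fun ha q => by simp [C.h_smul ha q]
  act := by simp [DGModule.trivialLR]
  bracket := by simp [DGModule.trivialLR]

/-- The extension `h'` of `h` to the symmetric algebra, as an `A`-linear derivation. -/
def symH' : GrSymAlg M →ₗ[K] GrSymAlg M := C.homotopyDerivation.toUEnv

theorem comm_aux {E : Type*} [Ring E] [Algebra K E] {s : K} {x y z w X : E}
    (hX : ∀ {e : E}, X * e = e * X) (h1 : x * y = s • (y * x)) (h2 : z * y = s • (y * z))
    (h3 : x * w = s • (w * x)) (h4 : z * w = s • (w * z)) :
    (x + z * X) * (y + w * X) = s • ((y + w * X) * (x + z * X)) := by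
  have e1 : z * X * y = s • (y * (z * X)) := by
    rw [mul_assoc, hX, ← mul_assoc, h2, smul_mul_assoc, mul_assoc]
  have e2 : x * (w * X) = s • (w * X * x) := by
    rw [← mul_assoc, h3, smul_mul_assoc, mul_assoc, mul_assoc, hX]
  have e3 : z * X * (w * X) = s • (w * X * (z * X)) := by
    rw [mul_assoc, hX, ← mul_assoc, ← mul_assoc, h4, mul_assoc w, hX (e := z * X)]
    simp only [smul_mul_assoc, mul_assoc]
  rw [add_mul, mul_add, mul_add, add_mul, mul_add, mul_add, h1, e1, e2, e3]
  simp only [smul_add]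
  abel

theorem isEnveloping_weight : UEnv.IsEnveloping M.trivialLR
    ((Polynomial.CAlgHom (R := K) (A := GrSymAlg M)).toLinearMap ∘ₗ UEnv.ιA M.trivialLR)
    ((Polynomial.CAlgHom (R := K) (A := GrSymAlg M)).toLinearMap ∘ₗ
        UEnv.ιQ M.trivialLR ∘ₗ C.j ∘ₗ C.p +
      LinearMap.mulRight K (Polynomial.X : Polynomial (GrSymAlg M)) ∘ₗ
        (Polynomial.CAlgHom (R := K) (A := GrSymAlg M)).toLinearMap ∘ₗ
        UEnv.ιQ M.trivialLR ∘ₗ (LinearMap.id - C.j ∘ₗ C.p)) := by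
  have H := UEnv.isEnveloping M.trivialLR
  have hjp : ∀ {i : ℤ} {q : Q}, q ∈ M.gr i → C.j (C.p q) ∈ M.gr i := fun h =>
    C.isContraction.j_mem (C.isContraction.p_mem h)
  refine ⟨?_, ?_, ?_, ?_, ?_⟩
  · simp [H.one]
  · simp [H.mul]
  · intro a q
    have h1 := H.smul a (C.j (C.p q))
    have h2 := H.smul a (q - C.j (C.p q))
    rw [smul_sub] at h2
    simp only [LinearMap.add_apply, LinearMap.comp_apply, LinearMap.sub_apply, LinearMap.id_apply,
      C.p_smul, C.j_smul, h1, h2, AlgHom.toLinearMap_apply, LinearMap.mulRight_apply, map_mul,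
      mul_add, mul_assoc]
  · intro i j q a hq ha
    have h1 := congrArg (Polynomial.CAlgHom (R := K)) (H.act (hjp hq) ha)
    have h2 := congrArg (Polynomial.CAlgHom (R := K)) (H.act (M.trivialLR.gr i |>.sub_mem hq (hjp hq)) ha)
    simp only [DGModule.trivialLR_act, LinearMap.zero_apply, map_zero, add_zero, map_mul, map_smul]
      at h1 h2 ⊢
    simp only [LinearMap.add_apply, LinearMap.comp_apply, LinearMap.sub_apply, LinearMap.id_apply,
      AlgHom.toLinearMap_apply, LinearMap.mulRight_apply]
    rw [add_mul, mul_assoc, Polynomial.X_mul, ← mul_assoc, h1, h2, mul_add, smul_add,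
      smul_mul_assoc, mul_assoc]
  · intro i j q r hq hr
    have hq' := M.trivialLR.gr i |>.sub_mem hq (hjp hq)
    have hr' := M.trivialLR.gr j |>.sub_mem hr (hjp hr)
    have h1 := congrArg (Polynomial.CAlgHom (R := K)) (H.bracket (hjp hq) (hjp hr))
    have h2 := congrArg (Polynomial.CAlgHom (R := K)) (H.bracket hq' (hjp hr))
    have h3 := congrArg (Polynomial.CAlgHom (R := K)) (H.bracket (hjp hq) hr')
    have h4 := congrArg (Polynomial.CAlgHom (R := K)) (H.bracket hq' hr')
    simp only [DGModule.trivialLR_bracket, LinearMap.zero_apply, map_zero, add_zero, map_mul,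
      map_smul] at h1 h2 h3 h4 ⊢
    simp only [LinearMap.add_apply, LinearMap.comp_apply, LinearMap.sub_apply, LinearMap.id_apply,
      AlgHom.toLinearMap_apply, LinearMap.mulRight_apply]
    exact comm_aux Polynomial.X_mul h1 h2 h3 h4

/-- Let `Z = ker p`, so that `Q = R ⊕ Z` via `j`, and `S_A Q = ⨁ i, S_A R ⊗ S_A^i Z`.  This is the
algebra morphism `S_A Q → (S_A Q)[X]` that is the identity on `A` and on `j(R)` and multiplies the
elements of `Z` by `X`.  The coefficient of `X ^ i` in `C.weight Σ` is the component of `Σ` in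
`S_A R ⊗ S_A^i Z`. -/
def weight : GrSymAlg M →ₐ[K] Polynomial (GrSymAlg M) := UEnv.lift C.isEnveloping_weight

/-- The homotopy of the symmetric algebra: on `S_A R ⊗ S_A^i Z` it is zero if `i = 0` (as
`0⁻¹ = 0`), and `(1 / i) h'` if `i > 0`. -/
def symH : GrSymAlg M →ₗ[K] GrSymAlg M :=
  Polynomial.lsum (fun i : ℕ => ((i : K)⁻¹) • C.symH') ∘ₗ C.weight.toLinearMap

/-- The subspace `S_A R ⊗ S_A^i Z` of `S_A Q`, where `Z = ker p`. -/
def weightSpace (i : ℕ) : Submodule K (GrSymAlg M) :=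
  Submodule.span K {x | ∃ (a : A) (l : List R) (z : List Q), (∀ q ∈ z, C.p q = 0) ∧ z.length = i ∧
    x = UEnv.ιA M.trivialLR a * (l.map fun r => UEnv.ιQ M.trivialLR (C.j r)).prod *
      (z.map (UEnv.ιQ M.trivialLR)).prod}

theorem symH_of_mem_weightSpace {i : ℕ} {x : GrSymAlg M} (hx : x ∈ C.weightSpace i) :
    C.symH x = (i : K)⁻¹ • C.symH' x := by
  have key : C.weight x = Polynomial.monomial i x := by
    have hQ : ∀ q, C.weight (UEnv.ιQ M.trivialLR q) =
        Polynomial.C (UEnv.ιQ M.trivialLR (C.j (C.p q))) +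
          Polynomial.C (UEnv.ιQ M.trivialLR (q - C.j (C.p q))) * Polynomial.X := fun q => by
      simp [weight]
    have hR : ∀ l : List R, C.weight (l.map fun r => UEnv.ιQ M.trivialLR (C.j r)).prod =
        Polynomial.C (l.map fun r => UEnv.ιQ M.trivialLR (C.j r)).prod := fun l => by
      induction l with
      | nil => simp
      | cons r l ih => simp [ih, hQ, C.isContraction.p_j]
    have hZ : ∀ z : List Q, (∀ q ∈ z, C.p q = 0) →
        C.weight (z.map (UEnv.ιQ M.trivialLR)).prod =
          Polynomial.monomial z.length (z.map (UEnv.ιQ M.trivialLR)).prod := fun z hz => by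
      induction z with
      | nil => simp
      | cons q z ih =>
        rw [List.map_cons, List.prod_cons, map_mul, ih fun q' h => hz q' (List.mem_cons_of_mem _ h),
          hQ, hz q List.mem_cons_self]
        simp [← Polynomial.monomial_one_one_eq_X, Polynomial.C_mul_monomial,
          Polynomial.monomial_mul_monomial, add_comm]
    induction hx using Submodule.span_induction with
    | mem x hx =>
      obtain ⟨a, l, z, hz, rfl, rfl⟩ := hx
      have hA : C.weight (UEnv.ιA M.trivialLR a) = Polynomial.C (UEnv.ιA M.trivialLR a) := by
        simp [weight]
      rw [map_mul, map_mul, hR, hZ z hz, hA, ← map_mul, Polynomial.C_mul_monomial]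
    | zero => simp
    | add x y _ _ hx hy => simp [hx, hy]
    | smul c x _ hx => rw [map_smul, hx, Polynomial.smul_monomial]
  simp [symH, key, Polynomial.lsum_apply, Polynomial.sum_monomial_index]

end LinearContraction

/-- A PBW type isomorphism `S_A Q ≅ U(Q)`: an isomorphism of filtered graded `A`-modules such that,
for all `k`, the triangle formed by it and the canonical maps from `S^{≤ k}` and from `U_k` to
`Gr_k U = U_k / U_{k-1}` commutes.  The map `S^{≤ k} → S^k → Gr_k U` annihilates `S^{≤ k-1}` and
sends `q₁ ⊙ ⋯ ⊙ q_k` to the class of `q₁ ⋯ q_k`. -/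
structure IsPBW (L : DGLieRinehart 𝔸 Q) (e : GrSymAlg L.toDGModule ≃ₗ[K] UEnv L) : Prop where
  degree : ∀ (n : ℤ) (x), x ∈ GrSymAlg.gr L.toDGModule n ↔ e x ∈ UEnv.gr L n
  linear : ∀ (a : A) (x), e (UEnv.ιA L.toDGModule.trivialLR a * x) = UEnv.ιA L a * e x
  filtered : ∀ (k : ℤ) (x), x ∈ GrSymAlg.filt L.toDGModule k ↔ e x ∈ UEnv.filt L k
  symbol : ∀ l : List Q,
    e (l.map (UEnv.ιQ L.toDGModule.trivialLR)).prod - (l.map (UEnv.ιQ L)).prod ∈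
      UEnv.filt L ((l.length : ℤ) - 1)

/-- The perturbation `t = δ₀ - δ` of `S_A Q`, where `δ₀` is the differential of `S_A Q` and `δ` is
the differential of `U(Q)`, transported to `S_A Q` along `e`. -/
def pbwPerturbation (L : DGLieRinehart 𝔸 Q) (e : GrSymAlg L.toDGModule ≃ₗ[K] UEnv L) :
    GrSymAlg L.toDGModule →ₗ[K] GrSymAlg L.toDGModule :=
  GrSymAlg.d L.toDGModule - e.symm.toLinearMap ∘ₗ UEnv.d L ∘ₗ e.toLinearMap

namespace LinearContraction

variable {L : DGLieRinehart 𝔸 Q} {N : DGModule 𝔸 R} (C : LinearContraction L.toDGModule N)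
variable (e : GrSymAlg L.toDGModule ≃ₗ[K] UEnv L)

/-- The series `X = ∑ (t h₀)^i t` for the perturbation `t` of `S_A Q` defined by `e`. -/
def pertX (hn : IsLocallyNilpotent (pbwPerturbation L e ∘ₗ C.symH)) :
    GrSymAlg L.toDGModule →ₗ[K] GrSymAlg L.toDGModule :=
  perturbationSeries (pbwPerturbation L e) C.symH hn

/-- The perturbed differential `δ_t = δ - p₀ X j₀` on `S_A R`. -/
def pertD (hn : IsLocallyNilpotent (pbwPerturbation L e ∘ₗ C.symH)) :
    GrSymAlg N →ₗ[K] GrSymAlg N :=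
  GrSymAlg.d N - C.symP.toLinearMap ∘ₗ C.pertX e hn ∘ₗ C.symJ.toLinearMap

/-- The map `p_t = p₀ (id + X h₀)`, precomposed with the identification of `U(Q)` with `S_A Q`. -/
def pertP (hn : IsLocallyNilpotent (pbwPerturbation L e ∘ₗ C.symH)) :
    UEnv L →ₗ[K] GrSymAlg N :=
  C.symP.toLinearMap ∘ₗ (LinearMap.id + C.pertX e hn ∘ₗ C.symH) ∘ₗ e.symm.toLinearMap

/-- The map `j_t = (id + h₀ X) j₀`, composed with the identification of `S_A Q` with `U(Q)`. -/
def pertJ (hn : IsLocallyNilpotent (pbwPerturbation L e ∘ₗ C.symH)) :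
    GrSymAlg N →ₗ[K] UEnv L :=
  e.toLinearMap ∘ₗ (LinearMap.id + C.symH ∘ₗ C.pertX e hn) ∘ₗ C.symJ.toLinearMap

/-- The map `h_t = h₀ + h₀ X h₀`, transported to `U(Q)`. -/
def pertH (hn : IsLocallyNilpotent (pbwPerturbation L e ∘ₗ C.symH)) :
    UEnv L →ₗ[K] UEnv L :=
  e.toLinearMap ∘ₗ (C.symH + C.symH ∘ₗ C.pertX e hn ∘ₗ C.symH) ∘ₗ e.symm.toLinearMap

end LinearContraction

end Modules

end

/-! Symmetric algebras. The anticommutator of the derivation h' with δ₀ is an even derivation. It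
vanishes on A and on j(R) and is the identity on Z = ker p, so it multiplies a product with i
factors from Z by i (`IsWeighted.anticommutator`). Hence h'/i contracts weight i > 0, while j p is
the identity in weight 0. The weighted products span S_A Q, so each identity between linear maps is
checked on them (`ext_isWeighted`, `isContraction_sym`). The algebra morphism `weight` reads off the
weight on all of S_A Q, so no separate proof that the decomposition is direct is needed.

Perturbation. Both differentials are derivations with the same values on generators, and PBW agrees
with multiplication up to lower order. So PBW intertwines them up to lower order, that is, t lowers
the filtration (`IsPBW.pbwPerturbation_mem_filt`). As h₀ preserves the filtration, t h₀ is locally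
nilpotent. The map δ₀ - t is the differential of U(Q) conjugated by PBW, so it squares to zero and
the homological perturbation lemma applies (`IsContraction.perturb`). Its core is the identity d X +
X d = X j p X. The outcome is carried to U(Q) along PBW (`IsContraction.transport`).

Transfer. Functions on words in W with values in U(Q) form an algebra under convolution, and an
operation b on words induces a coderivation b̂ of the tensor coalgebra. With signs absorbed in the
parity automorphism, put G = -j + h β with β = par G * G, and b = d_W + p β. Associativity of
convolution and the homotopy identity give D G = β + G ∘ b̂ by induction on the word length
(`D_transferWords`), and then b ∘ b̂ = 0 (`transferOperation_square`). On elements of degrees n_r,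
the sign with exponent ∑ (k - 1 - r) n_r turns G and b into γ_k and α_k, and b ∘ b̂ = 0 into the
Stasheff identities (`stasheff_term`). -/

noncomputable section

/-! ### Scaling and parity operators on graded spaces. -/

section GradedScale

variable {K V : Type*} [Field K] [AddCommGroup V] [Module K V]

/-- The endomorphism of a graded space that multiplies elements of degree `n` by `c ^ n`. -/
def gradedScale (c : K) {gr : ℤ → Submodule K V} (hgr : DirectSum.IsInternal gr) : V →ₗ[K] V :=
  DirectSum.toModule K ℤ V (fun n => c ^ n • (gr n).subtype) ∘ₗ
    (LinearEquiv.ofBijective (DirectSum.coeLinearMap gr) hgr).symm.toLinearMap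

theorem gradedScale_of_mem (c : K) {gr : ℤ → Submodule K V} (hgr : DirectSum.IsInternal gr)
    {n : ℤ} {x : V} (hx : x ∈ gr n) : gradedScale c hgr x = c ^ n • x := by
  have : (LinearEquiv.ofBijective (DirectSum.coeLinearMap gr) hgr).symm x =
      DirectSum.lof K ℤ (fun n => gr n) n ⟨x, hx⟩ := by
    rw [LinearEquiv.symm_apply_eq]
    exact (DirectSum.coeLinearMap_lof gr n ⟨x, hx⟩).symm
  simp [gradedScale, this]

variable {gr : ℤ → Submodule K V} (hgr : DirectSum.IsInternal gr)

@[simp] theorem parity_parity (x : V) : parity hgr (parity hgr x) = x := by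
  induction x using internal_induction hgr with
  | h0 => simp
  | hadd x y hx hy => simp [hx, hy]
  | hP n x hx => simp [parity_of_mem hgr hx, smul_smul, neg_one_zpow_mul_self]

theorem parity_odd {W : Type*} [AddCommGroup W] [Module K W] {grW : ℤ → Submodule K W}
    (hW : DirectSum.IsInternal grW) {s : ℤ} (hs : Odd s) {f : V →ₗ[K] W}
    (hf : ∀ {n : ℤ} {x : V}, x ∈ gr n → f x ∈ grW (n + s)) (x : V) :
    f (parity hgr x) = - parity hW (f x) := by
  induction x using internal_induction hgr with
  | h0 => simp
  | hadd x y hx hy => simp only [map_add, hx, hy]; abel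
  | hP n x hx =>
    rw [parity_of_mem hgr hx, parity_of_mem hW (hf hx), map_smul,
      zpow_add₀ (neg_ne_zero.2 one_ne_zero), hs.neg_one_zpow]
    simp

theorem parity_even {W : Type*} [AddCommGroup W] [Module K W] {grW : ℤ → Submodule K W}
    (hW : DirectSum.IsInternal grW) {f : V →ₗ[K] W}
    (hf : ∀ {n : ℤ} {x : V}, x ∈ gr n → f x ∈ grW n) (x : V) :
    f (parity hgr x) = parity hW (f x) := by
  induction x using internal_induction hgr with
  | h0 => simp
  | hadd x y hx hy => simp only [map_add, hx, hy]
  | hP n x hx => rw [parity_of_mem hgr hx, parity_of_mem hW (hf hx), map_smul]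

end GradedScale

section Modules

variable {K A : Type*} [Field K] [Ring A] [Algebra K A]
variable {𝔸 : CommDGAlgebra K A}
variable {Q R : Type*} [AddCommGroup Q] [Module K Q] [Module A Q] [IsScalarTower K A Q]
variable [AddCommGroup R] [Module K R] [Module A R] [IsScalarTower K A R]

/-! ### Grading and filtration of the enveloping algebra. -/

namespace UEnv

variable {L : DGLieRinehart 𝔸 Q}

theorem generator_induction {P : UEnv L → Prop} (hA : ∀ a, P (ιA L a)) (hQ : ∀ q, P (ιQ L q))
    (hadd : ∀ x y, P x → P y → P (x + y)) (hmul : ∀ x y, P x → P y → P (x * y)) (x : UEnv L) :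
    P x :=
  mem_of_generators
    { carrier := {x | P x}
      mul_mem' := fun {x y} hx hy => hmul x y hx hy
      add_mem' := fun {x y} hx hy => hadd x y hx hy
      algebraMap_mem' := fun c => by
        -- Scalars need no case of their own, since they come from A.
        have : algebraMap K (UEnv L) c = ιA L (c • 1) := by
          rw [map_smul, (isEnveloping L).one, Algebra.algebraMap_eq_smul_one]
        simpa [this] using hA (c • 1) } hA hQ x

@[simp] theorem par_ιA (a : A) : par L (ιA L a) = ιA L (parity 𝔸.internal a) := by simp [par]

@[simp] theorem par_ιQ (q : Q) : par L (ιQ L q) = ιQ L (parity L.internal q) := by simp [par]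

@[simp] theorem par_par (x : UEnv L) : par L (par L x) = x := by
  induction x using generator_induction with
  | hA a => simp
  | hQ q => simp
  | hadd x y hx hy => simp [hx, hy]
  | hmul x y hx hy => simp [hx, hy]

theorem ιA_mem {i : ℤ} {a : A} (ha : a ∈ 𝔸.gr i) : ιA L a ∈ gr L i :=
  Submodule.subset_span ⟨i, a, [], ha, by simp, by simp, by simp⟩

theorem ιQ_mem {i : ℤ} {q : Q} (hq : q ∈ L.gr i) : ιQ L q ∈ gr L i :=
  Submodule.subset_span ⟨0, 1, [(i, q)], 𝔸.one_mem, by simpa using hq, by simp,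
    by simp [(isEnveloping L).one]⟩

theorem ιA_mul_mem {i n : ℤ} {a : A} {x : UEnv L} (ha : a ∈ 𝔸.gr i) (hx : x ∈ gr L n) :
    ιA L a * x ∈ gr L (i + n) := by
  induction hx using Submodule.span_induction with
  | mem x hx =>
    obtain ⟨k, b, l, hb, hl, rfl, rfl⟩ := hx
    rw [← mul_assoc, ← (isEnveloping L).mul]
    exact Submodule.subset_span ⟨i + k, a * b, l, 𝔸.mul_mem ha hb, hl, by ring, rfl⟩
  | zero => simp
  | add x y _ _ hx hy => rw [mul_add]; exact add_mem hx hy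
  | smul c x _ hx => rw [mul_smul_comm]; exact Submodule.smul_mem _ _ hx

/-- Spanning elements carry their coefficient from A on the left. Commuting q past it costs one
extra term, with coefficient `L.act q b`, of the same total degree. -/
theorem ιQ_mul_mem {i n : ℤ} {q : Q} {x : UEnv L} (hq : q ∈ L.gr i) (hx : x ∈ gr L n) :
    ιQ L q * x ∈ gr L (i + n) := by
  induction hx using Submodule.span_induction with
  | mem x hx =>
    obtain ⟨k, b, l, hb, hl, rfl, rfl⟩ := hx
    rw [← mul_assoc, (isEnveloping L).act hq hb, add_mul, smul_mul_assoc, mul_assoc]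
    refine add_mem (Submodule.smul_mem _ _ ?_) ?_
    · exact Submodule.subset_span ⟨k, b, (i, q) :: l, hb, by simpa using ⟨hq, by simpa using hl⟩,
        by simp; ring, by simp⟩
    · exact Submodule.subset_span ⟨i + k, L.act q b, l, L.act_mem hq hb, hl, by ring, rfl⟩
  | zero => simp
  | add x y _ _ hx hy => rw [mul_add]; exact add_mem hx hy
  | smul c x _ hx => rw [mul_smul_comm]; exact Submodule.smul_mem _ _ hx

theorem mul_mem {m n : ℤ} {x y : UEnv L} (hx : x ∈ gr L m) (hy : y ∈ gr L n) :
    x * y ∈ gr L (m + n) := by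
  induction hx using Submodule.span_induction with
  | mem x hx =>
    obtain ⟨k, b, l, hb, hl, rfl, rfl⟩ := hx
    rw [mul_assoc, add_assoc]
    refine ιA_mul_mem hb ?_
    clear hb
    induction l with
    | nil => simpa using hy
    | cons z l ih =>
      simp only [List.map_cons, List.prod_cons, List.sum_cons, mul_assoc, add_assoc]
      exact ιQ_mul_mem (hl z List.mem_cons_self) (ih fun w hw => hl w (List.mem_cons_of_mem _ hw))
  | zero => simp
  | add x y _ _ hx hy => rw [add_mul]; exact add_mem hx hy
  | smul c x _ hx => rw [smul_mul_assoc]; exact Submodule.smul_mem _ _ hx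

theorem iSup_gr (L : DGLieRinehart 𝔸 Q) : ⨆ n, gr L n = ⊤ := by
  refine eq_top_iff.2 fun x _ => ?_
  induction x using generator_induction with
  | hA a =>
    induction a using internal_induction 𝔸.internal with
    | hP n a ha => exact Submodule.mem_iSup_of_mem n (ιA_mem ha)
    | h0 => simp
    | hadd a b ha hb => rw [map_add]; exact add_mem (ha trivial) (hb trivial)
  | hQ q =>
    induction q using internal_induction L.internal with
    | hP n a ha => exact Submodule.mem_iSup_of_mem n (ιQ_mem ha)
    | h0 => simp
    | hadd a b ha hb => rw [map_add]; exact add_mem (ha trivial) (hb trivial)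
  | hadd x y hx hy => exact add_mem (hx trivial) (hy trivial)
  | hmul x y hx hy =>
    refine Submodule.iSup_induction _ (motive := fun x => x * y ∈ ⨆ n, gr L n) (hx trivial)
      (fun m x hx => ?_) (by simp) fun x z hx hz => by rw [add_mul]; exact add_mem hx hz
    refine Submodule.iSup_induction _ (motive := fun y => x * y ∈ ⨆ n, gr L n) (hy trivial)
      (fun n y hy => ?_) (by simp) fun y z hy hz => by rw [mul_add]; exact add_mem hy hz
    exact Submodule.mem_iSup_of_mem (m + n) (mul_mem hx hy)

/-- The defining relations are homogeneous, so scaling degree n by c ^ n respects them. The induced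
endomorphism of U(Q) separates the degrees in `gr_internal`. -/
theorem isEnveloping_gradedScale (L : DGLieRinehart 𝔸 Q) {c : K} (hc : c ≠ 0) :
    IsEnveloping L (ιA L ∘ₗ gradedScale c 𝔸.internal) (ιQ L ∘ₗ gradedScale c L.internal) := by
  have H := isEnveloping L
  refine ⟨?_, ?_, ?_, ?_, ?_⟩
  · simp [gradedScale_of_mem c 𝔸.internal 𝔸.one_mem, H.one]
  · intro a b
    induction a using internal_induction 𝔸.internal with
    | h0 => simp
    | hadd x y hx hy => rw [add_mul, map_add, hx, hy, map_add, add_mul]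
    | hP i a ha =>
      induction b using internal_induction 𝔸.internal with
      | h0 => simp
      | hadd x y hx hy => rw [mul_add, map_add, hx, hy, map_add, mul_add]
      | hP j b hb =>
        simp [gradedScale_of_mem c 𝔸.internal ha, gradedScale_of_mem c 𝔸.internal hb,
          gradedScale_of_mem c 𝔸.internal (𝔸.mul_mem ha hb), H.mul, zpow_add₀ hc, smul_smul,
          mul_comm]
  · intro a q
    induction a using internal_induction 𝔸.internal with
    | h0 => simp
    | hadd x y hx hy => rw [add_smul, map_add, hx, hy, map_add, add_mul]
    | hP i a ha =>
      induction q using internal_induction L.internal with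
      | h0 => simp
      | hadd x y hx hy => rw [smul_add, map_add, hx, hy, map_add, mul_add]
      | hP j q hq =>
        simp [gradedScale_of_mem c 𝔸.internal ha, gradedScale_of_mem c L.internal hq,
          gradedScale_of_mem c L.internal (L.smul_mem ha hq), H.smul, zpow_add₀ hc, smul_smul,
          mul_comm]
  · intro i j q a hq ha
    simp only [LinearMap.comp_apply, gradedScale_of_mem c 𝔸.internal ha,
      gradedScale_of_mem c L.internal hq, gradedScale_of_mem c 𝔸.internal (L.act_mem hq ha),
      map_smul, smul_mul_assoc, mul_smul_comm, H.act hq ha, smul_add, smul_smul, zpow_add₀ hc]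
    congr 2 <;> ring
  · intro i j q r hq hr
    simp only [LinearMap.comp_apply, gradedScale_of_mem c L.internal hq,
      gradedScale_of_mem c L.internal hr, gradedScale_of_mem c L.internal (L.bracket_mem hq hr),
      map_smul, smul_mul_assoc, mul_smul_comm, H.bracket hq hr, smul_add, smul_smul, zpow_add₀ hc]
    congr 2 <;> ring

theorem scale_of_mem {c : K} (hc : c ≠ 0) {n : ℤ} {x : UEnv L} (hx : x ∈ gr L n) :
    lift (isEnveloping_gradedScale L hc) x = c ^ n • x := by
  induction hx using Submodule.span_induction with
  | mem x hx =>
    obtain ⟨i, a, l, ha, hl, rfl, rfl⟩ := hx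
    have hl' : lift (isEnveloping_gradedScale L hc) (l.map fun y => ιQ L y.2).prod =
        c ^ (l.map Prod.fst).sum • (l.map fun y => ιQ L y.2).prod := by
      induction l with
      | nil => simp
      | cons y l ih =>
        have h1 : lift (isEnveloping_gradedScale L hc) (ιQ L y.2) = c ^ y.1 • ιQ L y.2 := by
          simp [gradedScale_of_mem c L.internal (hl y List.mem_cons_self)]
        rw [List.map_cons, List.prod_cons, map_mul, h1,
          ih fun z hz => hl z (List.mem_cons_of_mem _ hz), List.map_cons, List.sum_cons,
          zpow_add₀ hc, smul_mul_assoc, mul_smul_comm, smul_smul]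
    rw [map_mul, hl', lift_ιA, LinearMap.comp_apply, gradedScale_of_mem c 𝔸.internal ha,
      map_smul, zpow_add₀ hc, smul_mul_assoc, mul_smul_comm, smul_smul]
  | zero => simp
  | add x y _ _ hx hy => rw [map_add, hx, hy, smul_add]
  | smul c x _ hx => rw [map_smul, hx, smul_comm]

/-- The pieces `gr L n` are defined as spans, so their independence needs an argument: they lie in
eigenspaces of the scaling endomorphism for the eigenvalues 2 ^ n, which are distinct in
characteristic zero. -/
theorem gr_internal [CharZero K] (L : DGLieRinehart 𝔸 Q) : DirectSum.IsInternal (gr L) := by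
  refine DirectSum.isInternal_submodule_of_iSupIndep_of_iSup_eq_top ?_ (iSup_gr L)
  have h2 : (2 : K) ≠ 0 := two_ne_zero
  have hinj : Function.Injective fun n : ℤ => (2 : K) ^ n := by
    intro m n h
    -- The powers are compared in ℚ, an ordered field that embeds into K.
    have h' : (2 : ℚ) ^ m = (2 : ℚ) ^ n := by
      have h : (2 : K) ^ m = (2 : K) ^ n := h
      apply Rat.cast_injective (α := K)
      push_cast
      exact h
    exact zpow_right_injective₀ (by norm_num) (by norm_num) h'
  refine ((Module.End.eigenspaces_iSupIndep
    (lift (isEnveloping_gradedScale L h2)).toLinearMap).comp hinj).mono fun n x hx => ?_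
  exact Module.End.mem_eigenspace_iff.2 (scale_of_mem h2 hx)

theorem filt_mono {k m : ℤ} (h : k ≤ m) : filt L k ≤ filt L m :=
  Submodule.span_mono fun _ ⟨a, l, hl, hx⟩ => ⟨a, l, hl.trans h, hx⟩

theorem filt_of_neg {k : ℤ} (h : k < 0) : filt L k = ⊥ := by
  rw [filt, Submodule.span_eq_bot]
  rintro x ⟨a, l, hl, -⟩
  have := Int.natCast_nonneg l.length
  omega

theorem ιA_mem_filt (a : A) : ιA L a ∈ filt L 0 :=
  Submodule.subset_span ⟨a, [], by simp, by simp⟩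

theorem prod_mem_filt (l : List Q) : (l.map (ιQ L)).prod ∈ filt L l.length :=
  Submodule.subset_span ⟨1, l, le_rfl, by simp [(isEnveloping L).one]⟩

theorem ιQ_mem_filt (q : Q) : ιQ L q ∈ filt L 1 := by
  simpa using prod_mem_filt (L := L) [q]

theorem ιA_mul_mem_filt {k : ℤ} (a : A) {x : UEnv L} (hx : x ∈ filt L k) :
    ιA L a * x ∈ filt L k := by
  induction hx using Submodule.span_induction with
  | mem x hx =>
    obtain ⟨b, l, hl, rfl⟩ := hx
    rw [← mul_assoc, ← (isEnveloping L).mul]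
    exact Submodule.subset_span ⟨a * b, l, hl, rfl⟩
  | zero => simp
  | add x y _ _ hx hy => rw [mul_add]; exact add_mem hx hy
  | smul c x _ hx => rw [mul_smul_comm]; exact Submodule.smul_mem _ _ hx

/-- Moving q past the coefficient creates a term with no new factor from Q, which is harmless. -/
theorem ιQ_mul_mem_filt {k : ℤ} (q : Q) {x : UEnv L} (hx : x ∈ filt L k) :
    ιQ L q * x ∈ filt L (k + 1) := by
  induction hx using Submodule.span_induction with
  | mem x hx =>
    obtain ⟨b, l, hl, rfl⟩ := hx
    induction q using internal_induction L.internal with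
    | h0 => simp
    | hadd q r hq hr => rw [map_add, add_mul]; exact add_mem hq hr
    | hP i q hq =>
      induction b using internal_induction 𝔸.internal with
      | h0 => simp
      | hadd a b ha hb => rw [map_add, add_mul, mul_add]; exact add_mem ha hb
      | hP j b hb =>
        rw [← mul_assoc, (isEnveloping L).act hq hb, add_mul, smul_mul_assoc, mul_assoc]
        refine add_mem (Submodule.smul_mem _ _ ?_) ?_
        · exact Submodule.subset_span ⟨b, q :: l, by simpa using hl, by simp⟩
        · exact Submodule.subset_span ⟨L.act q b, l, by omega, rfl⟩
  | zero => simp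
  | add x y _ _ hx hy => rw [mul_add]; exact add_mem hx hy
  | smul c x _ hx => rw [mul_smul_comm]; exact Submodule.smul_mem _ _ hx

theorem mul_mem_filt {k m : ℤ} {x y : UEnv L} (hx : x ∈ filt L k) (hy : y ∈ filt L m) :
    x * y ∈ filt L (k + m) := by
  induction hx using Submodule.span_induction with
  | mem x hx =>
    obtain ⟨a, l, hl, rfl⟩ := hx
    refine filt_mono (by omega : (l.length : ℤ) + m ≤ k + m) ?_
    rw [mul_assoc]
    refine ιA_mul_mem_filt a ?_
    clear hl
    induction l with
    | nil => simpa using hy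
    | cons q l ih =>
      rw [List.map_cons, List.prod_cons, mul_assoc, List.length_cons]
      have := ιQ_mul_mem_filt q ih
      convert this using 2
      push_cast
      ring
  | zero => simp
  | add x y _ _ hx hy => rw [add_mul]; exact add_mem hx hy
  | smul c x _ hx => rw [smul_mul_assoc]; exact Submodule.smul_mem _ _ hx

theorem exists_mem_filt (x : UEnv L) : ∃ k : ℕ, x ∈ filt L k := by
  induction x using generator_induction with
  | hA a => exact ⟨0, ιA_mem_filt a⟩
  | hQ q => exact ⟨1, ιQ_mem_filt q⟩
  | hadd x y hx hy =>
    obtain ⟨k, hk⟩ := hx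
    obtain ⟨m, hm⟩ := hy
    exact ⟨k + m, add_mem (filt_mono (by omega) hk) (filt_mono (by omega) hm)⟩
  | hmul x y hx hy =>
    obtain ⟨k, hk⟩ := hx
    obtain ⟨m, hm⟩ := hy
    exact ⟨k + m, by exact_mod_cast mul_mem_filt hk hm⟩

/-- A linear map that sends the products of at most `k` generators to a subspace sends
`filt L k` there. -/
theorem filt_le_comap {V : Type*} [AddCommGroup V] [Module K V] {S : ℤ → Submodule K V}
    (hS : Monotone S) {f : UEnv L →ₗ[K] V}
    (hf : ∀ (a : A) (l : List Q), f (ιA L a * (l.map (ιQ L)).prod) ∈ S l.length) {k : ℤ}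
    {x : UEnv L} (hx : x ∈ filt L k) : f x ∈ S k := by
  induction hx using Submodule.span_induction with
  | mem x hx =>
    obtain ⟨a, l, hl, rfl⟩ := hx
    exact hS hl (hf a l)
  | zero => simp
  | add x y _ _ hx hy => rw [map_add]; exact add_mem hx hy
  | smul c x _ hx => rw [map_smul]; exact Submodule.smul_mem _ _ hx

theorem filt_monotone (L : DGLieRinehart 𝔸 Q) : Monotone (filt L) := fun _ _ h => filt_mono h

end UEnv

/-! ### Odd derivations of the enveloping algebra. -/

namespace OddDerivation

variable {L : DGLieRinehart 𝔸 Q} (D : OddDerivation L)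

theorem toUEnv_par (x : UEnv L) : D.toUEnv (UEnv.par L x) = - UEnv.par L (D.toUEnv x) := by
  induction x using UEnv.generator_induction with
  | hA a => simp [parity_odd 𝔸.internal 𝔸.internal D.odd D.onA_mem]
  | hQ q => simp [parity_odd L.internal L.internal D.odd D.onQ_mem]
  | hadd x y hx hy => simp only [map_add, hx, hy]; abel
  | hmul x y hx hy =>
    simp only [map_mul, toUEnv_mul, map_add, hx, hy, UEnv.par_par]
    simp only [neg_mul, mul_neg, neg_add]

/-- The square of an odd derivation is a derivation, because the mixed terms cancel as `D`
anticommutes with `par`. So it suffices that it vanishes on generators. -/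
theorem toUEnv_toUEnv (hA : ∀ a, D.onA (D.onA a) = 0) (hQ : ∀ q, D.onQ (D.onQ q) = 0)
    (x : UEnv L) : D.toUEnv (D.toUEnv x) = 0 := by
  induction x using UEnv.generator_induction with
  | hA a => simp [hA]
  | hQ q => simp [hQ]
  | hadd x y hx hy => simp [hx, hy]
  | hmul x y hx hy => simp [toUEnv_mul, toUEnv_par, hx, hy]

theorem toUEnv_mul_of_mem {n : ℤ} {x : UEnv L} (hx : x ∈ UEnv.gr L n) (y : UEnv L) :
    D.toUEnv (x * y) = D.toUEnv x * y + (-1 : K) ^ n • (x * D.toUEnv y) := by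
  rw [toUEnv_mul, UEnv.par_of_mem hx, smul_mul_assoc]

theorem toUEnv_mem {n : ℤ} {x : UEnv L} (hx : x ∈ UEnv.gr L n) :
    D.toUEnv x ∈ UEnv.gr L (n + D.s) := by
  induction hx using Submodule.span_induction with
  | mem x hx =>
    obtain ⟨k, b, l, hb, hl, rfl, rfl⟩ := hx
    have key : (l.map fun y => UEnv.ιQ L y.2).prod ∈ UEnv.gr L (l.map Prod.fst).sum ∧
        D.toUEnv (l.map fun y => UEnv.ιQ L y.2).prod ∈
          UEnv.gr L ((l.map Prod.fst).sum + D.s) := by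
      induction l with
      | nil =>
        have h1 : (1 : UEnv L) = UEnv.ιA L 1 := (UEnv.isEnveloping L).one.symm
        simp only [List.map_nil, List.prod_nil, List.sum_nil]
        rw [h1, toUEnv_ιA]
        exact ⟨UEnv.ιA_mem 𝔸.one_mem, UEnv.ιA_mem (D.onA_mem 𝔸.one_mem)⟩
      | cons z l ih =>
        obtain ⟨h1, h2⟩ := ih fun w hw => hl w (List.mem_cons_of_mem _ hw)
        have hz := hl z List.mem_cons_self
        simp only [List.map_cons, List.prod_cons, List.sum_cons]
        refine ⟨UEnv.mul_mem (UEnv.ιQ_mem hz) h1, ?_⟩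
        rw [D.toUEnv_mul_of_mem (UEnv.ιQ_mem hz), toUEnv_ιQ]
        refine add_mem ?_ (Submodule.smul_mem _ _ ?_)
        · convert UEnv.mul_mem (UEnv.ιQ_mem (D.onQ_mem hz)) h1 using 2
          ring
        · convert UEnv.mul_mem (UEnv.ιQ_mem hz) h2 using 2
          ring
    rw [D.toUEnv_mul_of_mem (UEnv.ιA_mem hb), toUEnv_ιA]
    refine add_mem ?_ (Submodule.smul_mem _ _ ?_)
    · convert UEnv.mul_mem (UEnv.ιA_mem (D.onA_mem hb)) key.1 using 2
      ring
    · convert UEnv.mul_mem (UEnv.ιA_mem hb) key.2 using 2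
      ring
  | zero => simp
  | add x y _ _ hx hy => rw [map_add]; exact add_mem hx hy
  | smul c x _ hx => rw [map_smul]; exact Submodule.smul_mem _ _ hx

theorem toUEnv_one : D.toUEnv 1 = 0 := by
  have := D.toUEnv_mul 1 1
  simpa using this

theorem toUEnv_prod_mem_filt (l : List Q) :
    D.toUEnv (l.map (UEnv.ιQ L)).prod ∈ UEnv.filt L l.length := by
  induction l with
  | nil => simp [toUEnv_one]
  | cons q l ih =>
    rw [List.map_cons, List.prod_cons, toUEnv_mul, toUEnv_ιQ, UEnv.par_ιQ, List.length_cons,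
      Nat.cast_add, Nat.cast_one, add_comm (l.length : ℤ) 1]
    exact add_mem (UEnv.mul_mem_filt (UEnv.ιQ_mem_filt _) (UEnv.prod_mem_filt l))
      (UEnv.mul_mem_filt (UEnv.ιQ_mem_filt _) ih)

theorem toUEnv_mem_filt {k : ℤ} {x : UEnv L} (hx : x ∈ UEnv.filt L k) :
    D.toUEnv x ∈ UEnv.filt L k := by
  refine UEnv.filt_le_comap (UEnv.filt_monotone L) (fun a l => ?_) hx
  rw [toUEnv_mul, toUEnv_ιA, UEnv.par_ιA]
  exact add_mem (UEnv.ιA_mul_mem_filt _ (UEnv.prod_mem_filt l))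
    (UEnv.ιA_mul_mem_filt _ (D.toUEnv_prod_mem_filt l))

/-- The anticommutator of two odd derivations is a derivation. -/
theorem anticommutator_mul (D' : OddDerivation L) (x y : UEnv L) :
    D.toUEnv (D'.toUEnv (x * y)) + D'.toUEnv (D.toUEnv (x * y)) =
      (D.toUEnv (D'.toUEnv x) + D'.toUEnv (D.toUEnv x)) * y +
        x * (D.toUEnv (D'.toUEnv y) + D'.toUEnv (D.toUEnv y)) := by
  simp only [toUEnv_mul, map_add, toUEnv_par, UEnv.par_par, add_mul, mul_add, neg_mul]
  abel

end OddDerivation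

theorem UEnv.isCochainComplex [CharZero K] (L : DGLieRinehart 𝔸 Q) :
    IsCochainComplex (UEnv.gr L) (UEnv.d L) where
  internal := UEnv.gr_internal L
  d_mem := L.differential.toUEnv_mem
  d_d := L.differential.toUEnv_toUEnv 𝔸.d_d L.d_d

end Modules

section Modules

variable {K A : Type*} [Field K] [Ring A] [Algebra K A]
variable {𝔸 : CommDGAlgebra K A}
variable {Q R : Type*} [AddCommGroup Q] [Module K Q] [Module A Q] [IsScalarTower K A Q]
variable [AddCommGroup R] [Module K R] [Module A R] [IsScalarTower K A R]

/-! ### Functoriality of the symmetric algebra. -/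

namespace GrSymAlg

variable {M : DGModule 𝔸 Q} {N : DGModule 𝔸 R} {f : Q →ₗ[K] R}
  (hf : ∀ (a : A) (q : Q), f (a • q) = a • f q)
  (hd : ∀ {n : ℤ} {q : Q}, q ∈ M.gr n → f q ∈ N.gr n)

@[simp] theorem map_ιA (a : A) :
    map f hf hd (UEnv.ιA M.trivialLR a) = UEnv.ιA N.trivialLR a := by simp [map]

@[simp] theorem map_ιQ (q : Q) :
    map f hf hd (UEnv.ιQ M.trivialLR q) = UEnv.ιQ N.trivialLR (f q) := by simp [map]

/-- The signed Leibniz rule is expressed through `par`, so this compatibility lets `map_d` be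
checked on generators. -/
theorem map_par (x : GrSymAlg M) :
    map f hf hd (UEnv.par M.trivialLR x) = UEnv.par N.trivialLR (map f hf hd x) := by
  induction x using UEnv.generator_induction with
  | hA a => simp
  | hQ q => simpa using congrArg (UEnv.ιQ N.trivialLR) (parity_even M.internal N.internal hd q)
  | hadd x y hx hy => simp only [map_add, hx, hy]
  | hmul x y hx hy => simp only [map_mul, hx, hy]

@[simp] theorem d_ιA (a : A) :
    d M (UEnv.ιA M.trivialLR a) = UEnv.ιA M.trivialLR (𝔸.d a) := by
  simp [UEnv.d, DGLieRinehart.differential]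

@[simp] theorem d_ιQ (q : Q) :
    d M (UEnv.ιQ M.trivialLR q) = UEnv.ιQ M.trivialLR (M.d q) := by
  simp only [UEnv.d, OddDerivation.toUEnv_ιQ]
  rfl

theorem map_d (hfd : ∀ q, f (M.d q) = N.d (f q)) (x : GrSymAlg M) :
    map f hf hd (d M x) = d N (map f hf hd x) := by
  induction x using UEnv.generator_induction with
  | hA a => rw [d_ιA, map_ιA, map_ιA, d_ιA]
  | hQ q => rw [d_ιQ, map_ιQ, map_ιQ, d_ιQ, hfd]
  | hadd x y hx hy => simp only [map_add, hx, hy]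
  | hmul x y hx hy =>
    simp only [UEnv.d, OddDerivation.toUEnv_mul, map_add, map_mul, map_par] at hx hy ⊢
    rw [hx, hy]

theorem map_prod (l : List Q) : map f hf hd (l.map (UEnv.ιQ M.trivialLR)).prod =
    ((l.map f).map (UEnv.ιQ N.trivialLR)).prod := by
  induction l with
  | nil => simp
  | cons q l ih => simp [ih]

theorem map_mem_filt {k : ℤ} {x : GrSymAlg M} (hx : x ∈ filt M k) : map f hf hd x ∈ filt N k := by
  refine UEnv.filt_le_comap (f := (map f hf hd).toLinearMap) (UEnv.filt_monotone N.trivialLR)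
    (fun a l => ?_) hx
  rw [AlgHom.toLinearMap_apply, map_mul, map_prod, map_ιA]
  exact Submodule.subset_span ⟨a, l.map f, by simp, rfl⟩

theorem map_mem {n : ℤ} {x : GrSymAlg M} (hx : x ∈ gr M n) : map f hf hd x ∈ gr N n := by
  induction hx using Submodule.span_induction with
  | mem x hx =>
    obtain ⟨k, b, l, hb, hl, rfl, rfl⟩ := hx
    have key : map f hf hd (l.map fun y => UEnv.ιQ M.trivialLR y.2).prod =
        ((l.map fun y => (y.1, f y.2)).map fun y => UEnv.ιQ N.trivialLR y.2).prod := by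
      have := map_prod (N := N) hf hd (l.map Prod.snd)
      simpa [List.map_map, Function.comp_def] using this
    rw [map_mul, key, map_ιA]
    refine Submodule.subset_span ⟨k, b, _, hb, ?_, ?_, rfl⟩
    · intro y hy
      obtain ⟨z, hz, rfl⟩ := List.mem_map.1 hy
      exact hd (hl z hz)
    · simp [Function.comp_def]
  | zero => simp
  | add x y _ _ hx hy => rw [map_add]; exact add_mem hx hy
  | smul c x _ hx => rw [map_smul]; exact Submodule.smul_mem _ _ hx

end GrSymAlg

/-! ### The contraction of symmetric algebras, by the number of factors in ker p. -/

namespace LinearContraction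

variable {M : DGModule 𝔸 Q} {N : DGModule 𝔸 R} (C : LinearContraction M N)

@[simp] theorem symP_ιA (a : A) :
    C.symP (UEnv.ιA M.trivialLR a) = UEnv.ιA N.trivialLR a :=
  GrSymAlg.map_ιA C.p_smul C.isContraction.p_mem a

@[simp] theorem symP_ιQ (q : Q) :
    C.symP (UEnv.ιQ M.trivialLR q) = UEnv.ιQ N.trivialLR (C.p q) :=
  GrSymAlg.map_ιQ C.p_smul C.isContraction.p_mem q

@[simp] theorem symJ_ιA (a : A) :
    C.symJ (UEnv.ιA N.trivialLR a) = UEnv.ιA M.trivialLR a :=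
  GrSymAlg.map_ιA C.j_smul C.isContraction.j_mem a

@[simp] theorem symJ_ιQ (r : R) :
    C.symJ (UEnv.ιQ N.trivialLR r) = UEnv.ιQ M.trivialLR (C.j r) :=
  GrSymAlg.map_ιQ C.j_smul C.isContraction.j_mem r

@[simp] theorem symH'_ιA (a : A) : C.symH' (UEnv.ιA M.trivialLR a) = 0 := by
  simp [symH', homotopyDerivation]

@[simp] theorem symH'_ιQ (q : Q) :
    C.symH' (UEnv.ιQ M.trivialLR q) = UEnv.ιQ M.trivialLR (C.h q) := by
  simp [symH', homotopyDerivation]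

theorem symP_symJ (y : GrSymAlg N) : C.symP (C.symJ y) = y := by
  induction y using UEnv.generator_induction with
  | hA a => simp
  | hQ q => simp [C.isContraction.p_j]
  | hadd x y hx hy => simp only [map_add, hx, hy]
  | hmul x y hx hy => simp only [map_mul, hx, hy]

theorem symH'_symH' (x : GrSymAlg M) : C.symH' (C.symH' x) = 0 :=
  C.homotopyDerivation.toUEnv_toUEnv (fun _ => rfl) C.isContraction.h_h x

/-- The elements of `S_A R ⊗ S_A^i Z`, where `Z = ker p`, that are of symmetric degree at most
`k`. -/
inductive IsWeighted : ℕ → ℕ → GrSymAlg M → Prop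
  | base (a : A) : IsWeighted 0 0 (UEnv.ιA M.trivialLR a)
  | range (r : R) : IsWeighted 0 1 (UEnv.ιQ M.trivialLR (C.j r))
  | ker (z : Q) (hz : C.p z = 0) : IsWeighted 1 1 (UEnv.ιQ M.trivialLR z)
  | add {i k : ℕ} {x y : GrSymAlg M} (hx : IsWeighted i k x) (hy : IsWeighted i k y) :
      IsWeighted i k (x + y)
  | smul {i k : ℕ} (c : K) {x : GrSymAlg M} (hx : IsWeighted i k x) : IsWeighted i k (c • x)
  | mul {i k i' k' : ℕ} {x y : GrSymAlg M} (hx : IsWeighted i k x) (hy : IsWeighted i' k' y) :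
      IsWeighted (i + i') (k + k') (x * y)

variable {C}

namespace IsWeighted

/-- This makes `symH`, which is defined through the coefficients of `weight`, computable on weighted
elements. -/
theorem weight_eq {i k : ℕ} {x : GrSymAlg M} (hx : C.IsWeighted i k x) :
    C.weight x = Polynomial.monomial i x := by
  induction hx with
  | base a => simp [weight]
  | range r => simp [weight, C.isContraction.p_j]
  | ker z hz => simp [weight, hz, ← Polynomial.monomial_one_one_eq_X, Polynomial.C_mul_monomial]
  | add _ _ hx hy => rw [map_add, hx, hy, map_add]
  | smul c _ hx => rw [map_smul, hx, Polynomial.smul_monomial]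
  | mul _ _ hx hy => rw [map_mul, hx, hy, Polynomial.monomial_mul_monomial]

theorem symH_eq {i k : ℕ} {x : GrSymAlg M} (hx : C.IsWeighted i k x) :
    C.symH x = (i : K)⁻¹ • C.symH' x := by
  simp [symH, hx.weight_eq, Polynomial.lsum_apply, Polynomial.sum_monomial_index]

theorem mem_filt {i k : ℕ} {x : GrSymAlg M} (hx : C.IsWeighted i k x) :
    x ∈ GrSymAlg.filt M k := by
  induction hx with
  | base a => exact UEnv.ιA_mem_filt a
  | range r => exact UEnv.ιQ_mem_filt _
  | ker z hz => exact UEnv.ιQ_mem_filt _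
  | add _ _ hx hy => exact add_mem hx hy
  | smul c _ hx => exact Submodule.smul_mem _ _ hx
  | mul _ _ hx hy => exact_mod_cast UEnv.mul_mem_filt hx hy

/-- The maps j and p have degree 0 and commute with parity, so j(R) and ker p are stable under it.
The Leibniz rule needs this. -/
theorem par {i k : ℕ} {x : GrSymAlg M} (hx : C.IsWeighted i k x) :
    C.IsWeighted i k (UEnv.par M.trivialLR x) := by
  induction hx with
  | base a => rw [UEnv.par_ιA]; exact base _
  | range r =>
    have := parity_even N.internal M.internal C.isContraction.j_mem r
    rw [UEnv.par_ιQ]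
    simp only [DGModule.trivialLR_gr]
    rw [← this]
    exact range _
  | ker z hz =>
    have := parity_even M.internal N.internal C.isContraction.p_mem z
    rw [UEnv.par_ιQ]
    refine ker _ ?_
    simp only [DGModule.trivialLR_gr]
    rw [this, hz, map_zero]
  | add _ _ hx hy => rw [map_add]; exact hx.add hy
  | smul c _ hx => rw [map_smul]; exact hx.smul c
  | mul _ _ hx hy => rw [map_mul]; exact hx.mul hy

theorem zero {i k : ℕ} {x : GrSymAlg M} (hx : C.IsWeighted i k x) : C.IsWeighted i k 0 := by
  simpa using hx.smul (0 : K)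

/-- A derivation that preserves j(R) and ker p replaces one factor by another of the same kind, so
both counts survive. It serves for δ₀ and for h'. -/
theorem derivation {i k : ℕ} {x : GrSymAlg M} (hx : C.IsWeighted i k x)
    (D : OddDerivation M.trivialLR)
    (hj : ∀ r, C.IsWeighted 0 1 (UEnv.ιQ M.trivialLR (D.onQ (C.j r))))
    (hp : ∀ z, C.p z = 0 → C.p (D.onQ z) = 0) : C.IsWeighted i k (D.toUEnv x) := by
  induction hx with
  | base a => rw [D.toUEnv_ιA]; exact base _
  | range r => rw [D.toUEnv_ιQ]; exact hj r
  | ker z hz => rw [D.toUEnv_ιQ]; exact ker _ (hp z hz)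
  | add _ _ hx hy => rw [map_add]; exact hx.add hy
  | smul c _ hx => rw [map_smul]; exact hx.smul c
  | mul wx wy hx hy => rw [D.toUEnv_mul]; exact (hx.mul wy).add (wx.par.mul hy)

theorem d {i k : ℕ} {x : GrSymAlg M} (hx : C.IsWeighted i k x) :
    C.IsWeighted i k (GrSymAlg.d M x) :=
  hx.derivation M.trivialLR.differential
    (fun r => by
      have : M.trivialLR.differential.onQ (C.j r) = C.j (N.d r) := (C.isContraction.j_d r).symm
      rw [this]
      exact range _)
    (fun z hz => (C.isContraction.p_d z).trans (by rw [hz, map_zero]))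

theorem symH' {i k : ℕ} {x : GrSymAlg M} (hx : C.IsWeighted i k x) :
    C.IsWeighted i k (C.symH' x) :=
  hx.derivation C.homotopyDerivation
    (fun r => by
      -- The value is 0; written as `C.j 0` it is covered by `range`.
      have : C.homotopyDerivation.onQ (C.j r) = C.j 0 :=
        (C.isContraction.h_j r).trans (map_zero _).symm
      rw [this]
      exact range _)
    (fun z _ => C.isContraction.p_h z)

/-- The left side is a derivation in x that kills A and j(R) (as h j = 0) and fixes ker p (by the
homotopy identity), so it counts the factors from ker p. -/
theorem anticommutator {i k : ℕ} {x : GrSymAlg M} (hx : C.IsWeighted i k x) :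
    C.symH' (GrSymAlg.d M x) + GrSymAlg.d M (C.symH' x) = (i : K) • x := by
  induction hx with
  | base a => simp
  | range r => simp [← C.isContraction.j_d, C.isContraction.h_j]
  | ker z hz =>
    have := C.isContraction.homotopy z
    rw [hz, map_zero, sub_zero] at this
    simp only [symH'_ιQ, GrSymAlg.d_ιQ, ← map_add, this, Nat.cast_one, one_smul]
  | add _ _ hx hy => rw [smul_add, ← hx, ← hy]; simp only [map_add]; abel
  | smul c _ hx => rw [smul_comm, ← hx]; simp only [map_smul, smul_add]
  | mul _ _ hx hy =>
    refine (C.homotopyDerivation.anticommutator_mul M.trivialLR.differential _ _).trans ?_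
    have hx' : C.homotopyDerivation.toUEnv (M.trivialLR.differential.toUEnv _) +
      M.trivialLR.differential.toUEnv (C.homotopyDerivation.toUEnv _) = _ := hx
    have hy' : C.homotopyDerivation.toUEnv (M.trivialLR.differential.toUEnv _) +
      M.trivialLR.differential.toUEnv (C.homotopyDerivation.toUEnv _) = _ := hy
    rw [hx', hy', smul_mul_assoc, mul_smul_comm, ← add_smul, Nat.cast_add]

theorem symP_eq_zero {i k : ℕ} {x : GrSymAlg M} (hx : C.IsWeighted i k x) (hi : i ≠ 0) :
    C.symP x = 0 := by
  induction hx with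
  | base a => exact absurd rfl hi
  | range r => exact absurd rfl hi
  | ker z hz => simp [hz]
  | add _ _ hx hy => rw [map_add, hx hi, hy hi, add_zero]
  | smul c _ hx => rw [map_smul, hx hi, smul_zero]
  | @mul i k i' k' x y _ _ hx hy =>
    rw [map_mul]
    by_cases h : i = 0
    · rw [hy (by omega), mul_zero]
    · rw [hx h, zero_mul]

theorem symJ_symP {i k : ℕ} {x : GrSymAlg M} (hx : C.IsWeighted i k x) (hi : i = 0) :
    C.symJ (C.symP x) = x := by
  induction hx with
  | base a => simp
  | range r => simp [C.isContraction.p_j]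
  | ker z hz => exact absurd hi one_ne_zero
  | add _ _ hx hy => rw [map_add, map_add, hx hi, hy hi]
  | smul c _ hx => rw [map_smul, map_smul, hx hi]
  | mul _ _ hx hy => rw [map_mul, map_mul, hx (by omega), hy (by omega)]

end IsWeighted

variable (C)

theorem isWeighted_symJ (y : GrSymAlg N) :
    C.symJ y ∈ Submodule.span K {x | ∃ k, C.IsWeighted 0 k x} := by
  induction y using UEnv.generator_induction with
  | hA a => rw [symJ_ιA]; exact Submodule.subset_span ⟨0, .base a⟩
  | hQ r => rw [symJ_ιQ]; exact Submodule.subset_span ⟨1, .range r⟩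
  | hadd x y hx hy => rw [map_add]; exact add_mem hx hy
  | hmul x y hx hy =>
    rw [map_mul]
    have h := Submodule.mul_mem_mul hx hy
    rw [Submodule.span_mul_span] at h
    refine Submodule.span_mono ?_ h
    rintro _ ⟨x, ⟨k, hx⟩, y, ⟨m, hy⟩, rfl⟩
    exact ⟨k + m, hx.mul hy⟩

theorem prod_mem_span_isWeighted (l : List Q) : (l.map (UEnv.ιQ M.trivialLR)).prod ∈
    Submodule.span K {x | ∃ i, C.IsWeighted i l.length x} := by
  induction l with
  | nil =>
    refine Submodule.subset_span ⟨0, ?_⟩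
    have h1 := (UEnv.isEnveloping M.trivialLR).one
    simp only [List.map_nil, List.prod_nil, ← h1]
    exact .base 1
  | cons q l ih =>
    have hq : UEnv.ιQ M.trivialLR q ∈ Submodule.span K {x | ∃ i, C.IsWeighted i 1 x} := by
      -- The splitting of Q into j(R) and ker p.
      rw [← add_sub_cancel (C.j (C.p q)) q, map_add]
      exact add_mem (Submodule.subset_span ⟨0, .range _⟩)
        (Submodule.subset_span ⟨1, .ker _ (by rw [map_sub, C.isContraction.p_j, sub_self])⟩)
    rw [List.map_cons, List.prod_cons]
    have h := Submodule.mul_mem_mul hq ih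
    rw [Submodule.span_mul_span] at h
    refine Submodule.span_mono ?_ h
    rintro _ ⟨x, ⟨k, hx⟩, y, ⟨m, hy⟩, rfl⟩
    refine ⟨k + m, ?_⟩
    rw [List.length_cons, add_comm l.length]
    exact hx.mul hy

theorem mem_span_isWeighted {k : ℤ} {x : GrSymAlg M} (hx : x ∈ GrSymAlg.filt M k) :
    x ∈ Submodule.span K {x | ∃ i m : ℕ, (m : ℤ) ≤ k ∧ C.IsWeighted i m x} := by
  refine UEnv.filt_le_comap (f := LinearMap.id)
    (S := fun k => Submodule.span K {x | ∃ i m : ℕ, (m : ℤ) ≤ k ∧ C.IsWeighted i m x})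
    (fun k k' hk => Submodule.span_mono fun x hx => by
      obtain ⟨i, m, hm, hx⟩ := hx
      exact ⟨i, m, hm.trans hk, hx⟩)
    (fun a l => ?_) hx
  refine Submodule.span_induction (p := fun x _ => UEnv.ιA M.trivialLR a * x ∈
    Submodule.span K {x | ∃ i m : ℕ, (m : ℤ) ≤ l.length ∧ C.IsWeighted i m x}) ?_ ?_ ?_ ?_
    (C.prod_mem_span_isWeighted l)
  · rintro x ⟨i, hx⟩
    refine Submodule.subset_span ⟨0 + i, 0 + l.length, by simp, (IsWeighted.base a).mul hx⟩
  · simp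
  · intro x y _ _ hx hy
    rw [mul_add]
    exact add_mem hx hy
  · intro c x _ hx
    rw [mul_smul_comm]
    exact Submodule.smul_mem _ _ hx

/-- Linear identities on `S_A Q` may be checked on elements of a given weight. -/
theorem ext_isWeighted {V : Type*} [AddCommGroup V] [Module K V] {f g : GrSymAlg M →ₗ[K] V}
    (h : ∀ {i k : ℕ} {x : GrSymAlg M}, C.IsWeighted i k x → f x = g x) : f = g := by
  ext x
  obtain ⟨k, hk⟩ := UEnv.exists_mem_filt x
  refine LinearMap.eqOn_span (fun x hx => ?_) (C.mem_span_isWeighted hk)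
  obtain ⟨i, m, -, hx⟩ := hx
  exact h hx

theorem symH_mem_filt {k : ℤ} {x : GrSymAlg M} (hx : x ∈ GrSymAlg.filt M k) :
    C.symH x ∈ GrSymAlg.filt M k := by
  suffices h : Submodule.span K {x | ∃ i m : ℕ, (m : ℤ) ≤ k ∧ C.IsWeighted i m x} ≤
      (GrSymAlg.filt M k).comap C.symH from h (C.mem_span_isWeighted hx)
  refine Submodule.span_le.2 ?_
  rintro x ⟨i, m, hm, hx⟩
  rw [SetLike.mem_coe, Submodule.mem_comap, hx.symH_eq]
  exact Submodule.smul_mem _ _ (UEnv.filt_mono hm hx.symH'.mem_filt)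

theorem symH_symH (x : GrSymAlg M) : C.symH (C.symH x) = 0 := by
  refine congrArg (fun f => f x) (C.ext_isWeighted (f := C.symH ∘ₗ C.symH) (g := 0) fun hx => ?_)
  rw [LinearMap.comp_apply, hx.symH_eq, map_smul, hx.symH'.symH_eq, symH'_symH']
  simp

/-- The image of j has weight 0, where `symH` vanishes because 0⁻¹ = 0. -/
theorem symH_symJ (y : GrSymAlg N) : C.symH (C.symJ y) = 0 := by
  refine LinearMap.eqOn_span (f := C.symH) (g := 0) (fun x hx => ?_) (C.isWeighted_symJ y)
  obtain ⟨k, hx⟩ := hx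
  simp [hx.symH_eq]

theorem symP_symH (x : GrSymAlg M) : C.symP (C.symH x) = 0 := by
  refine congrArg (fun f => f x)
    (C.ext_isWeighted (f := C.symP.toLinearMap ∘ₗ C.symH) (g := 0) fun {i k x} hx => ?_)
  rw [LinearMap.comp_apply, hx.symH_eq, AlgHom.toLinearMap_apply, map_smul, LinearMap.zero_apply]
  by_cases h : i = 0
  · simp [h]
  · rw [hx.symH'.symP_eq_zero h, smul_zero]

/-- In weight i > 0 the anticommutator of h' and δ₀ is i, invertible in characteristic zero, and p
vanishes. In weight 0 both sides are zero. -/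
theorem sym_homotopy [CharZero K] (x : GrSymAlg M) :
    C.symH (GrSymAlg.d M x) + GrSymAlg.d M (C.symH x) = x - C.symJ (C.symP x) := by
  refine congrArg (fun f => f x) (C.ext_isWeighted
    (f := C.symH ∘ₗ GrSymAlg.d M + GrSymAlg.d M ∘ₗ C.symH)
    (g := LinearMap.id - C.symJ.toLinearMap ∘ₗ C.symP.toLinearMap) fun {i k x} hx => ?_)
  simp only [LinearMap.add_apply, LinearMap.sub_apply, LinearMap.comp_apply, LinearMap.id_apply,
    AlgHom.toLinearMap_apply]
  rw [hx.symH_eq, hx.d.symH_eq, map_smul, ← smul_add, hx.anticommutator, smul_smul]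
  by_cases h : i = 0
  · simp [h, hx.symJ_symP h]
  · rw [hx.symP_eq_zero h, map_zero, sub_zero, inv_mul_cancel₀ (Nat.cast_ne_zero.2 h), one_smul]

/-- The weight decomposition respects the degree since j p has degree 0. This is what gives `symH`
degree -1. -/
theorem weight_coeff_mem {n : ℤ} {x : GrSymAlg M} (hx : x ∈ GrSymAlg.gr M n) (i : ℕ) :
    (C.weight x).coeff i ∈ GrSymAlg.gr M n := by
  have hmul : ∀ {m n : ℤ} {f g : Polynomial (GrSymAlg M)},
      (∀ i, f.coeff i ∈ GrSymAlg.gr M m) → (∀ i, g.coeff i ∈ GrSymAlg.gr M n) →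
      ∀ i, (f * g).coeff i ∈ GrSymAlg.gr M (m + n) := fun hf hg i => by
    rw [Polynomial.coeff_mul]
    exact sum_mem fun c _ => UEnv.mul_mem (hf _) (hg _)
  have hA : ∀ {m : ℤ} {a : A}, a ∈ 𝔸.gr m → ∀ i,
      (C.weight (UEnv.ιA M.trivialLR a)).coeff i ∈ GrSymAlg.gr M m := fun {m a} ha i => by
    rw [(IsWeighted.base a).weight_eq, Polynomial.coeff_monomial]
    split_ifs
    · exact UEnv.ιA_mem ha
    · exact zero_mem _
  have hQ : ∀ {m : ℤ} {q : Q}, q ∈ M.gr m → ∀ i,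
      (C.weight (UEnv.ιQ M.trivialLR q)).coeff i ∈ GrSymAlg.gr M m := fun {m q} hq i => by
    have hjp := C.isContraction.j_mem (C.isContraction.p_mem hq)
    have hz : C.p (q - C.j (C.p q)) = 0 := by rw [map_sub, C.isContraction.p_j, sub_self]
    rw [← add_sub_cancel (C.j (C.p q)) q, map_add, map_add, Polynomial.coeff_add,
      (IsWeighted.range (C := C) (C.p q)).weight_eq, (IsWeighted.ker _ hz).weight_eq,
      Polynomial.coeff_monomial, Polynomial.coeff_monomial]
    refine add_mem ?_ ?_
    · split_ifs
      · exact UEnv.ιQ_mem hjp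
      · exact zero_mem _
    · split_ifs
      · exact UEnv.ιQ_mem (sub_mem hq hjp)
      · exact zero_mem _
  induction hx using Submodule.span_induction generalizing i with
  | mem x hx =>
    obtain ⟨k, a, l, ha, hl, rfl, rfl⟩ := hx
    rw [map_mul]
    refine hmul (hA ha) (fun i => ?_) i
    induction l generalizing i with
    | nil =>
      have h1 := (UEnv.isEnveloping M.trivialLR).one
      simp only [List.map_nil, List.prod_nil, List.sum_nil, ← h1]
      exact hA 𝔸.one_mem i
    | cons y l ih =>
      simp only [List.map_cons, List.prod_cons, List.sum_cons, map_mul]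
      exact hmul (hQ (hl y List.mem_cons_self))
        (ih fun z hz => hl z (List.mem_cons_of_mem _ hz)) i
  | zero => simp
  | add x y _ _ hx hy => rw [map_add, Polynomial.coeff_add]; exact add_mem (hx i) (hy i)
  | smul c x _ hx => rw [map_smul, Polynomial.coeff_smul]; exact Submodule.smul_mem _ _ (hx i)

theorem symH_mem {n : ℤ} {x : GrSymAlg M} (hx : x ∈ GrSymAlg.gr M n) :
    C.symH x ∈ GrSymAlg.gr M (n - 1) := by
  rw [symH, LinearMap.comp_apply, Polynomial.lsum_apply, Polynomial.sum_def]
  refine sum_mem fun i _ => Submodule.smul_mem _ _ ?_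
  exact C.homotopyDerivation.toUEnv_mem (C.weight_coeff_mem hx i)

theorem isContraction_sym [CharZero K] : IsContraction (GrSymAlg.gr M) (GrSymAlg.d M)
    (GrSymAlg.gr N) (GrSymAlg.d N) C.symP.toLinearMap C.symJ.toLinearMap C.symH where
  source := UEnv.isCochainComplex _
  target := UEnv.isCochainComplex _
  p_mem := GrSymAlg.map_mem C.p_smul C.isContraction.p_mem
  j_mem := GrSymAlg.map_mem C.j_smul C.isContraction.j_mem
  h_mem := C.symH_mem
  p_d := GrSymAlg.map_d C.p_smul C.isContraction.p_mem C.isContraction.p_d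
  j_d := GrSymAlg.map_d C.j_smul C.isContraction.j_mem C.isContraction.j_d
  p_j := C.symP_symJ
  homotopy := C.sym_homotopy
  h_h := C.symH_symH
  h_j := C.symH_symJ
  p_h := C.symP_symH

end LinearContraction

end Modules

/-! ### The homological perturbation lemma. -/

section Perturbation

variable {K V W : Type*} [Field K] [AddCommGroup V] [Module K V] [AddCommGroup W] [Module K W]

theorem perturbationSeries_eq_sum {t h : V →ₗ[K] V} (hn : IsLocallyNilpotent (t ∘ₗ h)) {x : V}
    {k : ℕ} (hk : ((t ∘ₗ h) ^ k) (t x) = 0) :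
    perturbationSeries t h hn x = ∑ i ∈ Finset.range k, ((t ∘ₗ h) ^ i) (t x) := by
  refine finsum_eq_sum_of_support_subset _ fun i hi => ?_
  rw [Finset.coe_range, Set.mem_Iio]
  by_contra hlt
  apply hi
  obtain ⟨m, rfl⟩ := Nat.exists_eq_add_of_le (not_lt.1 hlt)
  show ((t ∘ₗ h) ^ (k + m)) (t x) = 0
  rw [add_comm, pow_add, Module.End.mul_apply, hk, map_zero]

theorem perturbationSeries_eq_left {t h : V →ₗ[K] V} (hn : IsLocallyNilpotent (t ∘ₗ h)) (x : V) :
    perturbationSeries t h hn x = t x + t (h (perturbationSeries t h hn x)) := by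
  obtain ⟨k, hk⟩ := hn (t x)
  -- Truncation at k + 1 on the left matches truncation at k on the right, where t h shifts the
  -- series by one index.
  have hk' : ((t ∘ₗ h) ^ (k + 1)) (t x) = 0 := by
    rw [pow_succ', Module.End.mul_apply, hk, map_zero]
  conv_lhs => rw [perturbationSeries_eq_sum hn hk', Finset.sum_range_succ', add_comm]
  rw [perturbationSeries_eq_sum hn hk, map_sum, map_sum]
  simp [pow_succ']

theorem perturbationSeries_eq_right {t h : V →ₗ[K] V} (hn : IsLocallyNilpotent (t ∘ₗ h)) (x : V) :
    perturbationSeries t h hn x = t x + perturbationSeries t h hn (h (t x)) := by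
  obtain ⟨k, hk⟩ := hn (t x)
  have hk' : ((t ∘ₗ h) ^ (k + 1)) (t x) = 0 := by
    rw [pow_succ', Module.End.mul_apply, hk, map_zero]
  have hk'' : ((t ∘ₗ h) ^ k) (t (h (t x))) = 0 := by
    rw [pow_succ, Module.End.mul_apply] at hk'
    exact hk'
  rw [perturbationSeries_eq_sum hn hk', Finset.sum_range_succ', add_comm,
    perturbationSeries_eq_sum hn hk'']
  simp [pow_succ]

theorem perturbationSeries_mem {gr : ℤ → Submodule K V} {t h : V →ₗ[K] V}
    (hn : IsLocallyNilpotent (t ∘ₗ h))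
    (ht : ∀ {n : ℤ} {x : V}, x ∈ gr n → t x ∈ gr (n + 1))
    (hh : ∀ {n : ℤ} {x : V}, x ∈ gr n → h x ∈ gr (n - 1)) {n : ℤ} {x : V} (hx : x ∈ gr n) :
    perturbationSeries t h hn x ∈ gr (n + 1) := by
  obtain ⟨k, hk⟩ := hn (t x)
  rw [perturbationSeries_eq_sum hn hk]
  refine sum_mem fun i hi => ?_
  clear hi
  induction i with
  | zero => exact ht hx
  | succ i ih =>
    rw [pow_succ', Module.End.mul_apply]
    simpa using ht (hh ih)

variable {grV : ℤ → Submodule K V} {d : V →ₗ[K] V} {grW : ℤ → Submodule K W} {dW : W →ₗ[K] W}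
  {p : V →ₗ[K] W} {j : W →ₗ[K] V} {h : V →ₗ[K] V}

/-- Formally X = (1 - t h)⁻¹ t = t (1 - h t)⁻¹. Multiplied by 1 - t h on the left and 1 - h t on the
right, the claim becomes d t + t d = t (h d + d h) t + t j p t. By the homotopy identity the right
side is t², so this is (d - t)² = 0 combined with d² = 0. -/
theorem IsContraction.d_perturbationSeries (hc : IsContraction grV d grW dW p j h)
    {t : V →ₗ[K] V} (ht : ∀ x, (d - t) ((d - t) x) = 0) (hn : IsLocallyNilpotent (t ∘ₗ h))
    (x : V) : d (perturbationSeries t h hn x) + perturbationSeries t h hn (d x) =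
      perturbationSeries t h hn (j (p (perturbationSeries t h hn x))) := by
  obtain ⟨P, hP⟩ : ∃ P : Module.End K V, P = j ∘ₗ p := ⟨_, rfl⟩
  obtain ⟨X, hX⟩ : ∃ X : Module.End K V, X = perturbationSeries t h hn := ⟨_, rfl⟩
  let D : Module.End K V := d
  let T : Module.End K V := t
  let H : Module.End K V := h
  have e1 : X = T + T * H * X := by
    rw [hX]; exact LinearMap.ext (perturbationSeries_eq_left hn)
  have e2 : X = T + X * H * T := by
    rw [hX]; exact LinearMap.ext (perturbationSeries_eq_right hn)
  have e3 : H * D + D * H = 1 - P := by rw [hP]; exact LinearMap.ext hc.homotopy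
  have e4 : D * T + T * D = T * T := by
    have h1 : (D - T) * (D - T) = 0 := LinearMap.ext ht
    have h2 : D * D = 0 := LinearMap.ext hc.source.d_d
    have h3 : (D - T) * (D - T) = D * D - (D * T + T * D) + T * T := by noncomm_ring
    rw [h1, h2, zero_sub] at h3
    exact (eq_of_sub_eq_zero (by rw [h3]; abel)).symm
  have f1 : (1 - T * H) * X = T := by rw [sub_mul, one_mul]; exact sub_eq_of_eq_add e1
  have f2 : X * (1 - H * T) = T := by
    rw [mul_sub, mul_one, ← mul_assoc]; exact sub_eq_of_eq_add e2
  -- A left inverse of 1 - t h and, in `g2`, a right inverse of 1 - h t suffice to cancel the two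
  -- factors.
  have g1 : (1 + X * H) * (1 - T * H) = 1 := by
    have : (1 + X * H) * (1 - T * H) = 1 + (X * (1 - H * T) - T) * H := by noncomm_ring
    rw [this, f2, sub_self, zero_mul, add_zero]
  have g2 : (1 - H * T) * (1 + H * X) = 1 := by
    have : (1 - H * T) * (1 + H * X) = 1 + H * ((1 - T * H) * X - T) := by noncomm_ring
    rw [this, f1, sub_self, mul_zero, add_zero]
  have key : (1 - T * H) * (D * X + X * D - X * P * X) * (1 - H * T) = 0 := by
    calc _ = (1 - T * H) * D * (X * (1 - H * T)) + (1 - T * H) * X * D * (1 - H * T) -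
          (1 - T * H) * X * P * (X * (1 - H * T)) := by noncomm_ring
      _ = (D * T + T * D) - T * (H * D + D * H) * T - T * P * T := by
          rw [f1, f2]; noncomm_ring
      _ = 0 := by rw [e3, e4]; noncomm_ring
  have : D * X + X * D - X * P * X = 0 := by
    calc D * X + X * D - X * P * X = ((1 + X * H) * (1 - T * H)) * (D * X + X * D - X * P * X) *
          ((1 - H * T) * (1 + H * X)) := by rw [g1, g2, one_mul, mul_one]
      _ = (1 + X * H) * ((1 - T * H) * (D * X + X * D - X * P * X) * (1 - H * T)) *
          (1 + H * X) := by simp only [mul_assoc]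
      _ = 0 := by rw [key, mul_zero, zero_mul]
  have := congrArg (fun f => f x) this
  simp only [hX, hP] at this
  exact eq_of_sub_eq_zero this

/-- The homological perturbation lemma. -/
theorem IsContraction.perturb (hc : IsContraction grV d grW dW p j h) {t : V →ₗ[K] V}
    (ht : IsCochainComplex grV (d - t)) (hn : IsLocallyNilpotent (t ∘ₗ h)) :
    IsContraction grV (d - t) grW (dW - p ∘ₗ perturbationSeries t h hn ∘ₗ j)
      (p ∘ₗ (LinearMap.id + perturbationSeries t h hn ∘ₗ h))
      ((LinearMap.id + h ∘ₗ perturbationSeries t h hn) ∘ₗ j)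
      (h + h ∘ₗ perturbationSeries t h hn ∘ₗ h) := by
  have dX := hc.d_perturbationSeries ht.d_d hn
  have XL := perturbationSeries_eq_left hn
  have XR := perturbationSeries_eq_right hn
  have t_mem : ∀ {n : ℤ} {x : V}, x ∈ grV n → t x ∈ grV (n + 1) := fun {n x} hx => by
    have := sub_mem (hc.source.d_mem hx) (ht.d_mem hx)
    simpa using this
  have X_mem : ∀ {n : ℤ} {x : V}, x ∈ grV n → perturbationSeries t h hn x ∈ grV (n + 1) :=
    fun hx => perturbationSeries_mem hn t_mem hc.h_mem hx
  -- From here on X enters only through its degree, its two recursions and the identity `dX`; what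
  -- remains is linear algebra with the side conditions.
  generalize perturbationSeries t h hn = X at *
  have hp_d : ∀ x, (p ∘ₗ (LinearMap.id + X ∘ₗ h)) ((d - t) x) =
      (dW - p ∘ₗ X ∘ₗ j) ((p ∘ₗ (LinearMap.id + X ∘ₗ h)) x) := fun x => by
    have f1 := hc.p_d x
    have f2 := hc.p_d (X (h x))
    have f3 := congrArg p (XR x)
    have f4 := congrArg (fun y => p (X y)) (hc.homotopy x)
    have f5 := congrArg p (dX (h x))
    simp only [LinearMap.comp_apply, LinearMap.add_apply, LinearMap.sub_apply, LinearMap.id_apply,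
      map_add, map_sub] at f1 f2 f3 f4 f5 ⊢
    linear_combination (norm := abel) f1 + f2 + f3 + f4 - f5
  have hj_d : ∀ y, ((LinearMap.id + h ∘ₗ X) ∘ₗ j) ((dW - p ∘ₗ X ∘ₗ j) y) =
      (d - t) (((LinearMap.id + h ∘ₗ X) ∘ₗ j) y) := fun y => by
    have f1 := hc.j_d y
    have f2 := congrArg (fun y => h (X y)) (hc.j_d y)
    have f3 := XL (j y)
    have f4 := hc.homotopy (X (j y))
    have f5 := congrArg h (dX (j y))
    simp only [LinearMap.comp_apply, LinearMap.add_apply, LinearMap.sub_apply, LinearMap.id_apply,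
      map_add, map_sub] at f1 f2 f3 f4 f5 ⊢
    linear_combination (norm := abel) f1 + f2 - f3 - f4 + f5
  have hp_j : ∀ y, (p ∘ₗ (LinearMap.id + X ∘ₗ h)) (((LinearMap.id + h ∘ₗ X) ∘ₗ j) y) = y :=
    fun y => by
      simp [hc.h_j, hc.h_h, hc.p_h, hc.p_j]
  refine
    { source := ht
      target := ⟨hc.target.internal, fun {n y} hy => ?_, fun y => ?_⟩
      p_mem := fun {n x} hx => hc.p_mem (add_mem hx (by simpa using X_mem (hc.h_mem hx)))
      j_mem := fun {n y} hy => add_mem (hc.j_mem hy)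
        (by simpa using hc.h_mem (X_mem (hc.j_mem hy)))
      h_mem := fun {n x} hx => add_mem (hc.h_mem hx)
        (by simpa using hc.h_mem (X_mem (hc.h_mem hx)))
      p_d := hp_d
      j_d := hj_d
      p_j := hp_j
      homotopy := fun x => ?_
      h_h := fun x => by simp [hc.h_h]
      h_j := fun y => by simp [hc.h_h, hc.h_j]
      p_h := fun x => by simp [hc.h_h, hc.p_h] }
  · exact sub_mem (hc.target.d_mem hy) (hc.p_mem (X_mem (hc.j_mem hy)))
  -- The perturbed j is a cochain map with left inverse, so the new differential on W squares to
  -- zero because d - t does.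
  · rw [← hp_j ((dW - p ∘ₗ X ∘ₗ j) ((dW - p ∘ₗ X ∘ₗ j) y)), hj_d, hj_d, ht.d_d, map_zero]
  · have f1 := hc.homotopy x
    have f2 := congrArg h (XR x)
    have f3 := XL (h x)
    have f4 := congrArg (fun y => h (X y)) (hc.homotopy x)
    have f5 := hc.homotopy (X (h x))
    have f6 := congrArg h (dX (h x))
    simp only [LinearMap.comp_apply, LinearMap.add_apply, LinearMap.sub_apply, LinearMap.id_apply,
      map_add, map_sub] at f1 f2 f3 f4 f5 f6 ⊢
    linear_combination (norm := abel) f1 + f2 + f3 + f4 + f5 - f6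

/-- Contraction data may be transported along an isomorphism of complexes. -/
theorem IsContraction.transport {E : Type*} [AddCommGroup E] [Module K E]
    {grE : ℤ → Submodule K E} {dE : E →ₗ[K] E} (hc : IsContraction grV d grW dW p j h)
    (hE : IsCochainComplex grE dE) (e : V ≃ₗ[K] E) (he : ∀ n x, x ∈ grV n ↔ e x ∈ grE n)
    (hd : ∀ x, e (d x) = dE (e x)) :
    IsContraction grE dE grW dW (p ∘ₗ e.symm.toLinearMap) (e.toLinearMap ∘ₗ j)
      (e.toLinearMap ∘ₗ h ∘ₗ e.symm.toLinearMap) := by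
  have hs : ∀ {n : ℤ} {x : E}, x ∈ grE n → e.symm x ∈ grV n := fun {n x} hx =>
    (he n _).2 (by simpa using hx)
  have hd' : ∀ x, e.symm (dE x) = d (e.symm x) := fun x => by
    rw [LinearEquiv.symm_apply_eq, hd, e.apply_symm_apply]
  exact
    { source := hE
      target := hc.target
      p_mem := fun hx => hc.p_mem (hs hx)
      j_mem := fun hy => (he _ _).1 (hc.j_mem hy)
      h_mem := fun hx => (he _ _).1 (hc.h_mem (hs hx))
      p_d := fun x => by simp [hd', hc.p_d]
      j_d := fun y => by simp [hc.j_d, hd]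
      p_j := fun y => by simp [hc.p_j]
      homotopy := fun x => by
        have := congrArg e (hc.homotopy (e.symm x))
        simpa [hd', hd] using this
      h_h := fun x => by simp [hc.h_h]
      h_j := fun y => by simp [hc.h_j]
      p_h := fun x => by simp [hc.p_h] }

end Perturbation

section Modules

variable {K A : Type*} [Field K] [Ring A] [Algebra K A]
variable {𝔸 : CommDGAlgebra K A}
variable {Q R : Type*} [AddCommGroup Q] [Module K Q] [Module A Q] [IsScalarTower K A Q]
variable [AddCommGroup R] [Module K R] [Module A R] [IsScalarTower K A R]

/-! ### The PBW perturbation lowers the filtration. -/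

section PBW

variable {L : DGLieRinehart 𝔸 Q} {e : GrSymAlg L.toDGModule ≃ₗ[K] UEnv L}

theorem UEnv.d_ιA (a : A) : UEnv.d L (UEnv.ιA L a) = UEnv.ιA L (𝔸.d a) := by
  rw [UEnv.d, OddDerivation.toUEnv_ιA]; rfl

theorem UEnv.d_ιQ (q : Q) : UEnv.d L (UEnv.ιQ L q) = UEnv.ιQ L (L.d q) := by
  rw [UEnv.d, OddDerivation.toUEnv_ιQ]; rfl

theorem UEnv.d_mul (x y : UEnv L) :
    UEnv.d L (x * y) = UEnv.d L x * y + UEnv.par L x * UEnv.d L y :=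
  L.differential.toUEnv_mul x y

theorem GrSymAlg.d_mul {M : DGModule 𝔸 Q} (x y : GrSymAlg M) : GrSymAlg.d M (x * y) =
    GrSymAlg.d M x * y + UEnv.par M.trivialLR x * GrSymAlg.d M y :=
  UEnv.d_mul x y

/-- The PBW map intertwines the differentials modulo lower order terms, on products. -/
theorem IsPBW.d_prod (he : IsPBW L e) (l' l : List Q) :
    e ((l'.map (UEnv.ιQ L.toDGModule.trivialLR)).prod *
        GrSymAlg.d L.toDGModule (l.map (UEnv.ιQ L.toDGModule.trivialLR)).prod) -
      (l'.map (UEnv.ιQ L)).prod * UEnv.d L (l.map (UEnv.ιQ L)).prod ∈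
      UEnv.filt L ((l'.length : ℤ) + l.length - 1) := by
  induction l generalizing l' with
  | nil =>
    have h1 : UEnv.d L 1 = 0 := L.differential.toUEnv_one
    have h2 : GrSymAlg.d L.toDGModule 1 = 0 := L.toDGModule.trivialLR.differential.toUEnv_one
    simp [h1, h2]
  | cons q l ih =>
    simp only [List.map_cons, List.prod_cons]
    -- By Leibniz the differential either hits q, which `symbol` handles, or passes it. In the
    -- second case q, changed by parity, joins the prefix l'; this is why the induction is over all
    -- prefixes.
    have h1 := he.symbol (l' ++ L.d q :: l)
    have h2 := ih (l' ++ [parity L.internal q])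
    rw [UEnv.d_mul (L := L), GrSymAlg.d_mul, GrSymAlg.d_ιQ, UEnv.d_ιQ,
      UEnv.par_ιQ, UEnv.par_ιQ]
    simp only [List.map_append, List.prod_append, List.map_cons, List.prod_cons, List.map_nil,
      List.prod_nil, mul_one, List.length_append, List.length_cons, List.length_nil] at h1 h2 ⊢
    push_cast at h1 h2 ⊢
    have h3 : ((l'.length : ℤ) + (l.length + 1) - 1) = l'.length + 1 + l.length - 1 := by
      ring
    rw [← h3] at h2
    have := add_mem h1 h2
    convert this using 1
    simp only [mul_add, map_add, mul_assoc]
    simp only [DGModule.trivialLR_gr]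
    abel

/-- Let w be a product of elements of Q in S_A Q and w' the same product in U(Q). Then e (t w) = (e
(δ₀ w) - δ w') - δ (e w - w'). The first bracket is of lower order by `d_prod`; the second is by
`symbol`, and δ preserves the filtration. For a coefficient a the terms with the derivative of a
cancel, leaving multiplication by its parity image. -/
theorem IsPBW.pbwPerturbation_mem_filt (he : IsPBW L e) {k : ℤ} {x : GrSymAlg L.toDGModule}
    (hx : x ∈ GrSymAlg.filt L.toDGModule k) :
    pbwPerturbation L e x ∈ GrSymAlg.filt L.toDGModule (k - 1) := by
  refine UEnv.filt_le_comap (S := fun k => GrSymAlg.filt L.toDGModule (k - 1))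
    (fun k m h => UEnv.filt_mono (by omega)) (fun a l => ?_) hx
  rw [he.filtered]
  have h1 := he.d_prod [] l
  have h2 := he.symbol l
  simp only [List.map_nil, List.prod_nil, one_mul, List.length_nil, Nat.cast_zero, zero_add] at h1
  have h3 : UEnv.d L (e (l.map (UEnv.ιQ L.toDGModule.trivialLR)).prod -
      (l.map (UEnv.ιQ L)).prod) ∈ UEnv.filt L ((l.length : ℤ) - 1) :=
    L.differential.toUEnv_mem_filt h2
  have h4 := UEnv.ιA_mul_mem_filt (parity 𝔸.internal a) (sub_mem h1 h3)
  convert h4 using 1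
  rw [pbwPerturbation, LinearMap.sub_apply, map_sub, GrSymAlg.d_mul,
    GrSymAlg.d_ιA, UEnv.par_ιA, LinearMap.comp_apply, LinearMap.comp_apply,
    LinearEquiv.coe_coe, LinearEquiv.coe_coe, e.apply_symm_apply, he.linear, UEnv.d_mul,
    UEnv.d_ιA, UEnv.par_ιA, map_add, he.linear, he.linear, map_sub]
  simp only [mul_sub]
  abel

/-- The filtration is exhaustive and zero in negative indices, and t h₀ lowers it by one. -/
theorem IsPBW.isLocallyNilpotent {N : DGModule 𝔸 R} (he : IsPBW L e)
    (C : LinearContraction L.toDGModule N) :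
    IsLocallyNilpotent (pbwPerturbation L e ∘ₗ C.symH) := by
  intro x
  obtain ⟨k, hk⟩ := UEnv.exists_mem_filt x
  have key : ∀ m : ℕ, ((pbwPerturbation L e ∘ₗ C.symH) ^ m) x ∈
      GrSymAlg.filt L.toDGModule ((k : ℤ) - m) := by
    intro m
    induction m with
    | zero => simpa using hk
    | succ m ih =>
      rw [pow_succ', Module.End.mul_apply, LinearMap.comp_apply]
      have := he.pbwPerturbation_mem_filt (C.symH_mem_filt ih)
      rwa [sub_sub] at this
  refine ⟨k + 1, ?_⟩
  have := key (k + 1)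
  rw [GrSymAlg.filt, UEnv.filt_of_neg (by push_cast; omega), Submodule.mem_bot] at this
  exact this

/-- By the choice of t, the perturbed differential δ₀ - t is the conjugate of δ by e. So it squares
to zero, and e is an isomorphism from the perturbed complex to U(Q). -/
theorem IsPBW.isContraction_pert [CharZero K] {N : DGModule 𝔸 R} (he : IsPBW L e)
    (C : LinearContraction L.toDGModule N)
    (hn : IsLocallyNilpotent (pbwPerturbation L e ∘ₗ C.symH)) :
    IsContraction (UEnv.gr L) (UEnv.d L) (GrSymAlg.gr N) (C.pertD e hn)
      (C.pertP e hn) (C.pertJ e hn) (C.pertH e hn) := by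
  have hU := UEnv.isCochainComplex L
  have hd : ∀ x, (GrSymAlg.d L.toDGModule - pbwPerturbation L e) x = e.symm (UEnv.d L (e x)) :=
    fun x => by simp [pbwPerturbation]
  have hs : IsCochainComplex (GrSymAlg.gr L.toDGModule)
      (GrSymAlg.d L.toDGModule - pbwPerturbation L e) :=
    { internal := UEnv.gr_internal _
      d_mem := fun {n x} hx => by
        rw [hd, he.degree, e.apply_symm_apply]
        exact hU.d_mem ((he.degree n x).1 hx)
      d_d := fun x => by rw [hd, hd, e.apply_symm_apply, hU.d_d, map_zero] }
  exact (C.isContraction_sym.perturb hs hn).transport hU e he.degree fun x => by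
    rw [hd, e.apply_symm_apply]

end PBW

end Modules

/-! ### Sums over the ways to cut a word. -/

section Splittings

variable {α β E F : Type*} [AddCommMonoid E] [AddCommMonoid F]

/-- The sum of `f u v` over all factorizations `l = u ++ v`. -/
def splitSum (f : List α → List α → E) : List α → E
  | [] => f [] []
  | x :: l => f [] (x :: l) + splitSum (fun u v => f (x :: u) v) l

@[simp] theorem splitSum_nil (f : List α → List α → E) : splitSum f [] = f [] [] := rfl

@[simp] theorem splitSum_cons (f : List α → List α → E) (x : α) (l : List α) :
    splitSum f (x :: l) = f [] (x :: l) + splitSum (fun u v => f (x :: u) v) l := rfl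

theorem splitSum_congr {f g : List α → List α → E} {l : List α}
    (h : ∀ u v, u ++ v = l → f u v = g u v) : splitSum f l = splitSum g l := by
  induction l generalizing f g with
  | nil => exact h [] [] rfl
  | cons x l ih =>
    rw [splitSum_cons, splitSum_cons, h [] (x :: l) rfl,
      ih fun u v huv => h (x :: u) v (by rw [List.cons_append, huv])]

theorem splitSum_add (f g : List α → List α → E) (l : List α) :
    splitSum (fun u v => f u v + g u v) l = splitSum f l + splitSum g l := by
  induction l generalizing f g with
  | nil => rfl
  | cons x l ih => simp only [splitSum_cons, ih]; abel

theorem map_splitSum (φ : E →+ F) (f : List α → List α → E) (l : List α) :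
    φ (splitSum f l) = splitSum (fun u v => φ (f u v)) l := by
  induction l generalizing f with
  | nil => rfl
  | cons x l ih => simp only [splitSum_cons, map_add, ih]

theorem splitSum_zero (l : List α) : splitSum (fun _ _ => (0 : E)) l = 0 := by
  induction l with
  | nil => rfl
  | cons x l ih => simp only [splitSum_cons, ih, add_zero]

theorem splitSum_map (φ : β → α) (f : List α → List α → E) (l : List β) :
    splitSum f (l.map φ) = splitSum (fun u v => f (u.map φ) (v.map φ)) l := by
  induction l generalizing f with
  | nil => rfl
  | cons x l ih => simp only [splitSum_cons, List.map_cons, ih, List.map_nil]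

/-- Coassociativity of deconcatenation: both sides run over l = u ++ v ++ w. -/
theorem splitSum_assoc (f : List α → List α → List α → E) (l : List α) :
    splitSum (fun u r => splitSum (fun v w => f u v w) r) l =
      splitSum (fun s w => splitSum (fun u v => f u v w) s) l := by
  induction l generalizing f with
  | nil => rfl
  | cons x l ih =>
    simp only [splitSum_cons, splitSum_nil]
    rw [ih fun u v w => f (x :: u) v w, splitSum_add, add_assoc]

theorem splitSum_comm (f : List α → List α → List β → List β → E) (l : List α) (m : List β) :
    splitSum (fun u v => splitSum (fun a b => f u v a b) m) l =
      splitSum (fun a b => splitSum (fun u v => f u v a b) l) m := by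
  induction l generalizing f with
  | nil => rfl
  | cons x l ih => simp only [splitSum_cons, ih, splitSum_add]

/-- A cut falls either before or after the marked letter x. -/
theorem splitSum_append_cons (f : List α → List α → E) (u : List α) (x : α) (w : List α) :
    splitSum f (u ++ x :: w) = splitSum (fun a b => f a (b ++ x :: w)) u +
      splitSum (fun a b => f (u ++ x :: a) b) w := by
  induction u generalizing f with
  | nil => rfl
  | cons y u ih => simp only [splitSum_cons, List.cons_append, ih, add_assoc]

theorem splitSum_mem {K : Type*} [Semiring K] [Module K E] {S : Submodule K E}
    {f : List α → List α → E} {l : List α} (h : ∀ u v, u ++ v = l → f u v ∈ S) :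
    splitSum f l ∈ S := by
  induction l generalizing f with
  | nil => exact h [] [] rfl
  | cons x l ih =>
    exact add_mem (h [] (x :: l) rfl) (ih fun u v huv => h (x :: u) v (by rw [List.cons_append, huv]))

/-- The list of the first `k` terms of a sequence. -/
def initial (x : ℕ → α) (k : ℕ) : List α := List.ofFn fun r : Fin k => x r

@[simp] theorem length_initial (x : ℕ → α) (k : ℕ) : (initial x k).length = k :=
  List.length_ofFn

theorem initial_succ (x : ℕ → α) (k : ℕ) :
    initial x (k + 1) = x 0 :: initial (fun r => x (r + 1)) k := by
  simp [initial, List.ofFn_succ]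

theorem initial_congr {x y : ℕ → α} {k : ℕ} (h : ∀ r < k, x r = y r) :
    initial x k = initial y k := by
  rw [initial, initial]
  congr 1
  funext r
  exact h r r.2

theorem initial_add (x : ℕ → α) (k m : ℕ) :
    initial x (k + m) = initial x k ++ initial (fun r => x (k + r)) m := by
  induction k generalizing x with
  | zero => simp [initial]
  | succ k ih =>
    rw [add_right_comm, initial_succ, initial_succ, ih, List.cons_append]
    congr 2
    exact initial_congr fun r _ => congrArg x (by omega)

/-- The bridge from splittings of words to the indexed sums of `transferBeta` and of the Stasheff
identities. -/
theorem splitSum_initial (f : List α → List α → E) (x : ℕ → α) (k : ℕ) :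
    splitSum f (initial x k) = ∑ i ∈ Finset.range (k + 1),
      f (initial x i) (initial (fun r => x (i + r)) (k - i)) := by
  induction k generalizing f x with
  | zero => simp [initial]
  | succ k ih =>
    have h0 : f (initial x 0) (initial (fun r => x (0 + r)) (k + 1 - 0)) =
        f [] (x 0 :: initial (fun r => x (r + 1)) k) := by
      rw [← initial_succ]
      simp [initial]
    rw [initial_succ, splitSum_cons, ih, Finset.sum_range_succ' _ (k + 1), h0, add_comm (f [] _)]
    refine congrArg (· + _) (Finset.sum_congr rfl fun i _ => ?_)
    rw [initial_succ, Nat.add_sub_add_right]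
    congr 1
    exact initial_congr fun r _ => congrArg x (by omega)

theorem ofFn_update {k : ℕ} [DecidableEq (Fin k)] (m : Fin k → α) (i : Fin k) (z : α) :
    List.ofFn (Function.update m i z) =
      (List.ofFn m).take i ++ z :: (List.ofFn m).drop (i + 1) := by
  have h : List.ofFn (Function.update m i z) = (List.ofFn m).set i z := by
    refine List.ext_getElem (by simp) fun r h1 h2 => ?_
    simp [List.getElem_set, Function.update_apply, Fin.ext_iff, eq_comm]
  rw [h, List.set_eq_take_append_cons_drop, if_pos (by simp)]

end Splittings

/-! ### Convolution of functions on words, and coderivations. -/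

section Convolution

variable {W V E : Type*} [AddCommMonoid V] [Ring E]

/-- The convolution of functions on words with values in a ring. -/
def convolution (F G : List W → E) : List W → E := splitSum fun u v => F u * G v

theorem convolution_assoc (F G H : List W → E) :
    convolution (convolution F G) H = convolution F (convolution G H) := by
  funext l
  have h1 : ∀ u r : List W, F u * splitSum (fun v w => G v * H w) r =
      splitSum (fun v w => F u * (G v * H w)) r := fun u r =>
    map_splitSum (AddMonoidHom.mulLeft (F u)) _ r
  have h2 : ∀ s w : List W, splitSum (fun u v => F u * G v) s * H w =
      splitSum (fun u v => F u * G v * H w) s := fun s w =>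
    map_splitSum (AddMonoidHom.mulRight (H w)) _ s
  simp only [convolution, h1, h2, mul_assoc]
  exact (splitSum_assoc (fun u v w => F u * (G v * H w)) l).symm

/-- Composition with the coderivation of the tensor coalgebra given by `b`, where passing over a
letter `x` replaces it by `π x`. -/
def wordDerivation (π : W → W) (b : List W → W) (F : List W → V) : List W → V :=
  splitSum fun u r => splitSum (fun v w => F (u.map π ++ b v :: w)) r

/-- The coderivation property. After a factor v has been replaced by the letter b v, the word is
cut: if behind b v, then F receives it; if in front, then G does, and the letters of F have all been
passed over, hence changed by π. -/
theorem wordDerivation_convolution (π : W → W) (b : List W → W) (F G : List W → E) (l : List W) :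
    wordDerivation π b (convolution F G) l =
      convolution (wordDerivation π b F) G l +
        convolution (fun u => F (u.map π)) (wordDerivation π b G) l := by
  have h1 : ∀ u r : List W, F (u.map π) * wordDerivation π b G r =
      splitSum (fun c r => splitSum (fun v w => F (u.map π) * G (c.map π ++ b v :: w)) r) r :=
    fun u r => by
      rw [wordDerivation, ← AddMonoidHom.coe_mulLeft, map_splitSum]
      simp only [map_splitSum]
  have h2 : ∀ s c : List W, wordDerivation π b F s * G c =
      splitSum (fun u r => splitSum (fun v w => F (u.map π ++ b v :: w) * G c) r) s :=
    fun s c => by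
      rw [wordDerivation, ← AddMonoidHom.mulRight_apply, map_splitSum]
      simp only [map_splitSum, AddMonoidHom.mulRight_apply]
  have h3 : ∀ u r : List W, splitSum (fun v w => convolution F G (u.map π ++ b v :: w)) r =
      splitSum (fun a c => splitSum (fun v w => F (a.map π) * G (c.map π ++ b v :: w)) r) u +
      splitSum (fun s c => splitSum (fun v w => F (u.map π ++ b v :: w) * G c) s) r := by
    intro u r
    simp only [convolution, splitSum_append_cons, splitSum_add, splitSum_map]
    rw [splitSum_comm, splitSum_assoc fun v w c => F (u.map π ++ b v :: w) * G c]
  rw [wordDerivation]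
  simp only [h3, splitSum_add]
  rw [add_comm]
  simp only [convolution, h1, h2]
  congr 1
  · exact splitSum_assoc
      (fun u s c => splitSum (fun v w => F (u.map π ++ b v :: w) * G c) s) l
  · exact (splitSum_assoc
      (fun a c r => splitSum (fun v w => F (a.map π) * G (c.map π ++ b v :: w)) r) l).symm

theorem wordDerivation_add (π : W → W) (b : List W → W) (F G : List W → V) (l : List W) :
    wordDerivation π b (fun l => F l + G l) l =
      wordDerivation π b F l + wordDerivation π b G l := by
  simp only [wordDerivation, splitSum_add]

theorem map_wordDerivation {V' : Type*} [AddCommMonoid V'] (φ : V →+ V') (π : W → W)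
    (b : List W → W) (F : List W → V) (l : List W) :
    φ (wordDerivation π b F l) = wordDerivation π b (fun l => φ (F l)) l := by
  simp only [wordDerivation, map_splitSum]

/-- The function on words that is `f` on words of length one and zero otherwise. -/
def onLetters (f : W → V) : List W → V
  | [x] => f x
  | _ => 0

theorem splitSum_eq_nil_left {f : List W → List W → V} (h : ∀ u v, u ≠ [] → f u v = 0)
    (l : List W) : splitSum f l = f [] l := by
  cases l with
  | nil => rfl
  | cons x l =>
    rw [splitSum_cons, splitSum_congr (g := fun _ _ => 0) fun u v _ => h _ _ (by simp),
      splitSum_zero, add_zero]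

theorem splitSum_eq_nil_right {f : List W → List W → V} (h : ∀ u v, v ≠ [] → f u v = 0)
    (l : List W) : splitSum f l = f l [] := by
  induction l generalizing f with
  | nil => rfl
  | cons x l ih => rw [splitSum_cons, h _ _ (by simp), zero_add, ih fun u v hv => h _ _ hv]

theorem onLetters_append_cons (f : W → V) (u : List W) (x : W) (w : List W)
    (h : u ≠ [] ∨ w ≠ []) : onLetters f (u ++ x :: w) = 0 := by
  rcases u with _ | ⟨y, u⟩
  · rcases w with _ | ⟨z, w⟩
    · simp at h
    · rfl
  · rcases u with _ | ⟨y, u⟩ <;> rfl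

/-- Only the summand that replaces the whole of l by b l yields a word of length one. -/
theorem wordDerivation_onLetters (π : W → W) (b : List W → W) (f : W → V) (l : List W) :
    wordDerivation π b (onLetters f) l = f (b l) := by
  rw [wordDerivation, splitSum_eq_nil_left, splitSum_eq_nil_right]
  · rfl
  · exact fun u v hv => onLetters_append_cons _ _ _ _ (Or.inr hv)
  · intro u v hu
    rw [splitSum_congr (g := fun _ _ => 0) fun a c _ => onLetters_append_cons _ _ _ _
      (Or.inl (by simpa using hu)), splitSum_zero]

/-- A convolution of functions that vanish on the empty word involves only shorter words. -/
theorem convolution_congr {F F' G G' : List W → E} {l : List W}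
    (hF : F [] = 0) (hF' : F' [] = 0) (hG : G [] = 0) (hG' : G' [] = 0)
    (h1 : ∀ u : List W, u.length < l.length → F u = F' u)
    (h2 : ∀ u : List W, u.length < l.length → G u = G' u) :
    convolution F G l = convolution F' G' l := by
  refine splitSum_congr fun u v huv => ?_
  subst huv
  by_cases hu : u = []
  · rw [hu, hF, hF', zero_mul, zero_mul]
  by_cases hv : v = []
  · rw [hv, hG, hG', mul_zero, mul_zero]
  have hu' := List.length_pos_iff.2 hu
  have hv' := List.length_pos_iff.2 hv
  rw [h1 u (by simp; omega), h2 v (by simp; omega)]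

theorem convolution_eq_zero_of_left {F G : List W → E} {l : List W} (hG : G [] = 0)
    (hF : ∀ u : List W, u.length < l.length → F u = 0) : convolution F G l = 0 := by
  rw [convolution, splitSum_congr (g := fun _ _ => 0) fun u v huv => ?_, splitSum_zero]
  subst huv
  by_cases hv : v = []
  · rw [hv, hG, mul_zero]
  have hv' := List.length_pos_iff.2 hv
  rw [hF u (by simp; omega), zero_mul]

theorem convolution_eq_zero_of_right {F G : List W → E} {l : List W} (hF : F [] = 0)
    (hG : ∀ u : List W, u.length < l.length → G u = 0) : convolution F G l = 0 := by
  rw [convolution, splitSum_congr (g := fun _ _ => 0) fun u v huv => ?_, splitSum_zero]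
  subst huv
  by_cases hu : u = []
  · rw [hu, hF, zero_mul]
  have hu' := List.length_pos_iff.2 hu
  rw [hG v (by simp; omega), mul_zero]

end Convolution

/-! ### Functions on words that are linear in each letter. -/

section Multilinear

variable {K W V : Type*} [Field K] [AddCommGroup V] [Module K V] [AddCommGroup W] [Module K W]

/-- Functions on words that are linear in each letter. -/
structure IsMultilinear (K : Type*) [Field K] [Module K V] [Module K W] (F : List W → V) :
    Prop where
  add : ∀ u w x y, F (u ++ (x + y) :: w) = F (u ++ x :: w) + F (u ++ y :: w)
  smul : ∀ u w (c : K) x, F (u ++ (c • x) :: w) = c • F (u ++ x :: w)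

namespace IsMultilinear

theorem comp {V' : Type*} [AddCommGroup V'] [Module K V'] {F : List W → V}
    (hF : IsMultilinear K F) (φ : V →ₗ[K] V') : IsMultilinear K fun l => φ (F l) :=
  ⟨fun u w x y => by rw [hF.add, map_add], fun u w c x => by rw [hF.smul, map_smul]⟩

theorem add' {F G : List W → V} (hF : IsMultilinear K F) (hG : IsMultilinear K G) :
    IsMultilinear K fun l => F l + G l :=
  ⟨fun u w x y => by rw [hF.add, hG.add]; abel, fun u w c x => by rw [hF.smul, hG.smul, smul_add]⟩

theorem onLetters (f : W →ₗ[K] V) : IsMultilinear K (onLetters f) := by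
  constructor
  · intro u w x y
    by_cases h : u ≠ [] ∨ w ≠ []
    · simp only [onLetters_append_cons _ _ _ _ h, add_zero]
    · push Not at h
      obtain ⟨rfl, rfl⟩ := h
      exact map_add f x y
  · intro u w c x
    by_cases h : u ≠ [] ∨ w ≠ []
    · simp only [onLetters_append_cons _ _ _ _ h, smul_zero]
    · push Not at h
      obtain ⟨rfl, rfl⟩ := h
      exact map_smul f c x

theorem convolution {E : Type*} [Ring E] [Algebra K E] {F G : List W → E}
    (hF : IsMultilinear K F) (hG : IsMultilinear K G) : IsMultilinear K (convolution F G) := by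
  constructor
  · intro u w x y
    simp only [_root_.convolution, splitSum_append_cons, hF.add, hG.add, mul_add, add_mul,
      splitSum_add]
    abel
  · intro u w c x
    have h : ∀ (f : List W → List W → E) l,
        splitSum (fun a b => c • f a b) l = c • splitSum f l := fun f l =>
      (map_splitSum (DistribSMul.toAddMonoidHom E c) f l).symm
    simp only [_root_.convolution, splitSum_append_cons, hF.smul, hG.smul, mul_smul_comm,
      smul_mul_assoc, h, smul_add]

theorem zero {F : List W → V} (hF : IsMultilinear K F) (u w : List W) : F (u ++ 0 :: w) = 0 := by
  have := hF.smul u w 0 0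
  rwa [zero_smul, zero_smul] at this

theorem map_smul_list {F : List W → V} (hF : IsMultilinear K F) (u w : List W)
    (l : List (K × W)) : F (u ++ (l.map fun y => y.1 • y.2) ++ w) =
      (l.map Prod.fst).prod • F (u ++ l.map Prod.snd ++ w) := by
  induction l generalizing u with
  | nil => simp
  | cons y l ih =>
    have h1 := hF.smul u ((l.map fun y => y.1 • y.2) ++ w) y.1 y.2
    have h2 := ih (u ++ [y.2])
    simp only [List.append_assoc, List.map_cons, List.cons_append, List.nil_append,
      List.prod_cons] at h1 h2 ⊢
    rw [h1, h2, smul_smul]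

theorem map_smul_initial {F : List W → V} (hF : IsMultilinear K F) (w : List W) (c : ℕ → K)
    (x : ℕ → W) (k : ℕ) : F (initial (fun r => c r • x r) k ++ w) =
      (∏ r ∈ Finset.range k, c r) • F (initial x k ++ w) := by
  have := hF.map_smul_list [] w (initial (fun r => (c r, x r)) k)
  simpa [initial, List.map_ofFn, Function.comp_def, List.prod_ofFn, Finset.prod_range] using this

/-- The multilinear maps given by a function on words that is linear in each letter. -/
def toMultilinearMap {F : List W → V} (hF : IsMultilinear K F) (k : ℕ) :
    MultilinearMap K (fun _ : Fin k => W) V where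
  toFun x := F (List.ofFn x)
  map_update_add' m i x y := by rw [ofFn_update, ofFn_update, ofFn_update, hF.add]
  map_update_smul' m i c x := by rw [ofFn_update, ofFn_update, hF.smul]

end IsMultilinear

theorem prod_neg_one_zpow {ι : Type*} (s : Finset ι) (f : ι → ℤ) :
    ∏ i ∈ s, (-1 : K) ^ f i = (-1 : K) ^ ∑ i ∈ s, f i := by
  classical
  induction s using Finset.induction_on with
  | empty => simp
  | insert a s ha ih =>
    rw [Finset.prod_insert ha, Finset.sum_insert ha, ih, zpow_add₀ (neg_ne_zero.2 one_ne_zero)]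

theorem neg_one_zpow_congr {a b : ℤ} (h : ∃ c, a = b + 2 * c) : (-1 : K) ^ a = (-1 : K) ^ b := by
  obtain ⟨c, rfl⟩ := h
  rw [zpow_add₀ (neg_ne_zero.2 one_ne_zero), zpow_mul]
  norm_num

end Multilinear

/-! ### Homotopy transfer on words, with signs carried by parity. -/

section Transfer

variable {K W E : Type*} [Field K] [AddCommGroup W] [Module K W] [Ring E] [Algebra K E]

/-- The approximations, correct on words of length at most `n`, to `transferWords`. -/
def transferApprox (par : E →ₗ[K] E) (j : W →ₗ[K] E) (h : E →ₗ[K] E) : ℕ → List W → E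
  | 0 => fun _ => 0
  | n + 1 => fun l => onLetters (-j) l +
      h (convolution (fun u => par (transferApprox par j h n u)) (transferApprox par j h n) l)

/-- The sum over binary trees of homotopy transfer, with all signs absorbed in the parity
automorphism `par`: `G = -j + h (par G * G)`. -/
def transferWords (par : E →ₗ[K] E) (j : W →ₗ[K] E) (h : E →ₗ[K] E) (l : List W) : E :=
  transferApprox par j h l.length l

variable {par : E →ₗ[K] E} {j : W →ₗ[K] E} {h : E →ₗ[K] E}

theorem transferApprox_nil (n : ℕ) : transferApprox par j h n [] = 0 := by
  induction n with
  | zero => rfl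
  | succ n ih => simp [transferApprox, convolution, onLetters, ih]

/-- The approximations vanish on the empty word, so the convolution at l involves strictly shorter
words only, and depth l.length is enough. -/
theorem transferApprox_eq {n m : ℕ} {l : List W} (hn : l.length ≤ n) (hm : l.length ≤ m) :
    transferApprox par j h n l = transferApprox par j h m l := by
  induction n generalizing m l with
  | zero =>
    rw [List.eq_nil_of_length_eq_zero (Nat.le_zero.1 hn), transferApprox_nil, transferApprox_nil]
  | succ n ih =>
    cases m with
    | zero =>
      rw [List.eq_nil_of_length_eq_zero (Nat.le_zero.1 hm), transferApprox_nil, transferApprox_nil]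
    | succ m =>
      simp only [transferApprox]
      rw [convolution_congr (F' := fun u => par (transferApprox par j h m u))
        (by rw [transferApprox_nil, map_zero]) (by rw [transferApprox_nil, map_zero]) (transferApprox_nil n) (transferApprox_nil m)
        (fun u hu => by rw [ih (m := m) (by omega) (by omega)])
        (fun u hu => ih (m := m) (by omega) (by omega))]

theorem transferWords_nil : transferWords par j h [] = 0 := rfl

variable (par j h) in
/-- The product `β = par G * G`. -/
def transferProduct : List W → E :=
  convolution (fun u => par (transferWords par j h u)) (transferWords par j h)

theorem transferWords_eq (l : List W) :
    transferWords par j h l = onLetters (-j) l + h (transferProduct par j h l) := by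
  rw [transferWords, transferApprox_eq le_rfl (Nat.le_succ _), transferProduct]
  simp only [transferApprox]
  rw [convolution_congr (F' := fun u => par (transferWords par j h u)) (by rw [transferApprox_nil, map_zero])
    (by rw [transferWords_nil, map_zero]) (transferApprox_nil _) transferWords_nil
    (fun u hu => congrArg par (transferApprox_eq hu.le le_rfl))
    (fun u hu => transferApprox_eq hu.le le_rfl)]

theorem transferProduct_nil : transferProduct par j h [] = 0 := by
  simp [transferProduct, convolution, transferWords_nil]

theorem transferProduct_singleton (x : W) : transferProduct par j h [x] = 0 := by
  simp [transferProduct, convolution, transferWords_nil]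

theorem isMultilinear_transferWords : IsMultilinear K (transferWords par j h) := by
  have key : ∀ n, IsMultilinear K (transferApprox par j h n) := by
    intro n
    induction n with
    | zero => exact ⟨fun _ _ _ _ => (add_zero 0).symm, fun _ _ _ _ => (smul_zero _).symm⟩
    | succ n ih =>
      exact (IsMultilinear.onLetters (-j)).add' (((ih.comp par).convolution ih).comp h)
  constructor
  · intro u w x y
    -- The three words have the same length, so one approximation computes all of them.
    have := (key (u.length + (w.length + 1))).add u w x y
    simpa [transferWords] using this
  · intro u w c x
    have := (key (u.length + (w.length + 1))).smul u w c x
    simpa [transferWords] using this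

theorem isMultilinear_transferProduct : IsMultilinear K (transferProduct par j h) :=
  (isMultilinear_transferWords.comp par).convolution isMultilinear_transferWords

/-- For π = -parity this records the parity of the degree ∑ n_r + 1 - k of G on words of length k,
without reference to homogeneous letters. -/
theorem transferWords_map {π : W → W} (hpar : ∀ x, par (par x) = x)
    (hmul : ∀ x y, par (x * y) = par x * par y) (hj : ∀ y, j (π y) = - par (j y))
    (hh : ∀ x, h (par x) = - par (h x)) (l : List W) :
    transferWords par j h (l.map π) = - par (transferWords par j h l) := by
  have key : ∀ n l, transferApprox par j h n (l.map π) = - par (transferApprox par j h n l) := by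
    intro n
    induction n with
    | zero => intro l; simp [transferApprox]
    | succ n ih =>
      intro l
      have h1 : onLetters (-j) (l.map π) = - par (onLetters (-j) l) := by
        rcases l with _ | ⟨x, _ | ⟨y, l⟩⟩
        · simp [onLetters]
        · simp [onLetters, hj]
        · simp [onLetters]
      have h2 : convolution (fun u => par (transferApprox par j h n u)) (transferApprox par j h n)
          (l.map π) = par (convolution (fun u => par (transferApprox par j h n u))
            (transferApprox par j h n) l) := by
        have h3 := map_splitSum par.toAddMonoidHom
          (fun u v => par (transferApprox par j h n u) * transferApprox par j h n v) l
        simp only [LinearMap.toAddMonoidHom_coe] at h3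
        simp only [convolution, splitSum_map, h3, ih, hmul, hpar, map_neg, neg_mul_neg]
      simp only [transferApprox]
      rw [h1, h2, hh, map_add, neg_add]
  rw [transferWords, transferWords, List.length_map]
  exact key _ _

variable {p : E →ₗ[K] W} {D : E →ₗ[K] E} {dW : W →ₗ[K] W}

variable (par p j h dW) in
/-- The operations transferred to `W`, as a function on words: `b = dW + p β`. -/
def transferOperation (l : List W) : W := onLetters dW l + p (transferProduct par j h l)

theorem isMultilinear_transferOperation : IsMultilinear K (transferOperation par j h p dW) :=
  (IsMultilinear.onLetters dW).add' (isMultilinear_transferProduct.comp p)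

/-- The defect of the equation `D G = β + G ∘ b`. -/
theorem D_transferProduct {π : W → W} (b : List W → W) (hpar : ∀ x, par (par x) = x)
    (hmul : ∀ x y, par (x * y) = par x * par y) (hD : ∀ x y, D (x * y) = D x * y + par x * D y)
    (hDp : ∀ x, D (par x) = - par (D x))
    (hG : ∀ l : List W, transferWords par j h (l.map π) = - par (transferWords par j h l))
    (Δ : List W → E) (hΔ : ∀ l, D (transferWords par j h l) = transferProduct par j h l +
      wordDerivation π b (transferWords par j h) l + Δ l) (l : List W) :
    D (transferProduct par j h l) + wordDerivation π b (transferProduct par j h) l =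
      convolution (transferWords par j h) Δ l -
        convolution (fun u => par (Δ u)) (transferWords par j h) l := by
  set G := transferWords par j h with hGdef
  set B := transferProduct par j h with hBdef
  have hB : B = convolution (fun u => par (G u)) G := rfl
  have hsub : ∀ (F F' H : List W → E) (l : List W),
      convolution (fun u => F u - F' u) H l = convolution F H l - convolution F' H l := by
    intro F F' H l
    rw [eq_sub_iff_add_eq, convolution, convolution, convolution, ← splitSum_add]
    simp only [sub_mul, sub_add_cancel]
  have hadd : ∀ (F H H' : List W → E) (l : List W),
      convolution F (fun u => H u + H' u) l = convolution F H l + convolution F H' l := by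
    intro F H H' l
    simp only [convolution, mul_add, splitSum_add]
  have hadd' : ∀ (F F' H : List W → E) (l : List W),
      convolution (fun u => F u + F' u) H l = convolution F H l + convolution F' H l := by
    intro F F' H l
    simp only [convolution, add_mul, splitSum_add]
  have hneg : ∀ (F H : List W → E) (l : List W),
      convolution (fun u => - F u) H l = - convolution F H l := by
    intro F H l
    have := hsub (fun _ => 0) F H l
    simpa [convolution, splitSum_zero] using this
  have hparB : (fun l => par (B l)) = convolution G (fun u => par (G u)) := by
    funext l
    rw [hB, convolution, ← LinearMap.toAddMonoidHom_coe par, map_splitSum]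
    simp only [LinearMap.toAddMonoidHom_coe, hmul, hpar, convolution]
  have h1 : D (B l) = convolution G (fun u => D (G u)) l -
      convolution (fun u => par (D (G u))) G l := by
    rw [eq_sub_iff_add_eq, hB, convolution, ← LinearMap.toAddMonoidHom_coe D, map_splitSum,
      convolution, convolution, ← splitSum_add]
    refine splitSum_congr fun u v _ => ?_
    rw [LinearMap.toAddMonoidHom_coe, hD, hDp, hpar]
    noncomm_ring
  have h2 : wordDerivation π b B l = convolution (fun u => par (wordDerivation π b G u)) G l -
      convolution G (wordDerivation π b G) l := by
    rw [hB, wordDerivation_convolution, sub_eq_add_neg, ← hneg]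
    congr 1
    · refine congrArg (fun F => convolution F G l) (funext fun u => ?_)
      exact (map_wordDerivation par.toAddMonoidHom π b G u).symm
    · refine congrArg (fun F => convolution F (wordDerivation π b G) l) (funext fun u => ?_)
      rw [hG, map_neg, hpar]
  rw [h1, h2]
  simp only [hΔ, map_add, hadd, hadd']
  -- Here associativity of the product enters: par β * G = (G * par G) * G = G * β, so the two cubic
  -- terms cancel.
  have h3 : convolution (fun u => par (B u)) G l = convolution G B l := by
    rw [hparB, convolution_assoc, ← hB]
  rw [h3]
  abel

variable {grE : ℤ → Submodule K E} {grW : ℤ → Submodule K W}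

/-- Induction on the length. If the defect Δ vanishes on shorter words, `D_transferProduct` gives D
β + β ∘ b̂ = 0 at l. The homotopy identity then yields D h β = β - j p β + h (β ∘ b̂), and
substituting G = -j + h β and b = d_W + p β gives Δ l = 0. -/
theorem D_transferWords (hc : IsContraction grE D grW dW p j h) {π : W → W}
    (hpar : ∀ x, par (par x) = x)
    (hmul : ∀ x y, par (x * y) = par x * par y) (hD : ∀ x y, D (x * y) = D x * y + par x * D y)
    (hDp : ∀ x, D (par x) = - par (D x))
    (hG : ∀ l : List W, transferWords par j h (l.map π) = - par (transferWords par j h l))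
    (l : List W) :
    D (transferWords par j h l) = transferProduct par j h l +
      wordDerivation π (transferOperation par j h p dW) (transferWords par j h) l := by
  set b := transferOperation par j h p dW with hb
  obtain ⟨Δ, hΔ⟩ : ∃ Δ : List W → E, ∀ l, D (transferWords par j h l) =
      transferProduct par j h l + wordDerivation π b (transferWords par j h) l + Δ l :=
    ⟨fun l => D (transferWords par j h l) - (transferProduct par j h l +
      wordDerivation π b (transferWords par j h) l), fun l => (add_sub_cancel _ _).symm⟩
  suffices h0 : ∀ n, ∀ l : List W, l.length = n → Δ l = 0 by rw [hΔ, h0 _ l rfl, add_zero]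
  intro n
  induction n using Nat.strong_induction_on with
  | _ n ih =>
    rintro l rfl
    have hlt : ∀ u : List W, u.length < l.length → Δ u = 0 := fun u hu => ih _ hu u rfl
    have hBl : D (transferProduct par j h l) +
        wordDerivation π b (transferProduct par j h) l = 0 := by
      rw [D_transferProduct b hpar hmul hD hDp hG Δ hΔ]
      rw [convolution_eq_zero_of_right transferWords_nil hlt,
        convolution_eq_zero_of_left transferWords_nil fun u hu => by rw [hlt u hu, map_zero],
        sub_zero]
    have h1 : wordDerivation π b (transferWords par j h) l =
        - j (b l) + h (wordDerivation π b (transferProduct par j h) l) := by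
      rw [funext (transferWords_eq (par := par) (j := j) (h := h)), wordDerivation_add,
        wordDerivation_onLetters]
      exact congrArg _ (map_wordDerivation h.toAddMonoidHom π b (transferProduct par j h) l).symm
    have h2 : D (onLetters (-j) l) + j (onLetters dW l) = 0 := by
      rcases l with _ | ⟨x, _ | ⟨y, l⟩⟩
      · simp [onLetters]
      · simp [onLetters, hc.j_d]
      · simp [onLetters]
    have h3 := hc.homotopy (transferProduct par j h l)
    have h4 := congrArg h hBl
    have h5 := hΔ l
    have h6 : j (b l) = j (onLetters dW l) + j (p (transferProduct par j h l)) := map_add j _ _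
    rw [h1, h6, transferWords_eq, map_add] at h5
    rw [map_add, map_zero] at h4
    linear_combination (norm := abel) -h5 + h2 + h3 - h4

/-- The transferred operations square to zero, as a coderivation. -/
theorem transferOperation_square (hc : IsContraction grE D grW dW p j h) {π : W → W}
    (hpar : ∀ x, par (par x) = x)
    (hmul : ∀ x y, par (x * y) = par x * par y) (hD : ∀ x y, D (x * y) = D x * y + par x * D y)
    (hDp : ∀ x, D (par x) = - par (D x))
    (hG : ∀ l : List W, transferWords par j h (l.map π) = - par (transferWords par j h l))
    (l : List W) :
    wordDerivation π (transferOperation par j h p dW) (transferOperation par j h p dW) l = 0 := by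
  -- With zero defect, D β = -β ∘ b̂. Applying p turns d_W (p β) + p (β ∘ b̂) into zero, and the
  -- remaining term is d_W² = 0.
  have h1 := D_transferProduct (transferOperation par j h p dW) hpar hmul hD hDp hG (fun _ => 0)
    (fun l => by rw [D_transferWords hc hpar hmul hD hDp hG, add_zero]) l
  rw [convolution_eq_zero_of_right transferWords_nil fun _ _ => rfl,
    convolution_eq_zero_of_left transferWords_nil fun _ _ => map_zero par, sub_zero] at h1
  have h2 : wordDerivation π (transferOperation par j h p dW) (transferOperation par j h p dW) l =
      dW (transferOperation par j h p dW l) +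
        p (wordDerivation π (transferOperation par j h p dW) (transferProduct par j h) l) := by
    conv_lhs => arg 3; ext l; rw [transferOperation]
    rw [wordDerivation_add, wordDerivation_onLetters]
    exact congrArg _ (map_wordDerivation p.toAddMonoidHom π _ (transferProduct par j h) l).symm
  have h3 : dW (onLetters dW l) = 0 := by
    rcases l with _ | ⟨x, _ | ⟨y, l⟩⟩
    · simp [onLetters]
    · simp [onLetters, hc.target.d_d]
    · simp [onLetters]
  have h4 := congrArg p h1
  rw [map_add, hc.p_d, map_zero] at h4
  have h5 : dW (transferOperation par j h p dW l) =
    dW (onLetters dW l) + dW (p (transferProduct par j h l)) := map_add dW _ _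
  rw [h2, h5, h3, zero_add, h4]

end Transfer

/-! ### Suspension signs. -/

section WordSign

/-- The exponent `∑ (k - 1 - r) n_r` of the sign relating the operations on `W` to those on its
suspension, on elements of degrees `n_0, …, n_{k-1}`. -/
def wordSign (k : ℕ) (n : ℕ → ℤ) : ℤ := ∑ r ∈ Finset.range k, ((k : ℤ) - 1 - r) * n r

theorem wordSign_one (n : ℕ → ℤ) : wordSign 1 n = 0 := by simp [wordSign]

theorem wordSign_congr {k : ℕ} {n m : ℕ → ℤ} (h : ∀ r < k, n r = m r) :
    wordSign k n = wordSign k m :=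
  Finset.sum_congr rfl fun r hr => by rw [h r (Finset.mem_range.1 hr)]

/-- Appending b letters raises the coefficient of each of the first a degrees by b. The sign
comparisons below rest on this. -/
theorem wordSign_add (a b : ℕ) (n : ℕ → ℤ) : wordSign (a + b) n =
    wordSign a n + wordSign b (fun r => n (a + r)) + b * ∑ r ∈ Finset.range a, n r := by
  rw [wordSign, Finset.sum_range_add, wordSign, wordSign, Finset.mul_sum, add_right_comm,
    ← Finset.sum_add_distrib]
  refine congrArg₂ (· + ·) (Finset.sum_congr rfl fun r _ => ?_)
    (Finset.sum_congr rfl fun r _ => ?_) <;> push_cast <;> ring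

end WordSign

/-! ### Degrees, signs and the Stasheff identities. -/

section Transfer

variable {K W E : Type*} [Field K] [AddCommGroup W] [Module K W] [Ring E] [Algebra K E]
variable {par : E →ₗ[K] E} {j : W →ₗ[K] E} {h : E →ₗ[K] E}
variable {p : E →ₗ[K] W} {D : E →ₗ[K] E} {dW : W →ₗ[K] W}
variable {grE : ℤ → Submodule K E} {grW : ℤ → Submodule K W}

/-- Words are lists of pairs carrying the degree of each letter. A function of shift s changes the
degree by s minus the length, and shifts add under convolution: 1 for G, 2 for β. -/
theorem convolution_mem {F G : List W → E} {s t : ℤ}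
    (hmul : ∀ {m n : ℤ} {x y : E}, x ∈ grE m → y ∈ grE n → x * y ∈ grE (m + n))
    (hF : ∀ l : List (ℤ × W), (∀ y ∈ l, y.2 ∈ grW y.1) →
      F (l.map Prod.snd) ∈ grE ((l.map Prod.fst).sum + s - l.length))
    (hG : ∀ l : List (ℤ × W), (∀ y ∈ l, y.2 ∈ grW y.1) →
      G (l.map Prod.snd) ∈ grE ((l.map Prod.fst).sum + t - l.length))
    (l : List (ℤ × W)) (hl : ∀ y ∈ l, y.2 ∈ grW y.1) :
    convolution F G (l.map Prod.snd) ∈ grE ((l.map Prod.fst).sum + (s + t) - l.length) := by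
  rw [convolution, splitSum_map]
  refine splitSum_mem fun u v huv => ?_
  subst huv
  convert hmul (hF u fun y hy => hl y (List.mem_append_left _ hy))
    (hG v fun y hy => hl y (List.mem_append_right _ hy)) using 2
  simp only [List.map_append, List.sum_append, List.length_append]
  push_cast
  ring

theorem onLetters_mem {V : Type*} [AddCommGroup V] [Module K V] {gr : ℤ → Submodule K V}
    {f : W →ₗ[K] V} {s : ℤ} (hf : ∀ {n : ℤ} {x : W}, x ∈ grW n → f x ∈ gr (n + s))
    (l : List (ℤ × W)) (hl : ∀ y ∈ l, y.2 ∈ grW y.1) :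
    onLetters f (l.map Prod.snd) ∈ gr ((l.map Prod.fst).sum + (s + 1) - l.length) := by
  rcases l with _ | ⟨x, _ | ⟨y, l⟩⟩
  · exact zero_mem _
  · convert hf (hl x List.mem_cons_self) using 2
    · simp
      ring
    · rfl
  · exact zero_mem _

theorem transferWords_mem (hc : IsContraction grE D grW dW p j h)
    (hmul : ∀ {m n : ℤ} {x y : E}, x ∈ grE m → y ∈ grE n → x * y ∈ grE (m + n))
    (hpar : ∀ {n : ℤ} {x : E}, x ∈ grE n → par x = (-1 : K) ^ n • x)
    (l : List (ℤ × W)) (hl : ∀ y ∈ l, y.2 ∈ grW y.1) :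
    transferWords par j h (l.map Prod.snd) ∈ grE ((l.map Prod.fst).sum + 1 - l.length) := by
  have key : ∀ n (l : List (ℤ × W)), (∀ y ∈ l, y.2 ∈ grW y.1) →
      transferApprox par j h n (l.map Prod.snd) ∈
        grE ((l.map Prod.fst).sum + 1 - l.length) := by
    intro n
    induction n with
    | zero => exact fun l _ => zero_mem _
    | succ n ih =>
      intro l hl
      refine add_mem ?_ ?_
      · simpa using onLetters_mem (gr := grE) (f := -j) (s := 0)
          (fun hx => by simpa using hc.j_mem hx) l hl
      · have h2 := hc.h_mem (convolution_mem (F := fun u => par (transferApprox par j h n u))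
          (s := 1) (t := 1) hmul (fun l hl => by
          rw [hpar (ih l hl)]
          exact Submodule.smul_mem _ _ (ih l hl)) ih l hl)
        convert h2 using 2
        ring
  exact key _ l hl

theorem transferProduct_mem (hc : IsContraction grE D grW dW p j h)
    (hmul : ∀ {m n : ℤ} {x y : E}, x ∈ grE m → y ∈ grE n → x * y ∈ grE (m + n))
    (hpar : ∀ {n : ℤ} {x : E}, x ∈ grE n → par x = (-1 : K) ^ n • x)
    (l : List (ℤ × W)) (hl : ∀ y ∈ l, y.2 ∈ grW y.1) :
    transferProduct par j h (l.map Prod.snd) ∈ grE ((l.map Prod.fst).sum + 2 - l.length) := by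
  have h1 : ∀ l : List (ℤ × W), (∀ y ∈ l, y.2 ∈ grW y.1) →
      transferWords par j h (l.map Prod.snd) ∈ grE ((l.map Prod.fst).sum + 1 - l.length) :=
    transferWords_mem hc hmul hpar
  exact convolution_mem (s := 1) (t := 1) hmul (fun l hl => by
    rw [hpar (h1 l hl)]
    exact Submodule.smul_mem _ _ (h1 l hl)) h1 l hl

theorem transferOperation_mem (hc : IsContraction grE D grW dW p j h)
    (hmul : ∀ {m n : ℤ} {x y : E}, x ∈ grE m → y ∈ grE n → x * y ∈ grE (m + n))
    (hpar : ∀ {n : ℤ} {x : E}, x ∈ grE n → par x = (-1 : K) ^ n • x)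
    (l : List (ℤ × W)) (hl : ∀ y ∈ l, y.2 ∈ grW y.1) :
    transferOperation par j h p dW (l.map Prod.snd) ∈
      grW ((l.map Prod.fst).sum + 2 - l.length) :=
  add_mem (onLetters_mem (s := 1) hc.target.d_mem l hl)
    (hc.p_mem (transferProduct_mem hc hmul hpar l hl))

theorem sum_initial_pairs {V : Type*} (x : ℕ → V) (n : ℕ → ℤ) (k : ℕ) :
    ((initial (fun r => (n r, x r)) k).map Prod.fst).sum = ∑ r ∈ Finset.range k, n r := by
  simp [initial, List.map_ofFn, Function.comp_def, List.sum_ofFn, Finset.sum_range]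

theorem map_snd_initial_pairs {V : Type*} (x : ℕ → V) (n : ℕ → ℤ) (k : ℕ) :
    (initial (fun r => (n r, x r)) k).map Prod.snd = initial x k := by
  simp [initial, List.map_ofFn, Function.comp_def]

theorem mem_initial_pairs {x : ℕ → W} {n : ℕ → ℤ} (hx : ∀ r, x r ∈ grW (n r)) (k : ℕ) :
    ∀ y ∈ initial (fun r => (n r, x r)) k, y.2 ∈ grW y.1 := by
  intro y hy
  obtain ⟨r, rfl⟩ := (List.mem_ofFn' _ _).1 hy
  exact hx r

theorem transferWords_initial_mem (hc : IsContraction grE D grW dW p j h)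
    (hmul : ∀ {m n : ℤ} {x y : E}, x ∈ grE m → y ∈ grE n → x * y ∈ grE (m + n))
    (hpar : ∀ {n : ℤ} {x : E}, x ∈ grE n → par x = (-1 : K) ^ n • x)
    {x : ℕ → W} {n : ℕ → ℤ} (hx : ∀ r, x r ∈ grW (n r)) (k : ℕ) :
    transferWords par j h (initial x k) ∈ grE (∑ r ∈ Finset.range k, n r + 1 - k) := by
  have := transferWords_mem hc hmul hpar _ (mem_initial_pairs hx k)
  rwa [sum_initial_pairs, map_snd_initial_pairs, length_initial] at this

theorem transferOperation_initial_mem (hc : IsContraction grE D grW dW p j h)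
    (hmul : ∀ {m n : ℤ} {x y : E}, x ∈ grE m → y ∈ grE n → x * y ∈ grE (m + n))
    (hpar : ∀ {n : ℤ} {x : E}, x ∈ grE n → par x = (-1 : K) ^ n • x)
    {x : ℕ → W} {n : ℕ → ℤ} (hx : ∀ r, x r ∈ grW (n r)) (k : ℕ) :
    transferOperation par j h p dW (initial x k) ∈
      grW (∑ r ∈ Finset.range k, n r + 2 - k) := by
  have := transferOperation_mem hc hmul hpar _ (mem_initial_pairs hx k)
  rwa [sum_initial_pairs, map_snd_initial_pairs, length_initial] at this

/-- If `γ_l` agrees with `transferWords` up to sign for `l < k`, then `β_k` agrees with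
`transferProduct` up to sign. -/
theorem transferBeta_eq_of_lt (hc : IsContraction grE D grW dW p j h)
    (hmul : ∀ {m n : ℤ} {x y : E}, x ∈ grE m → y ∈ grE n → x * y ∈ grE (m + n))
    (hpar : ∀ {n : ℤ} {x : E}, x ∈ grE n → par x = (-1 : K) ^ n • x) {k : ℕ}
    (ih : ∀ l < k, 1 ≤ l → ∀ (x : ℕ → W) (n : ℕ → ℤ), (∀ r, x r ∈ grW (n r)) →
      transferGamma j h l x n = (-1 : K) ^ wordSign l n • transferWords par j h (initial x l))
    (x : ℕ → W) (n : ℕ → ℤ) (hx : ∀ r, x r ∈ grW (n r)) :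
    transferBeta j h k x n = (-1 : K) ^ wordSign k n • transferProduct par j h (initial x k) := by
  have hne : (-1 : K) ≠ 0 := neg_ne_zero.2 one_ne_zero
  rw [transferProduct, convolution, splitSum_initial, transferBeta, Finset.smul_sum]
  have hsub : Finset.Ico 1 k ⊆ Finset.range (k + 1) := fun l hl => by
    rw [Finset.mem_Ico] at hl
    rw [Finset.mem_range]
    omega
  rw [← Finset.sum_subset hsub]
  · refine Finset.sum_congr rfl fun l hl => ?_
    rw [Finset.mem_Ico] at hl
    rw [ih l hl.2 hl.1 x n hx, ih (k - l) (by omega) (by omega) _ _ fun r => hx (l + r),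
      hpar (transferWords_initial_mem hc hmul hpar hx l)]
    simp only [smul_mul_assoc, mul_smul_comm, smul_smul, ← zpow_add₀ hne]
    congr 1
    -- With s the sum of the first l degrees and m = k - l, the sign of β_k contributes l - 1 + (m -
    -- 1) s. On the other side stand m s from `wordSign_add` and s + 1 - l from `par`. The
    -- difference is 2 (l - 1 - s).
    refine neg_one_zpow_congr ⟨(l : ℤ) - 1 - ∑ r ∈ Finset.range l, n r, ?_⟩
    obtain ⟨m, rfl⟩ := Nat.exists_eq_add_of_le hl.2.le
    rw [wordSign_add, Nat.add_sub_cancel_left]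
    push_cast
    ring
  -- The extra cuts, at the two ends of the word, contribute nothing because G vanishes on the empty
  -- word.
  · intro l hl hl'
    rw [Finset.mem_range] at hl
    rw [Finset.mem_Ico] at hl'
    obtain rfl | rfl : l = 0 ∨ l = k := by omega
    · simp [initial, transferWords_nil]
    · simp [initial, transferWords_nil]

theorem transferGamma_eq_transferWords (hc : IsContraction grE D grW dW p j h)
    (hmul : ∀ {m n : ℤ} {x y : E}, x ∈ grE m → y ∈ grE n → x * y ∈ grE (m + n))
    (hpar : ∀ {n : ℤ} {x : E}, x ∈ grE n → par x = (-1 : K) ^ n • x) (k : ℕ) (hk : 1 ≤ k)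
    (x : ℕ → W) (n : ℕ → ℤ) (hx : ∀ r, x r ∈ grW (n r)) :
    transferGamma j h k x n = (-1 : K) ^ wordSign k n • transferWords par j h (initial x k) := by
  induction k using Nat.strong_induction_on generalizing x n with
  | _ k ih =>
    rcases hk.eq_or_lt with rfl | hk'
    · have h1 : initial x 1 = [x 0] := by simp [initial]
      rw [transferGamma_one, wordSign_one, h1, transferWords_eq, transferProduct_singleton]
      simp [onLetters]
    · have h1 : initial x k = x 0 :: x 1 :: initial (fun r => x (r + 1 + 1)) (k - 2) := by
        obtain ⟨m, rfl⟩ := Nat.exists_eq_add_of_le' hk'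
        rw [Nat.add_sub_cancel, initial_succ, initial_succ]
      rw [transferGamma_eq j h hk', transferBeta_eq_of_lt hc hmul hpar ih x n hx, map_smul,
        transferWords_eq]
      rw [show onLetters (-j) (initial x k) = 0 by rw [h1]; rfl, zero_add]

theorem transferBeta_eq_transferProduct (hc : IsContraction grE D grW dW p j h)
    (hmul : ∀ {m n : ℤ} {x y : E}, x ∈ grE m → y ∈ grE n → x * y ∈ grE (m + n))
    (hpar : ∀ {n : ℤ} {x : E}, x ∈ grE n → par x = (-1 : K) ^ n • x) (k : ℕ)
    (x : ℕ → W) (n : ℕ → ℤ) (hx : ∀ r, x r ∈ grW (n r)) :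
    transferBeta j h k x n = (-1 : K) ^ wordSign k n • transferProduct par j h (initial x k) :=
  transferBeta_eq_of_lt hc hmul hpar
    (fun l _ hl => transferGamma_eq_transferWords hc hmul hpar l hl) x n hx

variable (par j h p dW) in
/-- The transferred operations `α_k`, for a parity map `π` of `W`. -/
def transferredMap (π : W →ₗ[K] W) (k : ℕ) : MultilinearMap K (fun _ : Fin k => W) W :=
  (isMultilinear_transferOperation (par := par) (j := j) (h := h) (p := p)
    (dW := dW)).toMultilinearMap k |>.compLinearMap fun r => π ^ (k - 1 - r)

variable {π : W →ₗ[K] W}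

/-- The power k - 1 - r of the linear map π in slot r produces the sign `wordSign` on homogeneous
arguments, while keeping the operation multilinear on all of W. -/
theorem transferredMap_apply (hπ : ∀ {n : ℤ} {x : W}, x ∈ grW n → π x = (-1 : K) ^ n • x)
    (k : ℕ) {x : ℕ → W} {n : ℕ → ℤ} (hx : ∀ r, x r ∈ grW (n r)) :
    transferredMap par j h p dW π k (fun r : Fin k => x r) =
      (-1 : K) ^ wordSign k n • transferOperation par j h p dW (initial x k) := by
  have hpow : ∀ (m : ℕ) (r : ℕ), (π ^ m) (x r) = (-1 : K) ^ ((m : ℤ) * n r) • x r := by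
    intro m r
    induction m with
    | zero => simp
    | succ m ih =>
      rw [pow_succ', Module.End.mul_apply, ih, map_smul, hπ (hx r), smul_smul,
        ← zpow_add₀ (neg_ne_zero.2 one_ne_zero)]
      congr 2
      push_cast
      ring
  have h1 : transferredMap par j h p dW π k (fun r : Fin k => x r) = transferOperation par j h p dW
      (initial (fun r => (π ^ (k - 1 - r)) (x r)) k) := rfl
  have h2 : initial (fun r => (π ^ (k - 1 - r)) (x r)) k =
      initial (fun r => (-1 : K) ^ (((k : ℤ) - 1 - r) * n r) • x r) k :=
    initial_congr fun r hr => by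
      rw [hpow]
      congr 3
      omega
  have h3 := isMultilinear_transferOperation (par := par) (j := j) (h := h) (p := p)
    (dW := dW) |>.map_smul_initial [] (fun r => (-1 : K) ^ (((k : ℤ) - 1 - r) * n r)) x k
  rw [List.append_nil, List.append_nil] at h3
  rw [h1, h2, h3, prod_neg_one_zpow, wordSign]

theorem transferredMap_mem (hc : IsContraction grE D grW dW p j h)
    (hmul : ∀ {m n : ℤ} {x y : E}, x ∈ grE m → y ∈ grE n → x * y ∈ grE (m + n))
    (hpar : ∀ {n : ℤ} {x : E}, x ∈ grE n → par x = (-1 : K) ^ n • x)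
    (hπ : ∀ {n : ℤ} {x : W}, x ∈ grW n → π x = (-1 : K) ^ n • x)
    (k : ℕ) {x : ℕ → W} {n : ℕ → ℤ} (hx : ∀ r, x r ∈ grW (n r)) :
    transferredMap par j h p dW π k (fun r : Fin k => x r) ∈
      grW (∑ r ∈ Finset.range k, n r + 2 - k) := by
  rw [transferredMap_apply hπ k hx]
  exact Submodule.smul_mem _ _ (transferOperation_initial_mem hc hmul hpar hx k)

theorem isTransferred_transferredMap (hc : IsContraction grE D grW dW p j h)
    (hmul : ∀ {m n : ℤ} {x y : E}, x ∈ grE m → y ∈ grE n → x * y ∈ grE (m + n))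
    (hpar : ∀ {n : ℤ} {x : E}, x ∈ grE n → par x = (-1 : K) ^ n • x)
    (hπ : ∀ {n : ℤ} {x : W}, x ∈ grW n → π x = (-1 : K) ^ n • x) :
    IsTransferred grW dW p j h (transferredMap par j h p dW π) where
  one x := by
    show transferOperation par j h p dW [(π ^ 0) (x 0)] = dW (x 0)
    rw [transferOperation, transferProduct_singleton]
    simp [onLetters]
  ge_two k hk x n hx := by
    have h1 : initial x k = x 0 :: x 1 :: initial (fun r => x (r + 1 + 1)) (k - 2) := by
      obtain ⟨m, rfl⟩ := Nat.exists_eq_add_of_le' hk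
      rw [Nat.add_sub_cancel, initial_succ, initial_succ]
    rw [transferredMap_apply hπ k hx, transferBeta_eq_transferProduct hc hmul hpar k x n hx,
      map_smul, transferOperation, show onLetters dW (initial x k) = 0 by rw [h1]; rfl, zero_add]

/-- A summand of the Stasheff identity, without signs. -/
theorem stasheff_term (hc : IsContraction grE D grW dW p j h)
    (hmul : ∀ {m n : ℤ} {x y : E}, x ∈ grE m → y ∈ grE n → x * y ∈ grE (m + n))
    (hpar : ∀ {n : ℤ} {x : E}, x ∈ grE n → par x = (-1 : K) ^ n • x)
    (hπ : ∀ {n : ℤ} {x : W}, x ∈ grW n → π x = (-1 : K) ^ n • x)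
    {k i l : ℕ} (hi : 1 ≤ i) (hl : l + i ≤ k) {x : ℕ → W} {n : ℕ → ℤ}
    (hx : ∀ r, x r ∈ grW (n r)) :
    (-1 : K) ^ (i * (k - i)) •
      (-1 : K) ^ ((l : ℤ) * (i + 1) + i * ∑ r ∈ Finset.range l, n r) •
        transferredMap par j h p dW π (k - i + 1) (fun r : Fin (k - i + 1) =>
          if (r : ℕ) < l then x r
          else if (r : ℕ) = l then
            transferredMap par j h p dW π i (fun s : Fin i => x (l + s))
          else x (r + i - 1)) =
    (-1 : K) ^ wordSign k n • transferOperation par j h p dW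
      ((initial x l).map (fun y => -π y) ++
        transferOperation par j h p dW (initial (fun r => x (l + r)) i) ::
          initial (fun r => x (l + i + r)) (k - (l + i))) := by
  have hne : (-1 : K) ≠ 0 := neg_ne_zero.2 one_ne_zero
  obtain ⟨m, rfl⟩ := Nat.exists_eq_add_of_le hl
  have hb := isMultilinear_transferOperation (par := par) (j := j) (h := h) (p := p) (dW := dW)
  -- The arguments of the outer operation, with the inner value in position l; `n'` lists their
  -- degrees, the inner one being shifted by 2 - i.
  let y : ℕ → W := fun r => if r < l then x r
    else if r = l then transferredMap par j h p dW π i (fun s : Fin i => x (l + s))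
    else x (r + i - 1)
  let n' : ℕ → ℤ := fun r => if r < l then n r
    else if r = l then ∑ s ∈ Finset.range i, n (l + s) + 2 - i
    else n (r + i - 1)
  have hy : ∀ r, y r ∈ grW (n' r) := by
    intro r
    simp only [y, n']
    split_ifs
    · exact hx r
    · exact transferredMap_mem hc hmul hpar hπ i fun r => hx (l + r)
    · exact hx _
  have h1 := transferredMap_apply (par := par) (j := j) (h := h) (p := p) (dW := dW) hπ
    (l + i + m - i + 1) hy
  have hk : l + i + m - i + 1 = l + (1 + m) := by omega
  have h2 : initial y (l + i + m - i + 1) =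
      initial x l ++ y l :: initial (fun r => x (l + i + r)) m := by
    rw [hk, initial_add, initial_congr (y := x) fun r hr => by simp [y, hr], add_comm 1 m,
      initial_succ]
    congr 2
    refine initial_congr fun r _ => ?_
    simp only [y]
    rw [if_neg (by omega), if_neg (by omega)]
    congr 1
    omega
  have h3 : y l = (-1 : K) ^ wordSign i (fun r => n (l + r)) •
      transferOperation par j h p dW (initial (fun r => x (l + r)) i) := by
    simp only [y, lt_irrefl, if_true, if_false]
    exact transferredMap_apply hπ i fun r => hx (l + r)
  -- The map -π is the parity of the suspension, in which a letter of degree n has degree n - 1.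
  have h4 : (initial x l).map (fun y => -π y) =
      initial (fun r => (-1 : K) ^ (n r - 1) • x r) l := by
    rw [initial, List.map_ofFn, initial]
    congr 1
    funext r
    simp [hπ (hx r), zpow_sub_one₀ hne]
  have h5 : wordSign (l + i + m - i + 1) n' = wordSign l n +
      wordSign m (fun r => n (l + i + r)) + m * (∑ s ∈ Finset.range i, n (l + s) + 2 - i) +
      (1 + m) * ∑ r ∈ Finset.range l, n r := by
    have e1 : ∑ r ∈ Finset.range l, n' r = ∑ r ∈ Finset.range l, n r :=
      Finset.sum_congr rfl fun r hr => by simp [n', Finset.mem_range.1 hr]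
    have e2 : wordSign l n' = wordSign l n := wordSign_congr fun r hr => by simp [n', hr]
    have e3 : wordSign m (fun r => n' (l + (1 + r))) = wordSign m (fun r => n (l + i + r)) :=
      wordSign_congr fun r _ => by
        simp only [n']
        rw [if_neg (by omega), if_neg (by omega)]
        congr 1
        omega
    rw [hk, wordSign_add, wordSign_add, wordSign_one, e1, e2, e3]
    simp [n']
    ring
  have h6 : wordSign (l + i + m) n = wordSign l n + wordSign i (fun r => n (l + r)) +
      wordSign m (fun r => n (l + i + r)) + m * ∑ s ∈ Finset.range i, n (l + s) +
      (i + m) * ∑ r ∈ Finset.range l, n r := by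
    rw [add_assoc, wordSign_add, wordSign_add]
    simp only [add_assoc]
    push_cast
    ring
  have h7 : ∑ r ∈ Finset.range l, (n r - 1) = ∑ r ∈ Finset.range l, n r - l := by simp
  rw [show (fun r : Fin (l + i + m - i + 1) => if (r : ℕ) < l then x r
    else if (r : ℕ) = l then transferredMap par j h p dW π i (fun s : Fin i => x (l + s))
    else x (r + i - 1)) = fun r : Fin (l + i + m - i + 1) => y r from rfl, h1, h2, h3, hb.smul, h4,
    hb.map_smul_initial, prod_neg_one_zpow, Nat.add_sub_cancel_left]
  simp only [smul_smul, ← zpow_natCast (-1 : K) (i * (l + i + m - i)), ← zpow_add₀ hne]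
  congr 1
  -- The degree terms agree on both sides. What remains is 2 i l + 2 l + 2 m, where m is the number
  -- of letters behind the inner operation.
  refine neg_one_zpow_congr ⟨i * l + l + m, ?_⟩
  rw [h5, h6, h7, show l + i + m - i = l + m by omega]
  push_cast
  ring

/-- Homotopy transfer of the product of a DG algebra along contraction data. -/
theorem exists_isTransferred (hc : IsContraction grE D grW dW p j h)
    (hmul : ∀ {m n : ℤ} {x y : E}, x ∈ grE m → y ∈ grE n → x * y ∈ grE (m + n))
    (hD : ∀ {n : ℤ} {x : E}, x ∈ grE n → ∀ y, D (x * y) = D x * y + (-1 : K) ^ n • (x * D y)) :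
    ∃ α : (k : ℕ) → MultilinearMap K (fun _ : Fin k => W) W,
      IsTransferred grW dW p j h α ∧ IsAInfinityAlgebra grW α := by
  have hE := hc.source.internal
  have hW := hc.target.internal
  have hpar : ∀ {n : ℤ} {x : E}, x ∈ grE n → parity hE x = (-1 : K) ^ n • x :=
    fun hx => parity_of_mem hE hx
  have hπ : ∀ {n : ℤ} {x : W}, x ∈ grW n → parity hW x = (-1 : K) ^ n • x :=
    fun hx => parity_of_mem hW hx
  have hpmul : ∀ x y, parity hE (x * y) = parity hE x * parity hE y := by
    intro x y
    induction x using internal_induction hE with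
    | h0 => simp
    | hadd x z hx hz => rw [add_mul, map_add, hx, hz, map_add, add_mul]
    | hP m x hx =>
      induction y using internal_induction hE with
      | h0 => simp
      | hadd y z hy hz => rw [mul_add, map_add, hy, hz, map_add, mul_add]
      | hP n y hy =>
        rw [hpar hx, hpar hy, hpar (hmul hx hy), zpow_add₀ (neg_ne_zero.2 one_ne_zero),
          smul_mul_smul_comm]
  have hDmul : ∀ x y, D (x * y) = D x * y + parity hE x * D y := by
    intro x y
    induction x using internal_induction hE with
    | h0 => simp
    | hadd x z hx hz => simp only [add_mul, map_add, hx, hz]; abel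
    | hP m x hx => rw [hD hx, hpar hx, smul_mul_assoc]
  have hDp := parity_odd hE hE odd_one hc.source.d_mem
  have hhp := parity_odd hE hE (s := -1) odd_neg_one hc.h_mem
  have hjp := parity_even hW hE hc.j_mem
  have hG := transferWords_map (par := parity hE) (j := j) (h := h)
    (π := fun y => - parity hW y) (parity_parity hE) hpmul (fun y => by rw [map_neg, hjp]) hhp
  have hsq := transferOperation_square hc (parity_parity hE) hpmul hDmul hDp hG
  have hb := isMultilinear_transferOperation (par := parity hE) (j := j) (h := h) (p := p)
    (dW := dW)
  refine ⟨transferredMap (parity hE) j h p dW (parity hW),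
    isTransferred_transferredMap hc hmul hpar hπ, hW, ?_, ?_⟩
  · intro k _ x n hx
    -- Padding by zero, which is homogeneous of every degree, gives a sequence as the lemmas
    -- require.
    let x' : ℕ → W := fun r => if hr : r < k then x ⟨r, hr⟩ else 0
    let n' : ℕ → ℤ := fun r => if hr : r < k then n ⟨r, hr⟩ else 0
    have hx' : ∀ r, x' r ∈ grW (n' r) := by
      intro r
      simp only [x', n']
      split_ifs
      · exact hx _
      · exact zero_mem _
    have := transferredMap_mem hc hmul hpar hπ k hx'
    simpa [x', n', Finset.sum_range] using this
  · intro k _ x n hx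
    have h1 := hsq (initial x k)
    simp only [wordDerivation, splitSum_initial] at h1
    -- The identity b ∘ b̂ = 0 sums over the length l of the prefix and then the length i of the
    -- inner word. The order is exchanged, and i = 0 drops out because b vanishes on the empty word.
    have h2 : ∑ i ∈ Finset.Icc 1 k, ∑ l ∈ Finset.range (k - i + 1),
        transferOperation (parity hE) j h p dW ((initial x l).map (fun y => -parity hW y) ++
          transferOperation (parity hE) j h p dW (initial (fun r => x (l + r)) i) ::
            initial (fun r => x (l + i + r)) (k - (l + i))) = 0 := by
      rw [← h1, Finset.sum_comm' (t' := Finset.range (k + 1)) (s' := fun l => Finset.Icc 1 (k - l))]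
      · refine Finset.sum_congr rfl fun l _ => ?_
        have hsub : Finset.Icc 1 (k - l) ⊆ Finset.range (k - l + 1) := fun i hi => by
          rw [Finset.mem_Icc] at hi
          rw [Finset.mem_range]
          omega
        rw [← Finset.sum_subset hsub]
        · exact Finset.sum_congr rfl fun i _ => by simp only [add_assoc, Nat.sub_sub]
        · intro i hi hi'
          rw [Finset.mem_range] at hi
          rw [Finset.mem_Icc] at hi'
          obtain rfl : i = 0 := by omega
          rw [show transferOperation (parity hE) j h p dW (initial (fun r => x (l + r)) 0) = 0 by
            simp [initial, transferOperation, onLetters, transferProduct_nil]]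
          exact hb.zero _ _
      · intro i l
        simp only [Finset.mem_Icc, Finset.mem_range]
        omega
    -- The total suspension sign does not depend on i and l, so it may multiply the whole identity,
    -- and the summands can be compared one by one.
    rw [← smul_zero ((-1 : K) ^ wordSign k n), ← h2, Finset.smul_sum]
    refine Finset.sum_congr rfl fun i hi => ?_
    rw [Finset.smul_sum, Finset.smul_sum]
    refine Finset.sum_congr rfl fun l hl => ?_
    rw [Finset.mem_Icc] at hi
    rw [Finset.mem_range] at hl
    exact stasheff_term hc hmul hpar hπ hi.1 (by omega) hx

end Transfer

end

/-! ### Assembly of the theorem. -/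

theorem mainTheorem2 {K A Q R : Type*} [Field K] [CharZero K] [Ring A] [Algebra K A]
    [AddCommGroup Q] [Module K Q] [Module A Q] [IsScalarTower K A Q]
    [AddCommGroup R] [Module K R] [Module A R] [IsScalarTower K A R]
    (𝔸 : CommDGAlgebra K A) (L : DGLieRinehart 𝔸 Q) (N : DGModule 𝔸 R)
    (C : LinearContraction L.toDGModule N)
    (e : GrSymAlg L.toDGModule ≃ₗ[K] UEnv L) (he : IsPBW L e) :
    -- the contraction data extend to the symmetric algebras
    IsContraction (GrSymAlg.gr L.toDGModule) (GrSymAlg.d L.toDGModule)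
      (GrSymAlg.gr N) (GrSymAlg.d N) C.symP.toLinearMap C.symJ.toLinearMap C.symH ∧
    -- all the maps preserve the filtrations
    (∀ k : ℤ,
      (∀ x ∈ GrSymAlg.filt L.toDGModule k,
        GrSymAlg.d L.toDGModule x ∈ GrSymAlg.filt L.toDGModule k ∧
        C.symP x ∈ GrSymAlg.filt N k ∧ C.symH x ∈ GrSymAlg.filt L.toDGModule k) ∧
      (∀ y ∈ GrSymAlg.filt N k,
        GrSymAlg.d N y ∈ GrSymAlg.filt N k ∧ C.symJ y ∈ GrSymAlg.filt L.toDGModule k)) ∧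
    -- the perturbation lowers the filtration
    (∀ k : ℤ, ∀ x ∈ GrSymAlg.filt L.toDGModule k,
      pbwPerturbation L e x ∈ GrSymAlg.filt L.toDGModule (k - 1)) ∧
    -- the perturbation lemma applies, and its formulas give contraction data for `U(Q)`
    ∃ hnil : IsLocallyNilpotent (pbwPerturbation L e ∘ₗ C.symH),
      IsContraction (UEnv.gr L) (UEnv.d L) (GrSymAlg.gr N) (C.pertD e hnil)
        (C.pertP e hnil) (C.pertJ e hnil) (C.pertH e hnil) ∧
      -- homotopy transfer of the product of `U(Q)` gives an `A∞`-algebra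
      ∃ α : (k : ℕ) → MultilinearMap K (fun _ : Fin k => GrSymAlg N) (GrSymAlg N),
        IsTransferred (GrSymAlg.gr N) (C.pertD e hnil) (C.pertP e hnil) (C.pertJ e hnil)
          (C.pertH e hnil) α ∧
        IsAInfinityAlgebra (GrSymAlg.gr N) α := by
  have hcontr := he.isContraction_pert C (he.isLocallyNilpotent C)
  refine ⟨C.isContraction_sym, fun k => ⟨fun x hx => ⟨?_, ?_, C.symH_mem_filt hx⟩,
    fun y hy => ⟨?_, ?_⟩⟩, fun k x hx => he.pbwPerturbation_mem_filt hx,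
    he.isLocallyNilpotent C, hcontr, ?_⟩
  · exact OddDerivation.toUEnv_mem_filt _ hx
  · exact GrSymAlg.map_mem_filt C.p_smul C.isContraction.p_mem hx
  · exact OddDerivation.toUEnv_mem_filt _ hy
  · exact GrSymAlg.map_mem_filt C.j_smul C.isContraction.j_mem hy
  · exact exists_isTransferred hcontr UEnv.mul_mem L.differential.toUEnv_mul_of_mem
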